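/- Let $A$ be a complete discrete valuation ring with field of fractions $\mathbb{K}$ of characteristic $0$ and residue class field of characteristic $p>0$, and let $\Omega\supseteq\mathbb{K}$ be an algebraically closed field. Let $G$ be a finite group, $K\trianglelefteq G$ and $H\le G$ with $G=HK$, and put $L=H\cap K$. Let $\theta\in\operatorname{Irr}_\Omega(K)$ and $\varphi\in\operatorname{Irr}_\Omega(L)$ be irreducible characters of $p$-defect zero (i.e. $|K|_p=\theta(1)_p$, $|L|_p=\varphi(1)_p$) such that 1. $n=(\theta_L,\varphi)>0$; 2. $\mathbb{K}(\theta)=\mathbb{K}(\varphi)=:\mathbb{L}$; 3. for every $h\in H$ there is $\gamma\in\operatorname{Gal}(\mathbb{L}/\mathbb{K})$ with $\theta^{h\gamma}=\theta$ and $\varphi^{h\gamma}=\varphi$, where $\chi^h(x)=\chi(hxh^{-1})$. Let $e_\theta\in\mathbb{L}K$ and $e_\varphi\in\mathbb{L}L$ be the central idempotents belonging to $\theta$ and $\varphi$, and put, with $\Gamma=\operatorname{Gal}(\mathbb{L}/\mathbb{K})$ acting on coefficients, $$e_{(\theta,\mathbb{K})}=\sum_{\gamma\in\Gamma}e_\theta^\gamma,\qquad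 e_{(\varphi,\mathbb{K})}=\sum_{\gamma\in\Gamma}e_\varphi^\gamma,\qquad i=\sum_{\gamma\in\Gamma}(e_\theta e_\varphi)^\gamma .$$ Let $S=(i\,\mathbb{K}K\,i)^L$ and $\Sigma=(i\,AK\,i)^L$ be the sets of elements of $i\,\mathbb{K}K\,i$ and $i\,AK\,i$ that are fixed under conjugation by $L$. Let $H$ act on $S$ by $s^h=h^{-1}sh$, and let $Z=\mathrm{Z}(S)$ and $Z_0=Z^H$. Let $\{E_{ab}\mid 1\le a,b\le n\}\subseteq\Sigma$ be a full set of matrix units (that is, $E_{ab}E_{cd}=\delta_{bc}E_{ad}$ and $\sum_aE_{aa}=i$), let $S_0=\sum_{a,b}Z_0E_{ab}$, and let $\varepsilon$ be the action of $H$ on $S=S_0Z$ given by $(s_0z)^{\varepsilon(h)}=s_0z^h$ for $s_0\in S_0$, $z\in Z$. Let $\sigma\colon H/L\to S^*$ be a magic crossed representation with respect to $S_0$, that is, $$\sigma(Lx)^{\varepsilon(y)}\sigma(Ly)=\sigma(Lxy)\quad\text{and}\quad s^x=\sigma(Lx)^{-1}\,s^{\varepsilon(x)}\,\sigma(Lx)\qquad(x,y\in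 H,\ s\in S),$$ where inverses are taken in $S$, whose identity is $i$. Then $e_{(\theta,\mathbb{K})}\in\mathrm{Z}(AG)$ and $e_{(\varphi,\mathbb{K})}\in\mathrm{Z}(AH)$, and there is an idempotent $j\in\Sigma=(i\,AK\,i)^L$ such that $j\in AG$ and: * there is an isomorphism of $A$-algebras $AH\,e_{(\varphi,\mathbb{K})}\to jAGj$ sending $h\,e_{(\varphi,\mathbb{K})}$ to $j\,h\,\sigma(Lh)^{-1}$ for every $h\in H$; * $AG\,j\,AG=AG\,e_{(\theta,\mathbb{K})}$. Moreover, the $A$-algebras $AG\,e_{(\theta,\mathbb{K})}$ and $AH\,e_{(\varphi,\mathbb{K})}$ are Morita equivalent. -/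

import Mathlib

noncomputable section

/-- For an idempotent `e` of an `A`-algebra `R`, the corner `eRe` is an `A`-algebra with
identity `e`. -/
instance cornerAlgebra {A R : Type*} [CommRing A] [Ring R] [Algebra A R] {e : R}
    (he : IsIdempotentElem e) : Algebra A he.Corner where
  smul a x := ⟨a • x.1, by
    obtain ⟨r, hr⟩ := x.2
    exact ⟨a • r, by simpa using congrArg (a • ·) hr⟩⟩
  algebraMap :=
    { toFun := fun a => ⟨a • e, a • e, by simp [he.eq]⟩
      map_one' := Subtype.ext (one_smul A e)
      map_mul' := fun a b => Subtype.ext (by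
        change (a * b) • e = (a • e) * (b • e)
        rw [smul_mul_smul_comm, he.eq])
      map_zero' := Subtype.ext (zero_smul A e)
      map_add' := fun a b => Subtype.ext (add_smul a b e) }
  commutes' a x := Subtype.ext (by
    obtain ⟨h1, h2⟩ := (Subsemigroup.mem_corner_iff he).mp x.2
    change (a • e) * x.1 = x.1 * (a • e)
    simp [h1, h2])
  smul_def' a x := Subtype.ext (by
    obtain ⟨h1, _⟩ := (Subsemigroup.mem_corner_iff he).mp x.2
    change a • x.1 = (a • e) * x.1
    simp [h1])

/-- The element `e * r * e` of the corner `eRe`. -/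
def toCorner {R : Type*} [Ring R] {e : R} (he : IsIdempotentElem e) (r : R) : he.Corner :=
  ⟨e * r * e, r, rfl⟩

namespace Magic

section Characters

/-- `χ` is the character of an irreducible (finite-dimensional) representation over `Ω`. -/
def IsIrreducibleCharacter (Ω : Type*) [Field Ω] {N : Type*} [Group N] (χ : N → Ω) : Prop :=
  ∃ (d : ℕ) (ρ : Representation Ω N (Fin d → Ω)), ρ.IsIrreducible ∧ ∀ x, ρ.character x = χ x

/-- `χ` has `p`-defect zero: its degree and the group order have the same `p`-part. -/
def HasDefectZero (p : ℕ) {F : Type*} [Field F] {N : Type*} [Group N] (χ : N → F) : Prop :=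
  ∃ d : ℕ, χ 1 = d ∧ padicValNat p d = padicValNat p (Nat.card N)

end Characters

variable (A 𝕜 Ω : Type*) {𝕃 : Type*} [CommRing A] [Field 𝕜] [Field 𝕃] [Field Ω]
  [Algebra A 𝕜] [Algebra 𝕜 𝕃] [Algebra A 𝕃] [Algebra 𝕃 Ω]
  {G : Type*} [Group G]

/-- The basic configuration. `θ` and `φ` are characters of `K` and `L = H ∩ K` over the
algebraically closed field `Ω`; they are written as functions to a field `𝕃` between `𝕜` and `Ω`,
and `𝕃` is the field of values of each of them over `𝕜`. -/
structure BasicConfiguration (p : ℕ) (K H : Subgroup G) (θ : K → 𝕃)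
    (φ : (H ⊓ K : Subgroup G) → 𝕃) (n : ℕ) : Prop where
  /-- `G = HK` -/
  factor : ∀ g : G, ∃ h ∈ H, ∃ k ∈ K, g = h * k
  irr_θ : IsIrreducibleCharacter Ω fun k => algebraMap 𝕃 Ω (θ k)
  irr_φ : IsIrreducibleCharacter Ω fun l => algebraMap 𝕃 Ω (φ l)
  /-- `𝕜(θ) = 𝕃` -/
  adjoin_θ : IntermediateField.adjoin 𝕜 (Set.range θ) = ⊤
  /-- `𝕜(φ) = 𝕃` -/
  adjoin_φ : IntermediateField.adjoin 𝕜 (Set.range φ) = ⊤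
  n_pos : 0 < n
  /-- `n = (θ_L, φ)` -/
  mult : (Nat.card (H ⊓ K : Subgroup G) : 𝕃)⁻¹ *
    ∑ᶠ l : (H ⊓ K : Subgroup G), θ ⟨l, l.2.2⟩ * φ l⁻¹ = n
  /-- For `h ∈ H` some `γ` in the Galois group satisfies `θ^{hγ} = θ` and `φ^{hγ} = φ`,
  where `χ^h (x) = χ (h x h⁻¹)`. -/
  semi_invariant : ∀ h ∈ H, ∃ γ : 𝕃 ≃ₐ[𝕜] 𝕃,
    (∀ k k' : K, (k' : G) = h * k * h⁻¹ → γ (θ k') = θ k) ∧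
    (∀ l l' : (H ⊓ K : Subgroup G), (l' : G) = h * l * h⁻¹ → γ (φ l') = φ l)
  defect_θ : HasDefectZero p θ
  defect_φ : HasDefectZero p φ

/-- The central idempotent `e_χ = (χ(1)/|N|) ∑ χ(x⁻¹) x` of `𝕃N`, as an element of `𝕃G`. -/
def charIdempotent (N : Subgroup G) (χ : N → 𝕃) : MonoidAlgebra 𝕃 G :=
  ∑ᶠ x : N, MonoidAlgebra.single (x : G) (χ 1 / (Nat.card N : 𝕃) * χ x⁻¹)

/-- The trace `∑ a^γ` over `γ ∈ Gal(𝕃/𝕜)`, where `γ` acts on the coefficients of `a ∈ 𝕃G`. -/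
def galoisTrace (a : MonoidAlgebra 𝕃 G) : MonoidAlgebra 𝕃 G :=
  ∑ᶠ γ : 𝕃 ≃ₐ[𝕜] 𝕃, MonoidAlgebra.mapRingHom G (γ : 𝕃 →+* 𝕃) a

/-- `e_(χ,𝕜)`, for a character `χ` with field of values `𝕜(χ) = 𝕃`. -/
def fieldIdempotent (N : Subgroup G) (χ : N → 𝕃) : MonoidAlgebra 𝕃 G :=
  galoisTrace 𝕜 (charIdempotent N χ)

/-- The idempotent `i = ∑ (e_θ e_φ)^γ`, the sum over `γ ∈ Gal(𝕃/𝕜)`. -/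
def idem (K H : Subgroup G) (θ : K → 𝕃) (φ : (H ⊓ K : Subgroup G) → 𝕃) : MonoidAlgebra 𝕃 G :=
  galoisTrace 𝕜 (charIdempotent K θ * charIdempotent (H ⊓ K) φ)

/-- The canonical map `RM → 𝕃G` of group algebras, for an algebra `𝕃` over `R` and a
homomorphism `M → G`. -/
def embed {R : Type*} [CommRing R] [Algebra R 𝕃] {M : Type*} [Group M] (ν : M →* G) :
    MonoidAlgebra R M →+* MonoidAlgebra 𝕃 G :=
  (MonoidAlgebra.mapDomainRingHom 𝕃 ν).comp (MonoidAlgebra.mapRingHom M (algebraMap R 𝕃))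

/-- The group element `g` in `𝕃G`. -/
def grp (g : G) : MonoidAlgebra 𝕃 G := MonoidAlgebra.single g 1

/-- `x^h = h⁻¹ x h`. -/
def conj (h : G) (x : MonoidAlgebra 𝕃 G) : MonoidAlgebra 𝕃 G := grp h⁻¹ * x * grp h

/-- `(i RK i)^L`. For `R = 𝕜` this is `S`, for `R = A` this is `Σ`. -/
def fixedCorner (R : Type*) [CommRing R] [Algebra R 𝕃] (K H : Subgroup G) (θ : K → 𝕃)
    (φ : (H ⊓ K : Subgroup G) → 𝕃) : Set (MonoidAlgebra 𝕃 G) :=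
  {x | (∃ a : MonoidAlgebra R K, x = idem 𝕜 K H θ φ * embed K.subtype a * idem 𝕜 K H θ φ) ∧
    ∀ l ∈ H ⊓ K, conj l x = x}

/-- The center `Z` of `S = (i 𝕜K i)^L`. -/
def centerS (K H : Subgroup G) (θ : K → 𝕃) (φ : (H ⊓ K : Subgroup G) → 𝕃) :
    Set (MonoidAlgebra 𝕃 G) :=
  {z | z ∈ fixedCorner 𝕜 𝕜 K H θ φ ∧ ∀ s ∈ fixedCorner 𝕜 𝕜 K H θ φ, z * s = s * z}

/-- `E` is a full set of `n × n` matrix units in `Σ = (i AK i)^L`. -/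
structure IsMatrixUnits (K H : Subgroup G) (θ : K → 𝕃) (φ : (H ⊓ K : Subgroup G) → 𝕃) {n : ℕ}
    (E : Fin n → Fin n → MonoidAlgebra 𝕃 G) : Prop where
  mem : ∀ a b, E a b ∈ fixedCorner 𝕜 A K H θ φ
  mul : ∀ a b c d, E a b * E c d = if b = c then E a d else 0
  sum : ∑ a, E a a = idem 𝕜 K H θ φ

/-- The subalgebra `S₀` of `S` spanned by the matrix units over `Z₀ = Z^H`. -/
def subalgebraS0 (K H : Subgroup G) (θ : K → 𝕃) (φ : (H ⊓ K : Subgroup G) → 𝕃) {n : ℕ}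
    (E : Fin n → Fin n → MonoidAlgebra 𝕃 G) : Set (MonoidAlgebra 𝕃 G) :=
  {s | ∃ z : Fin n → Fin n → MonoidAlgebra 𝕃 G,
    (∀ a b, z a b ∈ centerS 𝕜 K H θ φ ∧ ∀ h ∈ H, conj h (z a b) = z a b) ∧
    s = ∑ a, ∑ b, z a b * E a b}

/-- The action `ε` of `H` on `S` with `(s₀ z)^{ε(h)} = s₀ z^h` for `s₀ ∈ S₀` and `z ∈ Z`
(see `eps_mul`): conjugation by `h` is applied to the coordinates of `s` with respect to the
matrix units. -/
def eps {n : ℕ} (E : Fin n → Fin n → MonoidAlgebra 𝕃 G) (h : G) (s : MonoidAlgebra 𝕃 G) :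
    MonoidAlgebra 𝕃 G :=
  ∑ a, ∑ b, E a b * conj h (∑ c, E c a * s * E b c)

theorem fixedCorner_subset [IsScalarTower A 𝕜 𝕃] (K H : Subgroup G) (θ : K → 𝕃)
    (φ : (H ⊓ K : Subgroup G) → 𝕃) :
    fixedCorner 𝕜 A K H θ φ ⊆ fixedCorner 𝕜 𝕜 K H θ φ := by
  rintro x ⟨⟨a, rfl⟩, hx⟩
  refine ⟨⟨MonoidAlgebra.mapRingHom K (algebraMap A 𝕜) a, ?_⟩, hx⟩
  have : (embed K.subtype (MonoidAlgebra.mapRingHom K (algebraMap A 𝕜) a) : MonoidAlgebra 𝕃 G)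
      = embed K.subtype a := by
    simp only [embed, RingHom.comp_apply]
    congr 1
    ext k
    simp [← IsScalarTower.algebraMap_apply A 𝕜 𝕃]
  rw [this]

theorem eps_mul [IsScalarTower A 𝕜 𝕃] {K H : Subgroup G} {θ : K → 𝕃}
    {φ : (H ⊓ K : Subgroup G) → 𝕃} {n : ℕ} {E : Fin n → Fin n → MonoidAlgebra 𝕃 G}
    (hE : IsMatrixUnits A 𝕜 K H θ φ E) {s z : MonoidAlgebra 𝕃 G}
    (hs : s ∈ subalgebraS0 𝕜 K H θ φ E) (hz : z ∈ centerS 𝕜 K H θ φ) {h : G} (hh : h ∈ H) :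
    eps E h (s * z) = s * conj h z := by
  obtain ⟨w, hw, rfl⟩ := hs
  have hES : ∀ a b, E a b ∈ fixedCorner 𝕜 𝕜 K H θ φ := fun a b =>
    fixedCorner_subset A 𝕜 K H θ φ (hE.mem a b)
  have hwE : ∀ a b c d, w a b * E c d = E c d * w a b := fun a b c d =>
    (hw a b).1.2 _ (hES c d)
  have hzE : ∀ c d, z * E c d = E c d * z := fun c d => hz.2 _ (hES c d)
  have hi : idem 𝕜 K H θ φ * idem 𝕜 K H θ φ = idem 𝕜 K H θ φ := by
    rw [← hE.sum, Finset.sum_mul_sum]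
    simp [hE.mul]
  have hzi : z * idem 𝕜 K H θ φ = z := by
    obtain ⟨⟨⟨a, rfl⟩, -⟩, -⟩ := hz
    simp only [mul_assoc, hi]
  have hconj : ∀ x y : MonoidAlgebra 𝕃 G, conj h (x * y) = conj h x * conj h y := by
    intro x y
    have h1 : (grp h * grp h⁻¹ : MonoidAlgebra 𝕃 G) = 1 := by
      simp [grp, MonoidAlgebra.single_mul_single, MonoidAlgebra.one_def]
    calc conj h (x * y) = grp h⁻¹ * x * 1 * y * grp h := by simp [conj, mul_assoc]
      _ = conj h x * conj h y := by rw [← h1]; simp [conj, mul_assoc]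
  have hcoord : ∀ a b, ∑ c, E c a * ((∑ a', ∑ b', w a' b' * E a' b') * z) * E b c
      = w a b * z := by
    intro a b
    have key : ∀ c, E c a * ((∑ a', ∑ b', w a' b' * E a' b') * z) * E b c
        = w a b * z * E c c := by
      intro c
      have h2 : ∀ a' b', E c a * (w a' b' * E a' b' * z) * E b c
          = if a = a' then (if b' = b then w a' b' * z * E c c else 0) else 0 := by
        intro a' b'
        have : E c a * (w a' b' * E a' b' * z) * E b c
            = w a' b' * z * (E c a * E a' b' * E b c) := by
          calc E c a * (w a' b' * E a' b' * z) * E b c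
              = E c a * w a' b' * (E a' b' * z) * E b c := by simp only [mul_assoc]
            _ = w a' b' * (E c a * z) * (E a' b' * E b c) := by
                rw [← hwE, ← hzE]; simp only [mul_assoc]
            _ = _ := by rw [← hzE]; simp only [mul_assoc]
        rw [this, hE.mul]
        split_ifs <;> simp_all [hE.mul]
      simp only [Finset.sum_mul, Finset.mul_sum, h2]
      simp
    rw [Finset.sum_congr rfl fun c _ => key c, ← Finset.mul_sum, hE.sum, mul_assoc, hzi]
  unfold eps
  simp only [hcoord, hconj, (hw _ _).2 h hh]
  simp only [Finset.sum_mul]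
  refine Finset.sum_congr rfl fun a _ => Finset.sum_congr rfl fun b _ => ?_
  rw [← mul_assoc, ← hwE]

/-- A magic crossed representation `σ : H/L → S`, with respect to the action `ε` defined by the
matrix units `E`. The values `σ(x)` are units of `S`, with inverses `σ.inv x`. -/
structure MagicCrossedRepresentation (K H : Subgroup G) [K.Normal] (θ : K → 𝕃)
    (φ : (H ⊓ K : Subgroup G) → 𝕃) {n : ℕ} (E : Fin n → Fin n → MonoidAlgebra 𝕃 G) where
  toFun : H ⧸ K.subgroupOf H → MonoidAlgebra 𝕃 G
  inv : H ⧸ K.subgroupOf H → MonoidAlgebra 𝕃 G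
  mem : ∀ x, toFun x ∈ fixedCorner 𝕜 𝕜 K H θ φ
  inv_mem : ∀ x, inv x ∈ fixedCorner 𝕜 𝕜 K H θ φ
  mul_inv : ∀ x, toFun x * inv x = idem 𝕜 K H θ φ
  inv_mul : ∀ x, inv x * toFun x = idem 𝕜 K H θ φ
  /-- `σ(x)^{ε(y)} σ(y) = σ(xy)` -/
  crossed : ∀ x y : H, eps E (y : G) (toFun x) * toFun y = toFun (x * y : H)
  /-- `s^x = s^{ε(x)σ(x)}` -/
  conj_eq : ∀ x : H, ∀ s ∈ fixedCorner 𝕜 𝕜 K H θ φ,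
    conj (x : G) s = inv x * eps E (x : G) s * toFun x

end Magic


end

open Magic

/-!
Write `c = θ(1)/|K|`, `c' = φ(1)/|L|`, `f = e_θ e_φ`, and let `𝒪` be the integral closure of `A` in
`𝕃`. As `A` is complete, `𝒪` is a valuation ring, invariant under `Gal(𝕃/𝕜)`
(`exists_valuationSubring_of_isAdicComplete`, `ValuationSubring.valuation_algEquiv_eq`). Defect zero
means that `c` and `c'` are units of `A`; so `e_θ`, `e_φ` and `f` have coefficients in `𝒪`, and the
Galois traces `e_(θ)`, `e_(φ)` and `i` have coefficients in `A`. Everything that is needed about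
characters is contained in the predicate `IsSchurIdempotent` on `(c, e_θ)` and `(c', e_φ)`, whose
main clause says that class sums act as scalars on the block of `e`. The trace on a group algebra is
the coefficient at the identity.

*Coordinates.* Let `w = E o o * f`. All the `E a a * f` have the same trace `c c' |L|`, and the
trace of the projection `y ↦ |L|⁻¹ ∑ w l⁻¹ y l w` of `𝕃K` onto `w (𝕃K)^L w` turns out to be the
square of `tr(w) / (c c' |L|)`, so that this corner is `𝕃 w` (`exists_eq_smul_of_coeff_one`). Hence
every `s` in `S = (i 𝕜K i)^L` has coordinates in `𝕃`, with `s f = ∑ coord s a b • E a b f`, and `s`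
is the Galois trace of `s f`. The coordinates are integral if and only if `s` has coefficients in
`A` (`IsBlockPair.coord_mem`, `IsBlockPair.memCorner_of_coord_mem`), because the idempotent `w` has
a coefficient that is a unit of `𝒪` (`exists_valuation_coeff_eq_one`). In coordinates, `ε(h)` is
the entrywise application of a Galois automorphism (`IsBlockPair.coord_eps`), so it preserves
valuations.

*Integrality of `σ`.* If all coordinates of `σ(x)` were in the maximal ideal, then so would be those
of all `σ(x ^ k)`, and in particular those of `σ(1) = i`. On the other hand, as `s ↦ σ(x)⁻¹ s σ(x)`
maps the `E a b` to `(E a b) ^ x`, which has integral coordinates, the products of a coordinate of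
`σ(x)⁻¹` and one of `σ(x)` are integral. Thus `σ(x)⁻¹` is integral, and then so is
`σ(x) = (σ(x⁻¹)⁻¹) ^ ε(x)` (`IsBlockPair.tau_mem`, `IsBlockPair.sigma_mem`).

*The isomorphism.* The elements `x σ(x)⁻¹` form a group that centralizes the `E a b`. So with
`j = E o o`, the map `x ↦ j x σ(x)⁻¹` extends to a homomorphism `AH → jAGj` of algebras. It is
injective on `AH e_(φ)` since it multiplies traces on this ideal by `c / c'`
(`IsBlockPair.coeff_one_twisted`). It is surjective because `j x k j = j x σ(x)⁻¹ · j σ(x) k j`, and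
`jAKj = j · AL` (`IsBlockPair.exists_eq_mul_of_corner`); the latter follows by expanding `f y`, for
`y` in `jAKj`, with respect to the dual bases `L` and `L⁻¹` of the trace form.

*Morita equivalence.* As `f` has a unit coefficient and `c` is a unit, a suitable class sum shows
that `e_(θ)` is in the ideal generated by `i` (`IsBlockPair.exists_sum_conj_eq`), and hence in
`AG j AG`. So `j` is a full idempotent of `AG e_(θ)`, and `M ↦ jM` is an equivalence of module
categories (`isMoritaEquivalent_corner_corner`).
-/

noncomputable section

/-! ### Integers in extensions of complete discretely valued fields -/

/-- A finite module over an adically complete ring is precomplete. -/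
theorem IsPrecomplete.of_finite {R M : Type*} [CommRing R] (I : Ideal R) [IsAdicComplete I R]
    [AddCommGroup M] [Module R M] [Module.Finite R M] : IsPrecomplete I M := by
  rw [← AdicCompletion.of_surjective_iff]
  intro x
  obtain ⟨t, rfl⟩ := AdicCompletion.ofTensorProduct_surjective_of_finite I M x
  induction t using TensorProduct.induction_on with
  | zero => exact ⟨0, by simp⟩
  | add a b ha hb =>
    obtain ⟨x, hx⟩ := ha
    obtain ⟨y, hy⟩ := hb
    exact ⟨x + y, by rw [map_add, map_add, hx, hy]⟩
  | tmul r m =>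
    obtain ⟨r, rfl⟩ := AdicCompletion.of_surjective I R r
    refine ⟨r • m, ?_⟩
    rw [AdicCompletion.ofTensorProduct_tmul, map_smul]
    exact (algebraMap_smul (AdicCompletion I R) r (AdicCompletion.of I M m)).symm

/-- A domain which is module-finite over a complete Noetherian local ring is local: a
decomposition of the closed fibre would lift to a nontrivial idempotent. -/
theorem isLocalRing_of_finite_of_isAdicComplete {A B : Type*} [CommRing A] [IsLocalRing A]
    [IsNoetherianRing A] [IsAdicComplete (IsLocalRing.maximalIdeal A) A] [CommRing B] [IsDomain B]
    [Algebra A B] [Module.Finite A B] : IsLocalRing B := by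
  set J := (IsLocalRing.maximalIdeal A).map (algebraMap A B) with hJ
  have h1 : IsPrecomplete (IsLocalRing.maximalIdeal A) B := IsPrecomplete.of_finite _
  have h2 : IsHausdorff (IsLocalRing.maximalIdeal A) B := inferInstance
  rw [← IsPrecomplete.map_algebraMap_iff (S := B)] at h1
  rw [← IsHausdorff.map_algebraMap_iff (S := B)] at h2
  have hcomp : IsAdicComplete J B := { h1, h2 with }
  have hjac : J ≤ Ideal.jacobson ⊥ := IsAdicComplete.le_jacobson_bot J
  have hart : IsArtinianRing (B ⧸ J) :=
    have : Module.Finite (A ⧸ IsLocalRing.maximalIdeal A) (B ⧸ J) := inferInstance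
    have : IsArtinianRing (A ⧸ IsLocalRing.maximalIdeal A) :=
      inferInstanceAs (IsArtinianRing (IsLocalRing.ResidueField A))
    isArtinian_of_tower (A ⧸ IsLocalRing.maximalIdeal A) inferInstance
  have hunit : ∀ b : B, IsUnit (Ideal.Quotient.mk J b) → IsUnit b := by
    intro b hb
    have := isLocalHom_of_le_jacobson_bot J hjac
    exact isUnit_of_map_unit (Ideal.Quotient.mk J) b hb
  refine IsLocalRing.of_isUnit_or_isUnit_one_sub_self fun b => ?_
  -- Fitting: `b ^ k` generates an ideal of `B ⧸ J` that has an idempotent generator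
  obtain ⟨k, y, hy⟩ := IsArtinian.exists_pow_succ_smul_dvd (Ideal.Quotient.mk J b) (1 : B ⧸ J)
  set x := Ideal.Quotient.mk J b with hx
  have hxk : ∀ m, x ^ k * (x * y) ^ m = x ^ k := by
    intro m
    induction m with
    | zero => simp
    | succ m ih =>
      rw [pow_succ, ← mul_assoc, ih, ← mul_assoc, ← pow_succ]
      simpa using hy
  obtain ⟨e, he⟩ := Ideal.Quotient.mk_surjective (I := J) ((x * y) ^ k)
  have hid : (x * y) ^ k * (x * y) ^ k = (x * y) ^ k := by
    nth_rewrite 1 3 [mul_pow]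
    rw [mul_right_comm, hxk]
  obtain ⟨e', he', hee'⟩ := HenselianRing.is_henselian (I := J) (Polynomial.X ^ 2 - Polynomial.X)
    (by monicity!) e (by
      rw [← Ideal.Quotient.eq_zero_iff_mem]
      simp [he, pow_two, hid]) (by
      have hd : (Polynomial.derivative (Polynomial.X ^ 2 - Polynomial.X : Polynomial B)).eval e
          = 2 * e - 1 := by simp [one_add_one_eq_two]
      rw [hd, map_sub, map_mul, he, map_one, map_ofNat]
      refine IsUnit.of_mul_eq_one (2 * (x * y) ^ k - 1) ?_
      linear_combination 4 * hid)
  have heq : Ideal.Quotient.mk J e' = (x * y) ^ k := by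
    rw [← he]; exact (Ideal.Quotient.eq).mpr hee'
  have hroot : e' * (e' - 1) = 0 := by
    have := he'
    simp only [Polynomial.IsRoot.def, Polynomial.eval_sub, Polynomial.eval_pow,
      Polynomial.eval_X] at this
    linear_combination this
  rcases mul_eq_zero.mp hroot with h0 | h0
  · right
    rw [h0, map_zero] at heq
    have hnil : x ^ k = 0 := by rw [← hxk k, ← heq, mul_zero]
    exact hunit _ (by simpa [hx] using IsNilpotent.isUnit_one_sub ⟨k, hnil⟩)
  · left
    rw [sub_eq_zero.mp h0, map_one] at heq
    refine hunit _ ?_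
    rcases Nat.eq_zero_or_pos k with rfl | hk
    · exact IsUnit.of_mul_eq_one y (by simpa using hy)
    · exact isUnit_of_mul_isUnit_left ((isUnit_pow_iff hk.ne').mp (heq ▸ isUnit_one))

/-- In a finite separable extension of a complete discretely valued field, the elements integral
over the valuation ring form a valuation ring. -/
theorem exists_valuationSubring_of_isAdicComplete (A 𝕜 𝕃 : Type*) [CommRing A] [IsDomain A]
    [IsDiscreteValuationRing A] [IsAdicComplete (IsLocalRing.maximalIdeal A) A]
    [Field 𝕜] [Algebra A 𝕜] [IsFractionRing A 𝕜]
    [Field 𝕃] [Algebra 𝕜 𝕃] [Algebra A 𝕃] [IsScalarTower A 𝕜 𝕃] [FiniteDimensional 𝕜 𝕃]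
    [Algebra.IsSeparable 𝕜 𝕃] : ∃ 𝒪 : ValuationSubring 𝕃, ∀ x, x ∈ 𝒪 ↔ IsIntegral A x := by
  have hfin : Module.Finite A (integralClosure A 𝕃) :=
    IsIntegralClosure.finite A 𝕜 𝕃 (integralClosure A 𝕃)
  have hfrac : IsFractionRing (integralClosure A 𝕃) 𝕃 :=
    integralClosure.isFractionRing_of_finite_extension 𝕜 𝕃
  have hded : IsDedekindDomain (integralClosure A 𝕃) :=
    IsIntegralClosure.isDedekindDomain A 𝕜 𝕃 (integralClosure A 𝕃)
  have hloc : IsLocalRing (integralClosure A 𝕃) :=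
    isLocalRing_of_finite_of_isAdicComplete (A := A)
  have hpir : IsPrincipalIdealRing (integralClosure A 𝕃) := inferInstance
  have hval : ValuationRing (integralClosure A 𝕃) :=
    ValuationRing.iff_local_bezout_domain.mpr ⟨hloc, inferInstance⟩
  refine ⟨{ (integralClosure A 𝕃).toSubring with
      mem_or_inv_mem' := fun x => ?_ }, fun x => Iff.rfl⟩
  rcases ValuationRing.isInteger_or_isInteger (integralClosure A 𝕃) x with ⟨y, hy⟩ | ⟨y, hy⟩
  · left; rw [← hy]; exact y.2
  · right; rw [← hy]; exact y.2

/-- The valuation is invariant under automorphisms, because these have finite order and preserve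
integrality. -/
theorem ValuationSubring.valuation_algEquiv_eq {A 𝕜 𝕃 : Type*} [CommRing A] [Field 𝕜]
    [Algebra A 𝕜] [Field 𝕃] [Algebra 𝕜 𝕃] [Algebra A 𝕃] [IsScalarTower A 𝕜 𝕃]
    [FiniteDimensional 𝕜 𝕃] {𝒪 : ValuationSubring 𝕃}
    (h𝒪 : ∀ x, x ∈ 𝒪 ↔ IsIntegral A x) (τ : 𝕃 ≃ₐ[𝕜] 𝕃) (x : 𝕃) :
    𝒪.valuation (τ x) = 𝒪.valuation x := by
  have hmem : ∀ (τ : 𝕃 ≃ₐ[𝕜] 𝕃) y, y ∈ 𝒪 → τ y ∈ 𝒪 := fun τ y hy =>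
    (h𝒪 _).mpr (((h𝒪 _).mp hy).map (τ.restrictScalars A))
  have hmono : ∀ (τ : 𝕃 ≃ₐ[𝕜] 𝕃) a b, 𝒪.valuation a ≤ 𝒪.valuation b →
      𝒪.valuation (τ a) ≤ 𝒪.valuation (τ b) := by
    intro τ a b hab
    rw [ValuationSubring.valuation_le_iff] at hab ⊢
    obtain ⟨c, hc⟩ := hab
    exact ⟨⟨τ c, hmem τ _ c.2⟩, by rw [← hc, map_mul]⟩
  have hord : ∃ m : ℕ, 0 < m ∧ τ ^ m = 1 :=
    have : Finite (𝕃 ≃ₐ[𝕜] 𝕃) := inferInstance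
    ⟨orderOf τ, orderOf_pos τ, pow_orderOf_eq_one τ⟩
  obtain ⟨m, hm, hτm⟩ := hord
  have hsucc : ∀ k : ℕ, (τ ^ (k + 1)) x = (τ ^ k) (τ x) := fun k => by
    rw [pow_succ, AlgEquiv.mul_apply]
  have hstrict : ∀ (k : ℕ) a b, 𝒪.valuation a < 𝒪.valuation b →
      𝒪.valuation ((τ ^ k) a) < 𝒪.valuation ((τ ^ k) b) := fun k a b hab =>
    lt_of_not_ge fun h => (not_le_of_gt hab) (by
      have := hmono (τ ^ k)⁻¹ _ _ h
      rwa [AlgEquiv.aut_inv, AlgEquiv.symm_apply_apply, AlgEquiv.symm_apply_apply] at this)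
  refine le_antisymm ?_ ?_
  · by_contra! hlt
    have := strictMono_nat_of_lt_succ (f := fun k => 𝒪.valuation ((τ ^ k) x))
      (fun k => by simpa only [hsucc] using hstrict k _ _ hlt) hm
    simp [hτm] at this
  · by_contra! hlt
    have := strictAnti_nat_of_succ_lt (f := fun k => 𝒪.valuation ((τ ^ k) x))
      (fun k => by simpa only [hsucc] using hstrict k _ _ hlt) hm
    simp [hτm] at this

/-! ### Representations over algebraically closed fields -/

namespace Representation

variable {k N V : Type*} [Field k] [IsAlgClosed k] [Group N] [AddCommGroup V] [Module k V]
  [FiniteDimensional k V] (ρ : Representation k N V)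

/-- The functional equation of an irreducible character. -/
theorem IsIrreducible.card_mul_character_mul_character [Fintype N] [ρ.IsIrreducible] (x y : N) :
    (Nat.card N : k) * (ρ.character x * ρ.character y)
      = ρ.character 1 * ∑ l : N, ρ.character (l⁻¹ * x * l * y) := by
  let T : V →ₗ[k] V := ∑ l : N, ρ (l⁻¹ * x * l)
  have hT : ∀ (g : N) (v : V), T (ρ g v) = ρ g (T v) := by
    intro g v
    simp only [T, LinearMap.sum_apply, map_sum]
    refine Fintype.sum_equiv (Equiv.mulRight g) _ _ fun l => ?_
    simp only [Equiv.coe_mulRight, ← Module.End.mul_apply, ← map_mul]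
    congr 2
    group
  obtain ⟨a, ha⟩ := (IsIrreducible.algebraMap_intertwiningMap_bijective_of_isAlgClosed
    (ρ := ρ)).2 (T.intertwiningMap_of_isIntertwiningMap ρ ρ hT)
  have hTa : T = a • LinearMap.id := by
    have := congrArg IntertwiningMap.toLinearMap ha
    rw [Algebra.algebraMap_eq_smul_one] at this
    exact this.symm
  have h1 : (Nat.card N : k) * ρ.character x = ρ.character 1 * a := by
    have := congrArg (LinearMap.trace k V) hTa
    simp only [T, map_sum, map_smul, LinearMap.trace_id, smul_eq_mul] at this
    rw [char_one, mul_comm _ a, ← this, Nat.card_eq_fintype_card, ← nsmul_eq_mul,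
      ← Finset.card_univ, ← Finset.sum_const]
    refine Finset.sum_congr rfl fun l _ => ?_
    have := ρ.char_conj x l⁻¹
    rw [inv_inv] at this
    exact this.symm
  have h2 : ∑ l : N, ρ.character (l⁻¹ * x * l * y) = a * ρ.character y := by
    have : T * ρ y = a • ρ y := by rw [hTa]; rfl
    have := congrArg (LinearMap.trace k V) this
    simp only [T, Finset.sum_mul, map_sum, ← map_mul, map_smul, smul_eq_mul] at this
    exact this
  rw [h2, ← mul_assoc, h1, mul_assoc]

/-- The values of a character are sums of roots of unity. -/
theorem character_mem_of_pow_eq_one (P : AddSubmonoid k)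
    (hP : ∀ z : k, z ^ Nat.card N = 1 → z ∈ P) (x : N) : ρ.character x ∈ P := by
  rw [character, Module.End.trace_eq_sum_roots_charpoly_of_splits (IsAlgClosed.splits _)]
  refine multiset_sum_mem _ fun z hz => hP z ?_
  have hz' := (Module.End.hasEigenvalue_iff_isRoot_charpoly (ρ x) z).mpr
    (Polynomial.isRoot_of_mem_roots hz)
  obtain ⟨v, hv⟩ := hz'.exists_hasEigenvector
  have h1 := hv.pow_apply (Nat.card N)
  rw [← map_pow, pow_card_eq_one', map_one, Module.End.one_apply] at h1
  have h2 : (z ^ Nat.card N - 1) • v = 0 := by rw [sub_smul, ← h1, one_smul, sub_self]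
  exact sub_eq_zero.mp ((smul_eq_zero.mp h2).resolve_right hv.2)

end Representation

namespace Magic

/-! ### Group algebras, subrings of elements with given support, and Schur idempotents -/

section GroupAlgebra

open MonoidAlgebra

variable {F G : Type*} [Field F] [Group G]

theorem coeff_one_mul_comm (x y : MonoidAlgebra F G) : (x * y).coeff 1 = (y * x).coeff 1 := by
  rw [coeff_mul_apply_left, coeff_mul_apply_right]
  simp [mul_comm]

theorem grp_mul_grp (g h : G) : (grp g * grp h : MonoidAlgebra F G) = grp (g * h) := by
  simp [grp, single_mul_single]

theorem grp_one : (grp 1 : MonoidAlgebra F G) = 1 := rfl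

@[simp] theorem grp_mul_grp_inv (g : G) : (grp g * grp g⁻¹ : MonoidAlgebra F G) = 1 := by
  rw [grp_mul_grp, mul_inv_cancel, grp_one]

@[simp] theorem grp_inv_mul_grp (g : G) : (grp g⁻¹ * grp g : MonoidAlgebra F G) = 1 := by
  rw [grp_mul_grp, inv_mul_cancel, grp_one]

theorem conj_mul (h : G) (x y : MonoidAlgebra F G) : conj h (x * y) = conj h x * conj h y := by
  calc conj h (x * y) = grp h⁻¹ * x * 1 * y * grp h := by simp [conj, mul_assoc]
    _ = conj h x * conj h y := by rw [← grp_mul_grp_inv h]; simp only [conj, mul_assoc]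

theorem conj_conj (g h : G) (x : MonoidAlgebra F G) : conj h (conj g x) = conj (g * h) x := by
  simp only [conj, mul_inv_rev, ← grp_mul_grp, mul_assoc]

theorem grp_mul_conj (h : G) (x : MonoidAlgebra F G) : grp h * conj h x = x * grp h := by
  rw [conj, ← mul_assoc, ← mul_assoc, grp_mul_grp_inv, one_mul]

theorem conj_eq_iff (h : G) (x y : MonoidAlgebra F G) : conj h x = y ↔ x * grp h = grp h * y := by
  constructor
  · rintro rfl
    rw [grp_mul_conj]
  · intro hxy
    rw [conj, mul_assoc, hxy, ← mul_assoc, grp_inv_mul_grp, one_mul]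

theorem coeff_mul_grp (x : MonoidAlgebra F G) (g h : G) :
    (x * grp g).coeff h = x.coeff (h * g⁻¹) := by simp [grp]

theorem coeff_grp_mul (x : MonoidAlgebra F G) (g h : G) :
    (grp g * x).coeff h = x.coeff (g⁻¹ * h) := by simp [grp]

theorem coeff_conj (x : MonoidAlgebra F G) (g h : G) :
    (conj g x).coeff h = x.coeff (g * h * g⁻¹) := by
  rw [conj, coeff_mul_grp, coeff_grp_mul, inv_inv, mul_assoc]

/-- `conj h` as a linear map. -/
def conjₗ (h : G) : MonoidAlgebra F G →ₗ[F] MonoidAlgebra F G :=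
  LinearMap.mulRight F (grp h) ∘ₗ LinearMap.mulLeft F (grp h⁻¹)

@[simp] theorem conjₗ_apply (h : G) (x : MonoidAlgebra F G) : conjₗ h x = conj h x := rfl

theorem conj_sum {ι : Type*} (s : Finset ι) (h : G) (x : ι → MonoidAlgebra F G) :
    conj h (∑ i ∈ s, x i) = ∑ i ∈ s, conj h (x i) := map_sum (conjₗ h) x s

theorem conj_add (h : G) (x y : MonoidAlgebra F G) : conj h (x + y) = conj h x + conj h y :=
  map_add (conjₗ h) x y

theorem conj_zero (h : G) : conj h (0 : MonoidAlgebra F G) = 0 := map_zero (conjₗ h)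

theorem conj_smul (h : G) (a : F) (x : MonoidAlgebra F G) : conj h (a • x) = a • conj h x :=
  map_smul (conjₗ h) a x

/-- The subring of `FG` of the elements with coefficients in `T` and support in `N`, that is,
the image of `TN`. -/
def coeffSubring (T : Subring F) (N : Subgroup G) : Subring (MonoidAlgebra F G) where
  carrier := {x | ∀ g, x.coeff g ∈ T ∧ (g ∉ N → x.coeff g = 0)}
  mul_mem' := by
    intro x y hx hy g
    rw [coeff_mul_apply_left]
    refine ⟨sum_mem fun h _ => mul_mem (hx h).1 (hy _).1,
      fun hg => Finset.sum_eq_zero fun h _ => ?_⟩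
    by_cases hh : h ∈ N
    · change x.coeff h * y.coeff (h⁻¹ * g) = 0
      rw [(hy (h⁻¹ * g)).2 fun h' => hg (by simpa using N.mul_mem hh h'), mul_zero]
    · change x.coeff h * y.coeff (h⁻¹ * g) = 0
      rw [(hx h).2 hh, zero_mul]
  one_mem' := by
    classical
    intro g
    rw [MonoidAlgebra.one_def, coeff_single, Finsupp.single_apply]
    split_ifs with h
    · exact ⟨one_mem _, fun hg => absurd (h ▸ one_mem N) hg⟩
    · exact ⟨zero_mem _, fun _ => rfl⟩
  add_mem' := fun hx hy g => ⟨add_mem (hx g).1 (hy g).1, fun hg => by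
    simp [(hx g).2 hg, (hy g).2 hg]⟩
  zero_mem' := fun g => ⟨zero_mem _, fun _ => rfl⟩
  neg_mem' := fun hx g => ⟨neg_mem (hx g).1, fun hg => by simp [(hx g).2 hg]⟩

theorem coeffSubring_mono {T T' : Subring F} {N N' : Subgroup G} (hT : T ≤ T') (hN : N ≤ N') :
    coeffSubring T N ≤ coeffSubring T' N' := fun _ hx g =>
  ⟨hT (hx g).1, fun hg => (hx g).2 fun h => hg (hN h)⟩

theorem single_mem_coeffSubring {T : Subring F} {N : Subgroup G} {g : G} {a : F} (hg : g ∈ N)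
    (ha : a ∈ T) : (single g a : MonoidAlgebra F G) ∈ coeffSubring T N := by
  classical
  intro h
  rw [coeff_single, Finsupp.single_apply]
  split_ifs with hh
  · exact ⟨ha, fun hn => absurd (hh ▸ hg) hn⟩
  · exact ⟨zero_mem _, fun _ => rfl⟩

theorem grp_mem_coeffSubring {T : Subring F} {N : Subgroup G} {g : G} (hg : g ∈ N) :
    (grp g : MonoidAlgebra F G) ∈ coeffSubring T N := single_mem_coeffSubring hg T.one_mem

theorem smul_mem_coeffSubring {T : Subring F} {N : Subgroup G} {a : F} (ha : a ∈ T)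
    {x : MonoidAlgebra F G} (hx : x ∈ coeffSubring T N) : a • x ∈ coeffSubring T N := fun g =>
  ⟨T.mul_mem ha (hx g).1, fun hg => by simp [(hx g).2 hg]⟩

theorem conj_mem_coeffSubring {T : Subring F} {N : Subgroup G} {h : G}
    (hN : ∀ g, g ∈ N ↔ h * g * h⁻¹ ∈ N) {x : MonoidAlgebra F G} (hx : x ∈ coeffSubring T N) :
    conj h x ∈ coeffSubring T N := fun g => by
  rw [coeff_conj, hN g]
  exact hx _

theorem eq_sum_of_mem_coeffSubring {T : Subring F} {N : Subgroup G} [Fintype N]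
    {x : MonoidAlgebra F G} (hx : x ∈ coeffSubring T N) :
    x = ∑ l : N, x.coeff (l : G) • grp (l : G) := by
  classical
  ext g
  simp only [coeff_sum, Finsupp.coe_finsetSum, Finset.sum_apply, coeff_smul_apply, grp,
    coeff_single, Finsupp.single_apply, smul_eq_mul, mul_ite, mul_one, mul_zero]
  by_cases hg : g ∈ N
  · rw [Finset.sum_eq_single ⟨g, hg⟩]
    · simp
    · rintro l - hl
      rw [if_neg fun h => hl (Subtype.ext h)]
    · simp
  · rw [(hx g).2 hg, Finset.sum_eq_zero]
    rintro l -
    rw [if_neg]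
    rintro rfl
    exact hg l.2

theorem ext_of_mem_coeffSubring {T T' : Subring F} {N : Subgroup G} {x y : MonoidAlgebra F G}
    (hx : x ∈ coeffSubring T N) (hy : y ∈ coeffSubring T' N)
    (h : ∀ g ∈ N, x.coeff g = y.coeff g) : x = y := by
  ext g
  by_cases hg : g ∈ N
  · exact h g hg
  · rw [(hx g).2 hg, (hy g).2 hg]

/-- A linear condition on the elements of `FN` can be checked on the elements of `N`. -/
theorem coeffSubring_induction {N : Subgroup G} [Finite N] (V : Submodule F (MonoidAlgebra F G))
    (hV : ∀ g ∈ N, grp g ∈ V) {T : Subring F} {x : MonoidAlgebra F G} (hx : x ∈ coeffSubring T N) :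
    x ∈ V := by
  have := Fintype.ofFinite N
  rw [eq_sum_of_mem_coeffSubring hx]
  exact sum_mem fun l _ => V.smul_mem _ (hV _ l.2)

theorem commute_of_mem_coeffSubring {N : Subgroup G} [Finite N] {e : MonoidAlgebra F G}
    (he : ∀ g ∈ N, grp g * e = e * grp g) {T : Subring F} {x : MonoidAlgebra F G}
    (hx : x ∈ coeffSubring T N) : x * e = e * x := by
  have : x ∈ LinearMap.ker (LinearMap.mulRight F e - LinearMap.mulLeft F e) :=
    coeffSubring_induction _ (fun g hg => by simp [he g hg]) hx
  simpa [sub_eq_zero] using this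

theorem mem_range_embed {R : Type*} [CommRing R] [Algebra R F] {M : Type*} [Group M] {ν : M →* G}
    {x : MonoidAlgebra F G} :
    (∃ a : MonoidAlgebra R M, embed ν a = x) ↔ x ∈ coeffSubring (algebraMap R F).range ν.range := by
  have hsingle : ∀ (m : M) (r : R), (embed ν (single m r) : MonoidAlgebra F G)
      = single (ν m) (algebraMap R F r) := fun m r => by
    simp [embed]
  constructor
  · rintro ⟨a, rfl⟩
    induction a using MonoidAlgebra.induction_linear with
    | zero => rw [map_zero]; exact zero_mem _
    | add a b ha hb => rw [map_add]; exact add_mem ha hb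
    | single m r =>
      rw [hsingle]
      exact single_mem_coeffSubring ⟨m, rfl⟩ ⟨r, rfl⟩
  · intro hx
    rw [← RingHom.mem_range, ← MonoidAlgebra.sum_coeff_single x]
    refine sum_mem fun g _ => ?_
    by_cases hg : g ∈ ν.range
    · obtain ⟨m, rfl⟩ := hg
      obtain ⟨r, hr⟩ := (hx (ν m)).1
      exact ⟨single m r, by rw [hsingle, hr]⟩
    · rw [(hx g).2 hg, single_zero]
      exact zero_mem _

theorem embed_injective {R : Type*} [CommRing R] [Algebra R F] {M : Type*} [Group M] {ν : M →* G}
    (hν : Function.Injective ν) (hR : Function.Injective (algebraMap R F)) :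
    Function.Injective (embed ν : MonoidAlgebra R M →+* MonoidAlgebra F G) := by
  intro a b hab
  exact map_injective (algebraMap R F : R →+ F) hR (mapDomain_injective hν hab)

end GroupAlgebra

section SchurIdempotent

open MonoidAlgebra

variable {F G : Type*} [Field F] [Group G]

/-- The properties of the central idempotent `e` of `FN` belonging to an absolutely irreducible
character `χ` that are used below, where `c = χ(1)/|N|`. The character itself is
`χ(y) = c⁻¹ tr(ey)`, where `tr` is the coefficient at the identity; so `schur` is the formula
`∑ y^l e = |N|χ(y)/χ(1) e` for the action of a class sum on a simple module. -/
structure IsSchurIdempotent (N : Subgroup G) [Fintype N] (c : F) (e : MonoidAlgebra F G) :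
    Prop where
  mem : e ∈ coeffSubring ⊤ N
  ne_zero : c ≠ 0
  coeff_one : e.coeff 1 = c ^ 2 * Nat.card N
  mul_self : e * e = e
  comm : ∀ g ∈ N, grp g * e = e * grp g
  schur : ∀ y ∈ coeffSubring ⊤ N,
    c ^ 2 • ((∑ l : N, conj (l : G) y) * e) = (e * y).coeff 1 • e

namespace IsSchurIdempotent

variable {N : Subgroup G} [Fintype N] {c : F} {e e' : MonoidAlgebra F G}

theorem commute (he : IsSchurIdempotent N c e) {T : Subring F} {x : MonoidAlgebra F G}
    (hx : x ∈ coeffSubring T N) : x * e = e * x := commute_of_mem_coeffSubring he.comm hx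

theorem sum_conj {x : MonoidAlgebra F G} (hx : ∀ g ∈ N, grp g * x = x * grp g) :
    ∑ l : N, conj (l : G) x = (Nat.card N : F) • x := by
  have : ∀ l : N, conj (l : G) x = x := fun l =>
    (conj_eq_iff _ _ _).mpr (hx l l.2).symm
  rw [Finset.sum_congr rfl fun l _ => this l, Finset.sum_const, Finset.card_univ,
    Fintype.card_eq_nat_card, Nat.cast_smul_eq_nsmul]

theorem map (he : IsSchurIdempotent N c e) (γ : F ≃+* F) (hγ : γ c = c) :
    IsSchurIdempotent N c (MonoidAlgebra.mapRingHom G (γ : F →+* F) e) := by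
  set f := MonoidAlgebra.mapRingHom G (γ : F →+* F) with hf
  have hgrp : ∀ g : G, f (grp g) = grp g := fun g => by simp [f, grp]
  have hconj : ∀ (g : G) x, f (conj g x) = conj g (f x) := fun g x => by simp [conj, hgrp]
  have hcoeff : ∀ x (g : G), (f x).coeff g = γ (x.coeff g) := fun x g => by simp [f]
  have hsmul : ∀ (a : F) (x : MonoidAlgebra F G), f (a • x) = γ a • f x := fun a x => by
    ext g; simp [hcoeff]
  refine ⟨fun g => ⟨trivial, fun hg => ?_⟩, he.ne_zero, ?_, ?_, fun g hg => ?_, fun y hy => ?_⟩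
  · rw [hcoeff, (he.mem g).2 hg, map_zero]
  · rw [hcoeff, he.coeff_one, map_mul, map_pow, hγ, map_natCast]
  · rw [← map_mul, he.mul_self]
  · rw [← hgrp g, ← map_mul, he.comm g hg, map_mul]
  · obtain ⟨z, rfl, hz⟩ : ∃ z, f z = y ∧ z ∈ coeffSubring (⊤ : Subring F) N := by
      refine ⟨MonoidAlgebra.mapRingHom G (γ.symm : F →+* F) y, ?_, fun g => ⟨trivial, fun hg => ?_⟩⟩
      · ext g; simp [hcoeff]
      · simp [(hy g).2 hg]
    rw [← map_mul, hcoeff, ← hsmul, ← he.schur z hz, hsmul, map_pow, hγ, map_mul, map_sum]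
    simp only [hconj]

/-- Different Schur idempotents are orthogonal. -/
theorem mul_eq_zero_of_ne [CharZero F] (he : IsSchurIdempotent N c e)
    (he' : IsSchurIdempotent N c e') (hne : e ≠ e') : e * e' = 0 := by
  have h1 := he.schur e' (coeffSubring_mono le_top le_rfl he'.mem)
  have h2 := he'.schur e (coeffSubring_mono le_top le_rfl he.mem)
  have hcomm : e' * e = e * e' := he.commute he'.mem
  rw [sum_conj he'.comm, smul_mul_assoc, smul_smul, hcomm] at h1
  rw [sum_conj he.comm, smul_mul_assoc, smul_smul, hcomm] at h2
  by_cases h0 : (e * e').coeff 1 = 0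
  · rw [h0, zero_smul] at h1
    refine (smul_eq_zero.mp h1).resolve_left (mul_ne_zero (pow_ne_zero _ he.ne_zero) ?_)
    exact Nat.cast_ne_zero.mpr Nat.card_pos.ne'
  · exact absurd (smul_right_injective _ h0 (h1.symm.trans h2)) hne

/-- The basis `N` of `FN` and its dual basis with respect to the trace form: an element of
`e(FG)e` can be recovered from traces over `N`. -/
theorem eq_sum_sum (he : IsSchurIdempotent N c e) {y : MonoidAlgebra F G} (h1 : y * e = y)
    (h2 : e * y = y) :
    y = c ^ 2 • ∑ l : N, (∑ m : N, conj (m : G) (y * grp (l : G)⁻¹)) * grp (l : G) := by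
  have hterm : ∀ l m : N, conj (m : G) (y * grp (l : G)⁻¹) * grp (l : G)
      = grp (m : G)⁻¹ * y * (conj (l : G) (grp (m : G)) * e) := by
    intro l m
    have h3 : conj (l : G) (grp (m : G)) * e = e * conj (l : G) (grp (m : G)) :=
      he.commute (T := ⊤) (conj_mem_coeffSubring (fun g => by
        rw [N.mul_mem_cancel_right (N.inv_mem l.2), N.mul_mem_cancel_left l.2])
        (grp_mem_coeffSubring m.2))
    rw [h3, ← mul_assoc, mul_assoc _ y e, h1]
    simp only [conj, mul_assoc, grp_mul_grp]
  have hsum : ∑ l : N, (∑ m : N, conj (m : G) (y * grp (l : G)⁻¹)) * grp (l : G)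
      = ∑ m : N, grp (m : G)⁻¹ * y * ((∑ l : N, conj (l : G) (grp (m : G))) * e) := by
    simp only [Finset.sum_mul, hterm, Finset.mul_sum]
    exact Finset.sum_comm
  have hschur : ∀ m : N, c ^ 2 • (grp (m : G)⁻¹ * y * ((∑ l : N, conj (l : G) (grp (m : G))) * e))
      = (e.coeff (m⁻¹ : N) • (grp (m⁻¹ : N) : MonoidAlgebra F G)) * y := by
    intro m
    rw [← mul_smul_comm, he.schur _ (grp_mem_coeffSubring m.2), coeff_mul_grp, one_mul,
      mul_smul_comm, mul_assoc, h1, smul_mul_assoc]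
    rfl
  have hinv : ∑ m : N, e.coeff (m⁻¹ : N) • (grp (m⁻¹ : N) : MonoidAlgebra F G) = e := by
    conv_rhs => rw [eq_sum_of_mem_coeffSubring he.mem]
    exact Equiv.sum_comp (Equiv.inv N) fun m : N =>
      e.coeff (m : G) • (grp (m : G) : MonoidAlgebra F G)
  rw [hsum, Finset.smul_sum, Finset.sum_congr rfl fun m _ => hschur m, ← Finset.sum_mul, hinv, h2]

/-- Trace formula: `∑ θ(a k b k⁻¹) = |K|/θ(1) θ(a)θ(b)`. -/
theorem sum_coeff_one (he : IsSchurIdempotent N c e) {a b : MonoidAlgebra F G}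
    (hb : b ∈ coeffSubring ⊤ N) :
    c ^ 2 * ∑ k : N, (e * a * grp (k : G) * b * grp (k : G)⁻¹).coeff 1
      = (e * a).coeff 1 * (e * b).coeff 1 := by
  have h1 : ∑ k : N, e * a * grp (k : G) * b * grp (k : G)⁻¹
      = e * (a * ∑ k : N, conj (k : G) b) := by
    rw [Finset.mul_sum, Finset.mul_sum]
    refine Fintype.sum_equiv (Equiv.inv N) _ _ fun k => ?_
    simp [conj, mul_assoc]
  have h2 : ∑ k : N, (e * a * grp (k : G) * b * grp (k : G)⁻¹).coeff 1
      = (∑ k : N, e * a * grp (k : G) * b * grp (k : G)⁻¹).coeff 1 := by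
    simp [coeff_sum]
  rw [h2, h1, coeff_one_mul_comm, ← smul_eq_mul, ← coeff_smul_apply, mul_assoc, ← mul_smul_comm,
    he.schur b hb, mul_smul_comm, coeff_smul_apply, smul_eq_mul, coeff_one_mul_comm a e, mul_comm]

end IsSchurIdempotent

end SchurIdempotent

/-! ### Primitive idempotents of minimal trace -/

section RankOne

open MonoidAlgebra

variable {F G : Type*} [Field F] [Group G]

namespace IsSchurIdempotent

variable {N : Subgroup G} [Fintype N] {c : F} {e : MonoidAlgebra F G}

/-- If `w = ew` commutes with `N`, then the trace form on `FN · w` is proportional to `χ`. -/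
theorem coeff_one_mul (he : IsSchurIdempotent N c e) {w : MonoidAlgebra F G}
    (hw : ∀ g ∈ N, grp g * w = w * grp g) (hew : e * w = w) {y : MonoidAlgebra F G}
    (hy : y ∈ coeffSubring ⊤ N) :
    c ^ 2 * Nat.card N * (y * w).coeff 1 = (e * y).coeff 1 * w.coeff 1 := by
  have h1 := congrArg (fun x => (x * w).coeff 1) (he.schur y hy)
  simp only [smul_mul_assoc, mul_assoc, hew, coeff_smul_apply, smul_eq_mul] at h1
  rw [← h1, mul_assoc]
  congr 1
  have h2 : ∀ l : N, (conj (l : G) y * w).coeff 1 = (y * w).coeff 1 := by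
    intro l
    rw [conj, mul_assoc, hw l l.2, coeff_one_mul_comm, ← mul_assoc, mul_assoc w, grp_mul_grp_inv,
      mul_one, coeff_one_mul_comm]
  simp only [Finset.sum_mul, coeff_sum, Finsupp.coe_finsetSum, Finset.sum_apply]
  rw [Finset.sum_congr rfl fun l _ => h2 l, Finset.sum_const, Finset.card_univ,
    Fintype.card_eq_nat_card, nsmul_eq_mul]

/-- The first orthogonality relation, in terms of the idempotent. -/
theorem sum_coeff_one_mul_coeff_one (he : IsSchurIdempotent N c e) :
    ∑ l : N, (e * grp (l : G)).coeff 1 * (e * grp (l : G)⁻¹).coeff 1 = c ^ 2 * Nat.card N := by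
  rw [← he.coeff_one]
  conv_rhs => rw [← he.mul_self]
  nth_rw 4 [eq_sum_of_mem_coeffSubring he.mem]
  simp only [Finset.mul_sum, coeff_sum, Finsupp.coe_finsetSum, Finset.sum_apply, mul_smul_comm,
    coeff_smul_apply, smul_eq_mul]
  refine Finset.sum_congr rfl fun l _ => ?_
  rw [mul_comm, coeff_mul_grp e (l : G)⁻¹, inv_inv, one_mul]

end IsSchurIdempotent

/-- Projection `FG → FN`, forgetting the coefficients outside of `N`. -/
def restrictSupport (N : Subgroup G) : MonoidAlgebra F G →ₗ[F] MonoidAlgebra F G :=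
  open scoped Classical in
  { toFun := fun x => .ofCoeff (x.coeff.filter (· ∈ N))
    map_add' := fun x y => by ext; simp [Finsupp.filter_add]
    map_smul' := fun a x => by ext; simp [Finsupp.filter_smul] }

open scoped Classical in
theorem coeff_restrictSupport (N : Subgroup G) (x : MonoidAlgebra F G) (g : G) :
    (restrictSupport N x).coeff g = if g ∈ N then x.coeff g else 0 := by
  simp [restrictSupport, Finsupp.filter_apply]

theorem restrictSupport_mem (N : Subgroup G) {T : Subring F} {x : MonoidAlgebra F G}
    (hx : ∀ g, x.coeff g ∈ T) : restrictSupport N x ∈ coeffSubring T N := fun g => by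
  classical
  rw [coeff_restrictSupport]
  split_ifs with h
  · exact ⟨hx g, fun h' => absurd h h'⟩
  · exact ⟨zero_mem _, fun _ => rfl⟩

theorem restrictSupport_eq_self {N : Subgroup G} {T : Subring F} {x : MonoidAlgebra F G}
    (hx : x ∈ coeffSubring T N) : restrictSupport N x = x := by
  classical
  ext g
  rw [coeff_restrictSupport]
  split_ifs with h
  · rfl
  · exact ((hx g).2 h).symm

theorem trace_eq_sum_coeff {F G : Type*} [Field F] [Fintype G]
    (f : MonoidAlgebra F G →ₗ[F] MonoidAlgebra F G) :
    LinearMap.trace F _ f = ∑ g : G, (f (grp g)).coeff g := by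
  classical
  rw [LinearMap.trace_eq_matrix_trace F (MonoidAlgebra.basis G F), Matrix.trace]
  refine Finset.sum_congr rfl fun g _ => ?_
  rw [Matrix.diag_apply, LinearMap.toMatrix_apply]
  simp [grp, MonoidAlgebra.basis]

variable {K L : Subgroup G} {c c' : F} {e e' w : MonoidAlgebra F G}

/-- The operator `y ↦ |L|⁻¹ ∑ w l⁻¹ y l w` on `FK`, extended by zero to `FG`. -/
def averageCorner (K L : Subgroup G) [Fintype L] (w : MonoidAlgebra F G) :
    MonoidAlgebra F G →ₗ[F] MonoidAlgebra F G :=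
  (Nat.card L : F)⁻¹ • ∑ l : L, LinearMap.mulLeft F w ∘ₗ LinearMap.mulRight F w ∘ₗ
    conjₗ (l : G) ∘ₗ restrictSupport K

theorem averageCorner_apply [Fintype L] (y : MonoidAlgebra F G) : averageCorner K L w y =
    (Nat.card L : F)⁻¹ • (w * (∑ l : L, conj (l : G) (restrictSupport K y)) * w) := by
  simp [averageCorner, Finset.mul_sum, Finset.sum_mul, mul_assoc]

theorem trace_averageCorner [CharZero F] [Finite G] [Fintype K] [Fintype L] (hLK : L ≤ K)
    (he : IsSchurIdempotent K c e) (he' : IsSchurIdempotent L c' e')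
    (hw : w ∈ coeffSubring ⊤ K) (hew : e * w = w) (hew' : e' * w = w)
    (hwL : ∀ l ∈ L, grp l * w = w * grp l) :
    (c * c' * Nat.card L) ^ 2 * LinearMap.trace F _ (averageCorner K L w) = (w.coeff 1) ^ 2 := by
  have := Fintype.ofFinite G
  have hcard : (Nat.card L : F) ≠ 0 := Nat.cast_ne_zero.mpr Nat.card_pos.ne'
  -- the coefficient of `k` in the image of `k`
  have hdiag : ∀ k : K, (averageCorner K L w (grp (k : G))).coeff k = (Nat.card L : F)⁻¹ * ∑ l : L,
      (e * (w * grp (l : G)⁻¹) * grp (k : G) * (grp (l : G) * w) * grp (k : G)⁻¹).coeff 1 := by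
    intro k
    rw [averageCorner_apply, restrictSupport_eq_self (grp_mem_coeffSubring (T := ⊤) k.2),
      coeff_smul_apply, smul_eq_mul]
    congr 1
    simp only [Finset.mul_sum, Finset.sum_mul, coeff_sum, Finsupp.coe_finsetSum, Finset.sum_apply]
    refine Finset.sum_congr rfl fun l _ => ?_
    rw [coeff_mul_grp _ (k : G)⁻¹, inv_inv, one_mul, ← mul_assoc e, hew]
    simp only [conj, mul_assoc]
  have htr : LinearMap.trace F _ (averageCorner K L w)
      = ∑ k : K, (averageCorner K L w (grp (k : G))).coeff k := by
    classical
    rw [trace_eq_sum_coeff, ← Finset.sum_subset (Finset.subset_univ (Finset.univ.filter (· ∈ K)))]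
    · exact Finset.sum_subtype (p := (· ∈ K)) _ (by simp) _
    · intro g _ hg
      have : restrictSupport K (grp g : MonoidAlgebra F G) = 0 := by
        ext h
        rw [coeff_restrictSupport, grp, coeff_single, Finsupp.single_apply]
        split_ifs with h1 h2
        · subst h2; simp_all
        all_goals rfl
      simp [averageCorner_apply, this, conj]
  have hlw : ∀ l : L, c ^ 2 * ∑ k : K,
      (e * (w * grp (l : G)⁻¹) * grp (k : G) * (grp (l : G) * w) * grp (k : G)⁻¹).coeff 1
      = (grp (l : G)⁻¹ * w).coeff 1 * (grp (l : G) * w).coeff 1 := by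
    intro l
    rw [he.sum_coeff_one (mul_mem (grp_mem_coeffSubring (hLK l.2)) hw), ← mul_assoc e w, hew,
      ← mul_assoc e, ← he.comm l (hLK l.2), mul_assoc _ e, hew, coeff_one_mul_comm w]
  have hL := fun l : L => he'.coeff_one_mul hwL hew' (grp_mem_coeffSubring l.2)
  have hL' := fun l : L => he'.coeff_one_mul hwL hew' (grp_mem_coeffSubring (L.inv_mem l.2))
  have hsum : (c' ^ 2 * Nat.card L) ^ 2 *
      ∑ l : L, (grp (l : G)⁻¹ * w).coeff 1 * (grp (l : G) * w).coeff 1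
      = c' ^ 2 * Nat.card L * w.coeff 1 ^ 2 := by
    conv_rhs => rw [← he'.sum_coeff_one_mul_coeff_one]
    rw [Finset.mul_sum, Finset.sum_mul]
    refine Finset.sum_congr rfl fun l _ => ?_
    linear_combination ((c' ^ 2 * Nat.card L) * (grp (l : G)⁻¹ * w).coeff 1) * hL l +
      ((e' * grp (l : G)).coeff 1 * w.coeff 1) * hL' l
  have h0 : c' ^ 2 * (Nat.card L : F) ≠ 0 := mul_ne_zero (pow_ne_zero 2 he'.ne_zero) hcard
  apply mul_left_cancel₀ h0
  rw [← hsum, htr, Finset.sum_congr rfl fun k _ => hdiag k, ← Finset.mul_sum, Finset.sum_comm,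
    ← Finset.sum_congr rfl fun l _ => hlw l, ← Finset.mul_sum]
  field_simp

/-- Let `w` be an idempotent of `(e e' FK e e')^L` of the smallest possible trace. Then `w` is
primitive with `w (FK)^L w = Fw`: the trace of the projection onto `w (FK)^L w` is one. -/
theorem exists_eq_smul_of_coeff_one [CharZero F] [Finite G] [Fintype K] [Fintype L] (hLK : L ≤ K)
    (he : IsSchurIdempotent K c e) (he' : IsSchurIdempotent L c' e')
    (hw : w ∈ coeffSubring ⊤ K) (hww : w * w = w) (hew : e * w = w) (hew' : e' * w = w)
    (hwL : ∀ l ∈ L, grp l * w = w * grp l) (htr : w.coeff 1 = c * c' * Nat.card L)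
    {y : MonoidAlgebra F G} (hy : y ∈ coeffSubring ⊤ K) (hyL : ∀ l ∈ L, grp l * y = y * grp l)
    (hwy : w * y = y) (hyw : y * w = y) : ∃ a : F, y = a • w := by
  have hcard : (Nat.card L : F) ≠ 0 := Nat.cast_ne_zero.mpr Nat.card_pos.ne'
  have h0 : c * c' * Nat.card L ≠ 0 := mul_ne_zero (mul_ne_zero he.ne_zero he'.ne_zero) hcard
  have htrace := trace_averageCorner hLK he he' hw hew hew' hwL
  rw [htr] at htrace
  have hone := mul_left_cancel₀ (pow_ne_zero 2 h0) (htrace.trans (mul_one _).symm)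
  let V : Submodule F (MonoidAlgebra F G) :=
    { carrier := {y | y ∈ coeffSubring ⊤ K ∧ (∀ l ∈ L, grp l * y = y * grp l) ∧
        w * y = y ∧ y * w = y}
      add_mem' := fun ha hb => ⟨add_mem ha.1 hb.1, fun l hl => by
        rw [mul_add, add_mul, ha.2.1 l hl, hb.2.1 l hl], by rw [mul_add, ha.2.2.1, hb.2.2.1],
        by rw [add_mul, ha.2.2.2, hb.2.2.2]⟩
      zero_mem' := ⟨zero_mem _, by simp⟩
      smul_mem' := fun a x hx => ⟨smul_mem_coeffSubring (Subring.mem_top a) hx.1, fun l hl => by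
        rw [mul_smul_comm, smul_mul_assoc, hx.2.1 l hl], by rw [mul_smul_comm, hx.2.2.1],
        by rw [smul_mul_assoc, hx.2.2.2]⟩ }
  have hproj : LinearMap.IsProj V (averageCorner K L w) := by
    have hcorner : ∀ x, w * averageCorner K L w x = averageCorner K L w x ∧
        averageCorner K L w x * w = averageCorner K L w x := fun x => by
      rw [averageCorner_apply, mul_smul_comm, smul_mul_assoc]
      simp only [← mul_assoc, hww]
      simp only [mul_assoc, hww, and_self]
    have hinv : ∀ (y : MonoidAlgebra F G), ∀ m ∈ L,
        grp m * ∑ l : L, conj (l : G) y = (∑ l : L, conj (l : G) y) * grp m := by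
      intro y m hm
      symm
      rw [← conj_eq_iff, conj_sum]
      simp only [conj_conj]
      exact Equiv.sum_comp (Equiv.mulRight (⟨m, hm⟩ : L)) fun l : L => conj (l : G) y
    refine ⟨fun x => ⟨?_, fun l hl => ?_, (hcorner x).1, (hcorner x).2⟩, fun x hx => ?_⟩
    · rw [averageCorner_apply]
      refine smul_mem_coeffSubring (Subring.mem_top _)
        (mul_mem (mul_mem hw (sum_mem fun l _ => ?_)) hw)
      exact conj_mem_coeffSubring (fun g => by
        rw [K.mul_mem_cancel_right (K.inv_mem (hLK l.2)), K.mul_mem_cancel_left (hLK l.2)])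
        (restrictSupport_mem K fun _ => Subring.mem_top _)
    · rw [averageCorner_apply, mul_smul_comm, smul_mul_assoc, ← mul_assoc, ← mul_assoc, hwL l hl,
        mul_assoc w, hinv _ l hl, mul_assoc _ w, ← hwL l hl]
      simp only [mul_assoc]
    · obtain ⟨hx1, hx2, hx3, hx4⟩ := hx
      have hconj : ∀ l : L, conj (l : G) x = x := fun l => (conj_eq_iff _ _ _).mpr (hx2 l l.2).symm
      rw [averageCorner_apply, restrictSupport_eq_self hx1, Finset.sum_congr rfl fun l _ => hconj l,
        Finset.sum_const, Finset.card_univ, Fintype.card_eq_nat_card, mul_smul_comm, hx3,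
        smul_mul_assoc, hx4, ← Nat.cast_smul_eq_nsmul F, smul_smul, inv_mul_cancel₀ hcard, one_smul]
  rw [hproj.trace] at hone
  have hfin : Module.finrank F V = 1 := by exact_mod_cast hone
  have hw0 : w ≠ 0 := by
    rintro rfl
    exact h0 (by simpa using htr.symm)
  obtain ⟨a, ha⟩ := (finrank_eq_one_iff_of_nonzero' (⟨w, hw, hwL, hww, hww⟩ : V)
    fun h => hw0 (congrArg Subtype.val h)).mp hfin ⟨y, hy, hyL, hwy, hyw⟩
  exact ⟨a, (congrArg Subtype.val ha).symm⟩

end RankOne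

/-! ### Irreducible characters and their central idempotents -/

section Characters

variable {Ω 𝕃 N : Type*} [Field Ω] [Field 𝕃] [Algebra 𝕃 Ω] [Group N] {χ : N → 𝕃}

namespace IsIrreducibleCharacter

theorem mul_comm (hχ : IsIrreducibleCharacter Ω fun x => algebraMap 𝕃 Ω (χ x)) (x y : N) :
    χ (x * y) = χ (y * x) := by
  obtain ⟨d, ρ, -, h⟩ := hχ
  replace h : ∀ x, ρ.character x = algebraMap 𝕃 Ω (χ x) := h
  apply (algebraMap 𝕃 Ω).injective
  rw [← h, ← h, ρ.char_mul_comm]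

theorem card_mul [IsAlgClosed Ω] [Fintype N]
    (hχ : IsIrreducibleCharacter Ω fun x => algebraMap 𝕃 Ω (χ x))
    (x y : N) : (Nat.card N : 𝕃) * (χ x * χ y) = χ 1 * ∑ l : N, χ (l⁻¹ * x * l * y) := by
  obtain ⟨d, ρ, hρ, h⟩ := hχ
  replace h : ∀ x, ρ.character x = algebraMap 𝕃 Ω (χ x) := h
  apply (algebraMap 𝕃 Ω).injective
  simp only [map_mul, map_sum, map_natCast, ← h]
  exact hρ.card_mul_character_mul_character ρ x y

theorem sum_mul_inv [IsAlgClosed Ω] [CharZero 𝕃] [Fintype N]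
    (hχ : IsIrreducibleCharacter Ω fun x => algebraMap 𝕃 Ω (χ x)) :
    ∑ x : N, χ x * χ x⁻¹ = Nat.card N := by
  obtain ⟨d, ρ, hρ, h⟩ := hχ
  replace h : ∀ x, ρ.character x = algebraMap 𝕃 Ω (χ x) := h
  have hΩ : CharZero Ω := charZero_of_injective_algebraMap (algebraMap 𝕃 Ω).injective
  have hcard : (Nat.card N : Ω) ≠ 0 := Nat.cast_ne_zero.mpr Nat.card_pos.ne'
  have := invertibleOfNonzero hcard
  apply (algebraMap 𝕃 Ω).injective
  have h1 := Representation.char_orthonormal ρ ρ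
  rw [if_pos ⟨Representation.Equiv.refl ρ⟩, inv_mul_eq_iff_eq_mul₀ hcard, mul_one] at h1
  simp only [map_mul, map_sum, map_natCast, ← h]
  exact h1

theorem one_ne_zero [IsAlgClosed Ω] [CharZero 𝕃] [Finite N]
    (hχ : IsIrreducibleCharacter Ω fun x => algebraMap 𝕃 Ω (χ x)) :
    χ 1 ≠ 0 := by
  have := Fintype.ofFinite N
  intro h0
  have hcard : (Nat.card N : 𝕃) ≠ 0 := Nat.cast_ne_zero.mpr Nat.card_pos.ne'
  refine hcard (hχ.sum_mul_inv ▸ Finset.sum_eq_zero fun x _ => ?_)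
  have := hχ.card_mul x x⁻¹
  rw [h0, zero_mul] at this
  exact (mul_eq_zero.mp this).resolve_left hcard

theorem isIntegral [IsAlgClosed Ω] [Finite N]
    (hχ : IsIrreducibleCharacter Ω fun x => algebraMap 𝕃 Ω (χ x))
    (x : N) : IsIntegral ℤ (χ x) := by
  obtain ⟨d, ρ, hρ, h⟩ := hχ
  replace h : ∀ x, ρ.character x = algebraMap 𝕃 Ω (χ x) := h
  rw [← isIntegral_algebraMap_iff (algebraMap 𝕃 Ω).injective, ← h]
  refine ρ.character_mem_of_pow_eq_one (integralClosure ℤ Ω).toSubring.toAddSubmonoid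
    (fun z hz => ?_) x
  exact IsIntegral.of_pow (n := Nat.card N) Nat.card_pos (hz ▸ isIntegral_one)

/-- The field of values of a character is a finite abelian extension, as it embeds into a
cyclotomic extension. -/
theorem isAbelianGalois [IsAlgClosed Ω] {𝕜 : Type*} [Field 𝕜] [Algebra 𝕜 𝕃] [CharZero 𝕃]
    [Finite N] (hχ : IsIrreducibleCharacter Ω fun x => algebraMap 𝕃 Ω (χ x))
    (h𝕃 : IntermediateField.adjoin 𝕜 (Set.range χ) = ⊤) :
    IsAbelianGalois 𝕜 𝕃 ∧ FiniteDimensional 𝕜 𝕃 := by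
  let : Algebra 𝕜 Ω := ((algebraMap 𝕃 Ω).comp (algebraMap 𝕜 𝕃)).toAlgebra
  have : IsScalarTower 𝕜 𝕃 Ω := IsScalarTower.of_algebraMap_eq fun _ => rfl
  have hΩ : CharZero Ω := charZero_of_injective_algebraMap (algebraMap 𝕃 Ω).injective
  have hn : NeZero (Nat.card N : Ω) := ⟨Nat.cast_ne_zero.mpr Nat.card_pos.ne'⟩
  set M := IntermediateField.adjoin 𝕜 {x : Ω | ∃ n ∈ ({Nat.card N} : Set ℕ), n ≠ 0 ∧ x ^ n = 1}
  have hM : IsCyclotomicExtension {Nat.card N} 𝕜 M :=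
    IntermediateField.isCyclotomicExtension_adjoin_of_exists_isPrimitiveRoot _ _ _ (by
      rintro n rfl -
      exact HasEnoughRootsOfUnity.exists_primitiveRoot Ω (Nat.card N))
  have hab : IsAbelianGalois 𝕜 M := IsCyclotomicExtension.isAbelianGalois {Nat.card N} 𝕜 M
  have hfin : FiniteDimensional 𝕜 M := IsCyclotomicExtension.finiteDimensional {Nat.card N} 𝕜 M
  have hrange : ∀ a : 𝕃, algebraMap 𝕃 Ω a ∈ M := by
    intro a
    have ha : a ∈ IntermediateField.adjoin 𝕜 (Set.range χ) := h𝕃 ▸ IntermediateField.mem_top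
    have hle : IntermediateField.adjoin 𝕜 (Set.range χ)
        ≤ M.comap (IsScalarTower.toAlgHom 𝕜 𝕃 Ω) := by
      rw [IntermediateField.adjoin_le_iff]
      rintro _ ⟨x, rfl⟩
      obtain ⟨d, ρ, hρ, h⟩ := hχ
      replace h : ∀ x, ρ.character x = algebraMap 𝕃 Ω (χ x) := h
      change algebraMap 𝕃 Ω (χ x) ∈ M
      rw [← h]
      exact ρ.character_mem_of_pow_eq_one M.toSubfield.toSubring.toAddSubmonoid (fun z hz =>
        IntermediateField.subset_adjoin _ _ ⟨_, rfl, Nat.card_pos.ne', hz⟩) x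
    exact hle ha
  let f : 𝕃 →ₐ[𝕜] M := (IsScalarTower.toAlgHom 𝕜 𝕃 Ω).codRestrict M.toSubalgebra hrange
  exact ⟨IsAbelianGalois.of_algHom f, FiniteDimensional.of_injective f.toLinearMap f.injective⟩

end IsIrreducibleCharacter

/-- If `χ` has `p`-defect zero, then `χ(1)/|N|` is a unit of every local ring of residue
characteristic `p`. -/
theorem HasDefectZero.exists_unit [CharZero 𝕃] {A : Type*} [CommRing A] [IsLocalRing A]
    [Algebra A 𝕃] {p : ℕ} [Fact p.Prime]
    [CharP (IsLocalRing.ResidueField A) p] [Finite N] (hd : HasDefectZero p χ) (h1 : χ 1 ≠ 0) :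
    ∃ u : Aˣ, algebraMap A 𝕃 u = χ 1 / Nat.card N := by
  obtain ⟨d, hd, hv⟩ := hd
  have hunit : ∀ m : ℕ, ¬ p ∣ m → IsUnit (m : A) := fun m hm => by
    rw [← IsLocalRing.residue_ne_zero_iff_isUnit, map_natCast]
    rwa [Ne, CharP.cast_eq_zero_iff _ p]
  have hd0 : d ≠ 0 := by rintro rfl; exact h1 (by simpa using hd)
  have hN0 : Nat.card N ≠ 0 := Nat.card_pos.ne'
  have hfactor : ∀ m : ℕ, m ≠ 0 → ∃ a, ¬ p ∣ a ∧ m = p ^ padicValNat p m * a := fun m hm => by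
    obtain ⟨a, ha⟩ := pow_padicValNat_dvd (p := p) (n := m)
    refine ⟨a, fun hpa => pow_succ_padicValNat_not_dvd (p := p) hm ?_, ha⟩
    conv_rhs => rw [ha]
    exact pow_succ p _ ▸ mul_dvd_mul_left _ hpa
  obtain ⟨a, ha, ha'⟩ : ∃ a, ¬ p ∣ a ∧ d = p ^ padicValNat p d * a := hfactor d hd0
  obtain ⟨b, hb, hb'⟩ : ∃ b, ¬ p ∣ b ∧ Nat.card N = p ^ padicValNat p d * b := by
    rw [hv]; exact hfactor _ hN0
  obtain ⟨u, hu⟩ := hunit a ha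
  obtain ⟨v, hv'⟩ := hunit b hb
  generalize padicValNat p d = k at ha' hb'
  have hpow : (p : 𝕃) ^ k ≠ 0 :=
    pow_ne_zero _ (Nat.cast_ne_zero.mpr (Fact.out : p.Prime).ne_zero)
  have hvb : algebraMap A 𝕃 v = (b : 𝕃) := by rw [hv', map_natCast]
  have hb0 : (b : 𝕃) ≠ 0 := Nat.cast_ne_zero.mpr (by rintro rfl; exact hb (dvd_zero p))
  have hvinv : algebraMap A 𝕃 (v⁻¹ : Aˣ) = (b : 𝕃)⁻¹ := by
    apply eq_inv_of_mul_eq_one_left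
    rw [← hvb, ← map_mul, Units.inv_mul, map_one]
  refine ⟨u * v⁻¹, ?_⟩
  rw [Units.val_mul, map_mul, hu, hvinv, map_natCast, hd, hb']
  conv_rhs => rw [ha']
  push_cast
  rw [mul_div_mul_left _ _ hpow, div_eq_mul_inv]

end Characters

section

variable {Ω 𝕃 G : Type*} [Field Ω] [IsAlgClosed Ω] [Field 𝕃] [Algebra 𝕃 Ω]
  [Group G] {N : Subgroup G} [Fintype N] {χ : N → 𝕃}

theorem coeff_charIdempotent (χ : N → 𝕃) (g : N) :
    (charIdempotent N χ).coeff (g : G) = χ 1 / Nat.card N * χ g⁻¹ := by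
  classical
  rw [charIdempotent, finsum_eq_sum_of_fintype, MonoidAlgebra.coeff_sum, Finsupp.coe_finsetSum,
    Finset.sum_apply, Finset.sum_eq_single g]
  · simp
  · rintro l - hl
    rw [MonoidAlgebra.coeff_single, Finsupp.single_apply, if_neg fun h => hl (Subtype.ext h)]
  · simp

theorem charIdempotent_mem {T : Subring 𝕃} (hT : ∀ x, χ 1 / Nat.card N * χ x ∈ T) :
    (charIdempotent N χ : MonoidAlgebra 𝕃 G) ∈ coeffSubring T N := by
  rw [charIdempotent, finsum_eq_sum_of_fintype]
  exact sum_mem fun x _ => single_mem_coeffSubring x.2 (hT _)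

/-- The central idempotent belonging to an absolutely irreducible character. -/
theorem IsIrreducibleCharacter.isSchurIdempotent [CharZero 𝕃]
    (hχ : IsIrreducibleCharacter Ω fun x => algebraMap 𝕃 Ω (χ x)) :
    IsSchurIdempotent N (χ 1 / Nat.card N) (charIdempotent N χ : MonoidAlgebra 𝕃 G) := by
  set c : 𝕃 := χ 1 / Nat.card N with hc
  set e : MonoidAlgebra 𝕃 G := charIdempotent N χ with he
  have hcard : (Nat.card N : 𝕃) ≠ 0 := Nat.cast_ne_zero.mpr Nat.card_pos.ne'
  have hc0 : c ≠ 0 := div_ne_zero hχ.one_ne_zero hcard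
  have hχ1 : χ 1 = c * Nat.card N := (div_mul_cancel₀ _ hcard).symm
  have hcoeff : ∀ g : N, e.coeff (g : G) = c * χ g⁻¹ := coeff_charIdempotent χ
  have hmem : e ∈ coeffSubring (⊤ : Subring 𝕃) N := charIdempotent_mem fun _ => trivial
  have hone : e.coeff 1 = c ^ 2 * Nat.card N := by
    have := hcoeff 1
    rw [inv_one, hχ1] at this
    rw [← OneMemClass.coe_one N, this]
    ring
  have hnorm : ∀ l ∈ N, ∀ g, g ∈ N ↔ l * g * l⁻¹ ∈ N := fun l hl g => by
    rw [N.mul_mem_cancel_right (N.inv_mem hl), N.mul_mem_cancel_left hl]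
  have hcomm : ∀ g ∈ N, grp g * e = e * grp g := by
    intro g hg
    symm
    rw [← conj_eq_iff]
    refine ext_of_mem_coeffSubring (conj_mem_coeffSubring (hnorm g hg) hmem) hmem fun h hh => ?_
    rw [coeff_conj]
    have h1 := hcoeff ⟨g * h * g⁻¹, (hnorm g hg h).mp hh⟩
    have h2 := hcoeff ⟨h, hh⟩
    rw [h1, h2]
    have h3 : (⟨g * h * g⁻¹, (hnorm g hg h).mp hh⟩ : N)⁻¹ = ⟨g, hg⟩ * (⟨h, hh⟩⁻¹ * ⟨g, hg⟩⁻¹) :=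
      Subtype.ext (by simp [mul_assoc])
    rw [h3, hχ.mul_comm, inv_mul_cancel_right]
  have hgrp : ∀ x ∈ N, c ^ 2 • ((∑ l : N, conj (l : G) (grp x)) * e) = (e * grp x).coeff 1 • e := by
    intro x hx
    refine ext_of_mem_coeffSubring (T := ⊤) (T' := ⊤) (smul_mem_coeffSubring (Subring.mem_top _)
      (mul_mem (sum_mem fun l _ => ?_) hmem)) (smul_mem_coeffSubring (Subring.mem_top _) hmem)
      fun h hh => ?_
    · exact conj_mem_coeffSubring (hnorm l l.2) (grp_mem_coeffSubring hx)
    · have h1 : ∀ l : N, (conj (l : G) (grp x) * e).coeff h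
          = c * χ (l⁻¹ * ⟨x, hx⟩ * l * ⟨h, hh⟩⁻¹) := by
        intro l
        have h2 := hcoeff ((l⁻¹ * ⟨x, hx⟩ * l)⁻¹ * ⟨h, hh⟩)
        have h3 : ((l⁻¹ * ⟨x, hx⟩ * l)⁻¹ * ⟨h, hh⟩)⁻¹ = (⟨h, hh⟩ : N)⁻¹ * (l⁻¹ * ⟨x, hx⟩ * l) := by
          rw [mul_inv_rev (l⁻¹ * ⟨x, hx⟩ * l)⁻¹, inv_inv]
        rw [h3, hχ.mul_comm] at h2
        rw [conj, grp_mul_grp, grp_mul_grp, coeff_grp_mul, ← h2]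
        rfl
      have h3 := hcoeff (⟨x, hx⟩⁻¹ : N)
      have h4 := hcoeff ⟨h, hh⟩
      have h5 := hχ.card_mul ⟨x, hx⟩ ⟨h, hh⟩⁻¹
      rw [inv_inv] at h3
      simp only [MonoidAlgebra.coeff_smul_apply, smul_eq_mul, Finset.sum_mul,
        MonoidAlgebra.coeff_sum, Finsupp.coe_finsetSum, Finset.sum_apply, h1, coeff_mul_grp,
        one_mul]
      rw [← Finset.mul_sum]
      have h6 : c * ∑ l : N, χ (l⁻¹ * ⟨x, hx⟩ * l * ⟨h, hh⟩⁻¹) = χ ⟨x, hx⟩ * χ (⟨h, hh⟩⁻¹) := by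
        apply mul_left_cancel₀ hcard
        rw [h5, hχ1]
        ring
      rw [h6]
      have h7 : e.coeff x⁻¹ = c * χ ⟨x, hx⟩ := h3
      have h8 : e.coeff h = c * χ ⟨h, hh⟩⁻¹ := h4
      rw [h7, h8]
      ring
  let V : Submodule 𝕃 (MonoidAlgebra 𝕃 G) :=
    { carrier := {y | c ^ 2 • ((∑ l : N, conj (l : G) y) * e) = (e * y).coeff 1 • e}
      add_mem' := fun {a b} ha hb => by
        simp only [Set.mem_ofPred_eq, conj_add, Finset.sum_add_distrib, add_mul, smul_add, mul_add,
          MonoidAlgebra.coeff_add, Finsupp.add_apply, add_smul] at ha hb ⊢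
        rw [ha, hb]
      zero_mem' := by simp [conj_zero]
      smul_mem' := fun a y hy => by
        simp only [Set.mem_ofPred_eq, conj_smul, ← Finset.smul_sum, smul_mul_assoc, mul_smul_comm,
          MonoidAlgebra.coeff_smul_apply, smul_eq_mul] at hy ⊢
        rw [smul_comm, hy, smul_smul] }
  have hschur : ∀ y ∈ coeffSubring (⊤ : Subring 𝕃) N,
      c ^ 2 • ((∑ l : N, conj (l : G) y) * e) = (e * y).coeff 1 • e := fun y hy =>
    coeffSubring_induction V hgrp hy
  refine ⟨hmem, hc0, hone, ?_, hcomm, hschur⟩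
  have htau : (e * e).coeff 1 = c ^ 2 * Nat.card N := by
    nth_rw 2 [eq_sum_of_mem_coeffSubring hmem]
    rw [← hχ.sum_mul_inv, Finset.mul_sum, Finset.mul_sum]
    simp only [MonoidAlgebra.coeff_sum, Finsupp.coe_finsetSum, Finset.sum_apply, mul_smul_comm,
      MonoidAlgebra.coeff_smul_apply, smul_eq_mul, coeff_mul_grp, one_mul]
    refine Finset.sum_congr rfl fun l _ => ?_
    have := hcoeff l⁻¹
    rw [inv_inv] at this
    rw [hcoeff l, ← InvMemClass.coe_inv, this]
    ring
  have h1 := hschur e hmem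
  rw [IsSchurIdempotent.sum_conj hcomm, smul_mul_assoc, smul_smul, htau] at h1
  exact smul_right_injective _ (mul_ne_zero (pow_ne_zero 2 hc0) hcard) h1

end

/-! ### The Galois action and the idempotents of a basic configuration -/

section GaloisAction

variable {𝕜 𝕃 G : Type*} [Field 𝕜] [Field 𝕃] [Algebra 𝕜 𝕃] [Group G]

/-- The action of the Galois group on the coefficients of the elements of `𝕃G`. -/
def gal (γ : 𝕃 ≃ₐ[𝕜] 𝕃) : MonoidAlgebra 𝕃 G →+* MonoidAlgebra 𝕃 G :=
  MonoidAlgebra.mapRingHom G (γ : 𝕃 →+* 𝕃)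

@[simp] theorem coeff_gal (γ : 𝕃 ≃ₐ[𝕜] 𝕃) (x : MonoidAlgebra 𝕃 G) (g : G) :
    (gal γ x).coeff g = γ (x.coeff g) := by simp [gal]

@[simp] theorem gal_grp (γ : 𝕃 ≃ₐ[𝕜] 𝕃) (g : G) : gal γ (grp g : MonoidAlgebra 𝕃 G) = grp g := by
  simp [gal, grp]

theorem gal_conj (γ : 𝕃 ≃ₐ[𝕜] 𝕃) (g : G) (x : MonoidAlgebra 𝕃 G) :
    gal γ (conj g x) = conj g (gal γ x) := by simp [conj]

theorem gal_smul (γ : 𝕃 ≃ₐ[𝕜] 𝕃) (a : 𝕃) (x : MonoidAlgebra 𝕃 G) :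
    gal γ (a • x) = γ a • gal γ x := by ext; simp

theorem gal_gal (γ δ : 𝕃 ≃ₐ[𝕜] 𝕃) (x : MonoidAlgebra 𝕃 G) : gal γ (gal δ x) = gal (γ * δ) x := by
  ext; simp

@[simp] theorem gal_one (x : MonoidAlgebra 𝕃 G) : gal (1 : 𝕃 ≃ₐ[𝕜] 𝕃) x = x := by ext; simp

theorem galoisTrace_eq [Fintype (𝕃 ≃ₐ[𝕜] 𝕃)] (x : MonoidAlgebra 𝕃 G) :
    galoisTrace 𝕜 x = ∑ γ : 𝕃 ≃ₐ[𝕜] 𝕃, gal γ x := finsum_eq_sum_of_fintype _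

theorem gal_galoisTrace [Finite (𝕃 ≃ₐ[𝕜] 𝕃)] (γ : 𝕃 ≃ₐ[𝕜] 𝕃) (x : MonoidAlgebra 𝕃 G) :
    gal γ (galoisTrace 𝕜 x) = galoisTrace 𝕜 x := by
  have := Fintype.ofFinite (𝕃 ≃ₐ[𝕜] 𝕃)
  rw [galoisTrace_eq, map_sum]
  simp only [gal_gal]
  exact Equiv.sum_comp (Equiv.mulLeft γ) fun δ => gal δ x

theorem galoisTrace_gal [Finite (𝕃 ≃ₐ[𝕜] 𝕃)] (γ : 𝕃 ≃ₐ[𝕜] 𝕃) (x : MonoidAlgebra 𝕃 G) :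
    galoisTrace 𝕜 (gal γ x) = galoisTrace 𝕜 x := by
  have := Fintype.ofFinite (𝕃 ≃ₐ[𝕜] 𝕃)
  rw [galoisTrace_eq, galoisTrace_eq]
  simp only [gal_gal]
  exact Equiv.sum_comp (Equiv.mulRight γ) fun δ => gal δ x

theorem conj_galoisTrace [Finite (𝕃 ≃ₐ[𝕜] 𝕃)] (g : G) (x : MonoidAlgebra 𝕃 G) :
    conj g (galoisTrace 𝕜 x) = galoisTrace 𝕜 (conj g x) := by
  have := Fintype.ofFinite (𝕃 ≃ₐ[𝕜] 𝕃)
  simp only [galoisTrace_eq, conj_sum, gal_conj]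

theorem mul_galoisTrace [Finite (𝕃 ≃ₐ[𝕜] 𝕃)] {s : MonoidAlgebra 𝕃 G}
    (hs : ∀ γ : 𝕃 ≃ₐ[𝕜] 𝕃, gal γ s = s) (x : MonoidAlgebra 𝕃 G) :
    s * galoisTrace 𝕜 x = galoisTrace 𝕜 (s * x) := by
  have := Fintype.ofFinite (𝕃 ≃ₐ[𝕜] 𝕃)
  simp only [galoisTrace_eq, Finset.mul_sum, map_mul, hs]

theorem galoisTrace_mul [Finite (𝕃 ≃ₐ[𝕜] 𝕃)] {s : MonoidAlgebra 𝕃 G}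
    (hs : ∀ γ : 𝕃 ≃ₐ[𝕜] 𝕃, gal γ s = s) (x : MonoidAlgebra 𝕃 G) :
    galoisTrace 𝕜 x * s = galoisTrace 𝕜 (x * s) := by
  have := Fintype.ofFinite (𝕃 ≃ₐ[𝕜] 𝕃)
  simp only [galoisTrace_eq, Finset.sum_mul, map_mul, hs]

variable {A : Type*} [CommRing A] [Algebra A 𝕜] [Algebra A 𝕃] [IsScalarTower A 𝕜 𝕃]

theorem gal_of_mem_coeffSubring {N : Subgroup G} {x : MonoidAlgebra 𝕃 G}
    (hx : x ∈ coeffSubring (algebraMap 𝕜 𝕃).range N) (γ : 𝕃 ≃ₐ[𝕜] 𝕃) : gal γ x = x := by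
  ext g
  obtain ⟨a, ha⟩ := (hx g).1
  rw [coeff_gal, ← ha, γ.commutes]

theorem range_algebraMap_le : (algebraMap A 𝕃).range ≤ (algebraMap 𝕜 𝕃).range := by
  rintro _ ⟨a, rfl⟩
  exact ⟨algebraMap A 𝕜 a, (IsScalarTower.algebraMap_apply A 𝕜 𝕃 a).symm⟩

/-- The invariants of `𝒪N` are `AN`. -/
theorem mem_coeffSubring_of_gal [IsIntegrallyClosed A] [IsFractionRing A 𝕜]
    [FiniteDimensional 𝕜 𝕃] [IsGalois 𝕜 𝕃]
    {𝒪 : ValuationSubring 𝕃} (h𝒪 : ∀ x, x ∈ 𝒪 ↔ IsIntegral A x) {N : Subgroup G}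
    {x : MonoidAlgebra 𝕃 G} (hx : x ∈ coeffSubring 𝒪.toSubring N)
    (hγ : ∀ γ : 𝕃 ≃ₐ[𝕜] 𝕃, gal γ x = x) : x ∈ coeffSubring (algebraMap A 𝕃).range N := by
  refine fun g => ⟨?_, (hx g).2⟩
  obtain ⟨a, ha⟩ := (IsGalois.mem_bot_iff_fixed (F := 𝕜) (x.coeff g)).mpr fun γ => by
    rw [← coeff_gal, hγ]
  have hint : IsIntegral A (x.coeff g) := (h𝒪 _).mp (hx g).1
  have ha' : algebraMap 𝕜 𝕃 a = x.coeff g := ha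
  rw [← ha', isIntegral_algebraMap_iff (algebraMap 𝕜 𝕃).injective] at hint
  obtain ⟨b, rfl⟩ := IsIntegrallyClosed.isIntegral_iff.mp hint
  exact ⟨b, by rw [← ha', ← IsScalarTower.algebraMap_apply]⟩

theorem gal_mem_coeffSubring {𝒪 : ValuationSubring 𝕃} (h𝒪 : ∀ x, x ∈ 𝒪 ↔ IsIntegral A x)
    {N : Subgroup G} {x : MonoidAlgebra 𝕃 G} (hx : x ∈ coeffSubring 𝒪.toSubring N)
    (γ : 𝕃 ≃ₐ[𝕜] 𝕃) : gal γ x ∈ coeffSubring 𝒪.toSubring N := fun g => by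
  rw [coeff_gal]
  exact ⟨(h𝒪 _).mpr (((h𝒪 _).mp (hx g).1).map (γ.restrictScalars A)),
    fun hg => by rw [(hx g).2 hg, map_zero]⟩

theorem galoisTrace_mem_coeffSubring [IsIntegrallyClosed A] [IsFractionRing A 𝕜]
    [FiniteDimensional 𝕜 𝕃] [IsGalois 𝕜 𝕃]
    {𝒪 : ValuationSubring 𝕃} (h𝒪 : ∀ x, x ∈ 𝒪 ↔ IsIntegral A x) {N : Subgroup G}
    {x : MonoidAlgebra 𝕃 G} (hx : x ∈ coeffSubring 𝒪.toSubring N) :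
    galoisTrace 𝕜 x ∈ coeffSubring (algebraMap A 𝕃).range N := by
  have := Fintype.ofFinite (𝕃 ≃ₐ[𝕜] 𝕃)
  refine mem_coeffSubring_of_gal h𝒪 ?_ fun γ => gal_galoisTrace γ x
  rw [galoisTrace_eq]
  exact sum_mem fun γ _ => gal_mem_coeffSubring h𝒪 hx γ

end GaloisAction

section UnitCoefficient

variable {𝕃 G : Type*} [Field 𝕃] [Group G]

/-- A nonzero idempotent with coefficients in a valuation ring has a unit among its coefficients:
otherwise the maximal valuation `m < 1` of a coefficient satisfies `m ≤ m²`. -/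
theorem exists_valuation_coeff_eq_one (𝒪 : ValuationSubring 𝕃) {N : Subgroup G}
    {e : MonoidAlgebra 𝕃 G} (he : e ∈ coeffSubring 𝒪.toSubring N) (hee : e * e = e)
    (he0 : e ≠ 0) : ∃ g, 𝒪.valuation (e.coeff g) = 1 := by
  have hsupp : e.coeff.support.Nonempty := by
    rw [Finsupp.support_nonempty_iff]
    simpa using he0
  obtain ⟨g, hg, hmax⟩ := e.coeff.support.exists_max_image (fun g => 𝒪.valuation (e.coeff g)) hsupp
  have hmax' : ∀ h, 𝒪.valuation (e.coeff h) ≤ 𝒪.valuation (e.coeff g) := fun h => by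
    by_cases hh : h ∈ e.coeff.support
    · exact hmax h hh
    · rw [Finsupp.notMem_support_iff.mp hh, map_zero]
      exact zero_le
  refine ⟨g, le_antisymm ((𝒪.valuation_le_one_iff _).mpr (he g).1) ?_⟩
  have h1 : 𝒪.valuation (e.coeff g) ≤ 𝒪.valuation (e.coeff g) * 𝒪.valuation (e.coeff g) := by
    conv_lhs => rw [← hee, MonoidAlgebra.coeff_mul_apply_left]
    refine Valuation.map_sum_le _ fun h _ => ?_
    rw [map_mul]
    exact mul_le_mul' (hmax' _) (hmax' _)
  have h0 : 0 < 𝒪.valuation (e.coeff g) := by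
    rw [zero_lt_iff, Valuation.ne_zero_iff]
    exact Finsupp.mem_support_iff.mp hg
  exact (le_mul_iff_one_le_right h0).mp h1

end UnitCoefficient

section BlockPair

/-- The properties of the idempotents `eθ = e_θ` and `eφ = e_φ` in a basic configuration that are
used below, together with `f = e_θ e_φ` and its trace `i`. Here `c = θ(1)/|K|` and
`c' = φ(1)/|L|`, and `𝒪` is the ring of integers of `𝕃`. Defect zero enters through `unit_θ` and
`unit_φ`. -/
structure IsBlockPair (A 𝕜 : Type*) {𝕃 G : Type*} [CommRing A] [Field 𝕜] [Field 𝕃] [Algebra 𝕜 𝕃]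
    [Algebra A 𝕃] [Group G] (K H : Subgroup G) [Fintype K] [Fintype (H ⊓ K : Subgroup G)]
    (𝒪 : ValuationSubring 𝕃) (c c' : 𝕃) (eθ eφ f i : MonoidAlgebra 𝕃 G) (n : ℕ) : Prop where
  mem_iff : ∀ x, x ∈ 𝒪 ↔ IsIntegral A x
  schur_θ : IsSchurIdempotent K c eθ
  schur_φ : IsSchurIdempotent (H ⊓ K) c' eφ
  mem_θ : eθ ∈ coeffSubring 𝒪.toSubring K
  mem_φ : eφ ∈ coeffSubring 𝒪.toSubring (H ⊓ K)
  unit_θ : ∃ u : Aˣ, algebraMap A 𝕃 u = c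
  unit_φ : ∃ u : Aˣ, algebraMap A 𝕃 u = c'
  gal_c : ∀ γ : 𝕃 ≃ₐ[𝕜] 𝕃, γ c = c
  gal_c' : ∀ γ : 𝕃 ≃ₐ[𝕜] 𝕃, γ c' = c'
  gal_θ : ∀ γ : 𝕃 ≃ₐ[𝕜] 𝕃, gal γ eθ = eθ → γ = 1
  gal_φ : ∀ γ : 𝕃 ≃ₐ[𝕜] 𝕃, gal γ eφ = eφ → γ = 1
  conj_eq : ∀ h ∈ H, ∃ γ : 𝕃 ≃ₐ[𝕜] 𝕃, conj h eθ = gal γ eθ ∧ conj h eφ = gal γ eφ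
  n_pos : 0 < n
  mult : f.coeff 1 = c * c' * Nat.card (H ⊓ K : Subgroup G) * n
  f_eq : f = eθ * eφ
  i_eq : i = galoisTrace 𝕜 f

/-- `x` lies in the fixed corner `(i TK i)^L`, where `L = H ⊓ K` and `i` is an idempotent of `TK`. -/
structure MemCorner {𝕃 G : Type*} [Field 𝕃] [Group G] (T : Subring 𝕃) (K H : Subgroup G)
    (i x : MonoidAlgebra 𝕃 G) : Prop where
  mem : x ∈ coeffSubring T K
  left : i * x = x
  right : x * i = x
  comm : ∀ l ∈ H ⊓ K, grp l * x = x * grp l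

theorem mem_coeffSubring_top {𝕃 G : Type*} [Field 𝕃] [Group G] {x : MonoidAlgebra 𝕃 G}
    {T : Subring 𝕃} {N : Subgroup G} (hx : x ∈ coeffSubring T N) :
    x ∈ coeffSubring (⊤ : Subring 𝕃) N := coeffSubring_mono le_top le_rfl hx

/-- `x · Tr(y) = xy` if `x` annihilates the other conjugates of `y`. -/
theorem mul_galoisTrace_eq {𝕜 𝕃 G : Type*} [Field 𝕜] [Field 𝕃] [Algebra 𝕜 𝕃] [Group G]
    [FiniteDimensional 𝕜 𝕃] {x y : MonoidAlgebra 𝕃 G}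
    (hxy : ∀ γ : 𝕃 ≃ₐ[𝕜] 𝕃, γ ≠ 1 → x * gal γ y = 0) : x * galoisTrace 𝕜 y = x * y := by
  have := Fintype.ofFinite (𝕃 ≃ₐ[𝕜] 𝕃)
  rw [galoisTrace_eq, Finset.mul_sum, Finset.sum_eq_single 1 (fun γ _ hγ => hxy γ hγ) (by simp),
    gal_one]

theorem gal_orthogonal {𝕜 𝕃 G : Type*} [Field 𝕜] [Field 𝕃] [Algebra 𝕜 𝕃] [Group G] [CharZero 𝕃]
    {N : Subgroup G} [Fintype N] {c : 𝕃} {e : MonoidAlgebra 𝕃 G}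
    (he : IsSchurIdempotent N c e) (hc : ∀ γ : 𝕃 ≃ₐ[𝕜] 𝕃, γ c = c)
    (hinj : ∀ γ : 𝕃 ≃ₐ[𝕜] 𝕃, gal γ e = e → γ = 1) {γ : 𝕃 ≃ₐ[𝕜] 𝕃} (hγ : γ ≠ 1) :
    e * gal γ e = 0 :=
  he.mul_eq_zero_of_ne (he.map (γ : 𝕃 ≃+* 𝕃) (hc γ)) fun h => hγ (hinj γ h.symm)

variable {A 𝕜 𝕃 G : Type*} [CommRing A] [Field 𝕜] [Field 𝕃] [Algebra 𝕜 𝕃] [Algebra A 𝕃] [Group G]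
  {K H : Subgroup G} [Fintype K] [Fintype (H ⊓ K : Subgroup G)]
  {𝒪 : ValuationSubring 𝕃} {c c' : 𝕃} {eθ eφ f i : MonoidAlgebra 𝕃 G} {n : ℕ}

namespace IsBlockPair

section

variable (h : IsBlockPair A 𝕜 K H 𝒪 c c' eθ eφ f i n)
include h

theorem commute : eθ * eφ = eφ * eθ :=
  (h.schur_θ.commute (coeffSubring_mono le_rfl inf_le_right h.mem_φ)).symm

theorem θ_mul_f : eθ * f = f := by rw [h.f_eq, ← mul_assoc, h.schur_θ.mul_self]

theorem φ_mul_f : eφ * f = f := by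
  rw [h.f_eq, h.commute, ← mul_assoc, h.schur_φ.mul_self]

theorem f_mul_θ : f * eθ = f := by
  rw [h.f_eq, h.commute, mul_assoc, h.schur_θ.mul_self]

theorem f_mul_f : f * f = f := by
  conv_lhs => rw [h.f_eq, mul_assoc, ← h.f_eq, h.φ_mul_f, h.θ_mul_f]

theorem range_le : (algebraMap A 𝕃).range ≤ 𝒪.toSubring := by
  rintro _ ⟨a, rfl⟩
  exact (h.mem_iff _).mpr isIntegral_algebraMap

theorem f_mem : f ∈ coeffSubring 𝒪.toSubring K := by
  rw [h.f_eq]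
  exact mul_mem h.mem_θ (coeffSubring_mono le_rfl inf_le_right h.mem_φ)

theorem grp_mul_f {l : G} (hl : l ∈ H ⊓ K) : grp l * f = f * grp l := by
  rw [h.f_eq, ← mul_assoc, h.schur_θ.comm l hl.2, mul_assoc, h.schur_φ.comm l hl, mul_assoc]

theorem conj_f {g : G} (hg : g ∈ H) : ∃ γ : 𝕃 ≃ₐ[𝕜] 𝕃, conj g f = gal γ f := by
  obtain ⟨γ, h1, h2⟩ := h.conj_eq g hg
  exact ⟨γ, by rw [h.f_eq, conj_mul, h1, h2, map_mul]⟩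

/-- Elements of `(𝕃K)^L` commute with `f`. -/
theorem mul_f {T : Subring 𝕃} {x : MonoidAlgebra 𝕃 G} (hx : x ∈ coeffSubring T K)
    (hxL : ∀ l ∈ H ⊓ K, grp l * x = x * grp l) : x * f = f * x := by
  rw [h.f_eq, ← mul_assoc, h.schur_θ.commute hx, mul_assoc, mul_assoc,
    commute_of_mem_coeffSubring hxL h.mem_φ]

section

variable [CharZero 𝕃]

theorem θ_mul_gal_f {γ : 𝕃 ≃ₐ[𝕜] 𝕃} (hγ : γ ≠ 1) : eθ * gal γ f = 0 := by
  rw [h.f_eq, map_mul, ← mul_assoc, gal_orthogonal h.schur_θ h.gal_c h.gal_θ hγ, zero_mul]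

theorem φ_mul_gal_f {γ : 𝕃 ≃ₐ[𝕜] 𝕃} (hγ : γ ≠ 1) : eφ * gal γ f = 0 := by
  rw [h.f_eq, h.commute, map_mul, ← mul_assoc, gal_orthogonal h.schur_φ h.gal_c' h.gal_φ hγ,
    zero_mul]

theorem coeff_one_f_ne_zero : f.coeff 1 ≠ 0 := by
  rw [h.mult]
  exact mul_ne_zero (mul_ne_zero (mul_ne_zero h.schur_θ.ne_zero h.schur_φ.ne_zero)
    (Nat.cast_ne_zero.mpr Nat.card_pos.ne')) (Nat.cast_ne_zero.mpr h.n_pos.ne')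

end

variable [FiniteDimensional 𝕜 𝕃]

theorem gal_i (γ : 𝕃 ≃ₐ[𝕜] 𝕃) : gal γ i = i := by rw [h.i_eq, gal_galoisTrace]

theorem conj_i {g : G} (hg : g ∈ H) : conj g i = i := by
  obtain ⟨γ, hγ⟩ := h.conj_f hg
  rw [h.i_eq, conj_galoisTrace, hγ, galoisTrace_gal]

theorem grp_mul_i {g : G} (hg : g ∈ H) : grp g * i = i * grp g :=
  ((conj_eq_iff _ _ _).mp (h.conj_i hg)).symm

/-- Elements with coefficients in `𝕜` are determined by their component at `f`. -/
theorem eq_galoisTrace {x : MonoidAlgebra 𝕃 G} (hx : ∀ γ : 𝕃 ≃ₐ[𝕜] 𝕃, gal γ x = x)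
    (hxi : x * i = x) : x = galoisTrace 𝕜 (x * f) := by
  rw [← mul_galoisTrace hx, ← h.i_eq, hxi]

theorem grp_mul_galoisTrace_φ {g : G} (hg : g ∈ H) :
    grp g * galoisTrace 𝕜 eφ = galoisTrace 𝕜 eφ * grp g := by
  obtain ⟨γ, -, hγ⟩ := h.conj_eq g hg
  rw [eq_comm, ← conj_eq_iff, conj_galoisTrace, hγ, galoisTrace_gal]

theorem grp_mul_galoisTrace_θ (hfac : ∀ g : G, ∃ h ∈ H, ∃ k ∈ K, g = h * k) (g : G) :
    grp g * galoisTrace 𝕜 eθ = galoisTrace 𝕜 eθ * grp g := by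
  obtain ⟨x, hx, k, hk, rfl⟩ := hfac g
  obtain ⟨γ, hγ, -⟩ := h.conj_eq x hx
  rw [eq_comm, ← conj_eq_iff, ← conj_conj, conj_galoisTrace, conj_galoisTrace, hγ, ← gal_conj,
    galoisTrace_gal, (conj_eq_iff _ _ _).mpr (h.schur_θ.comm k hk).symm]

section Integral

variable [Algebra A 𝕜] [IsScalarTower A 𝕜 𝕃]

theorem i_mem [IsIntegrallyClosed A] [IsFractionRing A 𝕜] [IsGalois 𝕜 𝕃] :
    i ∈ coeffSubring (algebraMap A 𝕃).range K := by
  rw [h.i_eq]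
  exact galoisTrace_mem_coeffSubring h.mem_iff h.f_mem

theorem i_mem_top : i ∈ coeffSubring (⊤ : Subring 𝕃) K := by
  have := Fintype.ofFinite (𝕃 ≃ₐ[𝕜] 𝕃)
  rw [h.i_eq, galoisTrace_eq]
  exact sum_mem fun γ _ => mem_coeffSubring_top (gal_mem_coeffSubring h.mem_iff h.f_mem γ)

end Integral

variable [CharZero 𝕃]

theorem θ_mul_i : eθ * i = f := by
  rw [h.i_eq, mul_galoisTrace_eq fun γ hγ => h.θ_mul_gal_f hγ, h.θ_mul_f]

theorem φ_mul_i : eφ * i = f := by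
  rw [h.i_eq, mul_galoisTrace_eq fun γ hγ => h.φ_mul_gal_f hγ, h.φ_mul_f]

theorem i_mul_φ : i * eφ = f := by
  rw [← commute_of_mem_coeffSubring (N := H ⊓ K) (e := i)
    (fun l hl => h.grp_mul_i (Subgroup.mem_inf.mp hl).1) h.mem_φ, h.φ_mul_i]

theorem i_mul_gal_φ (γ : 𝕃 ≃ₐ[𝕜] 𝕃) : i * gal γ eφ = gal γ f := by
  conv_lhs => rw [← h.gal_i γ, ← map_mul, h.i_mul_φ]

theorem f_mul_i : f * i = f := by
  conv_lhs => rw [← h.f_mul_θ, mul_assoc, h.θ_mul_i, h.f_mul_f]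

theorem i_mul_i : i * i = i := by
  conv_lhs => rw [h.i_eq, galoisTrace_mul (by rw [← h.i_eq]; exact h.gal_i), ← h.i_eq, h.f_mul_i]
  exact h.i_eq.symm

theorem galoisTrace_θ_mul_i : galoisTrace 𝕜 eθ * i = i := by
  rw [galoisTrace_mul h.gal_i, h.θ_mul_i, ← h.i_eq]

theorem galoisTrace_φ_mul_i : galoisTrace 𝕜 eφ * i = i := by
  rw [galoisTrace_mul h.gal_i, h.φ_mul_i, ← h.i_eq]

theorem galoisTrace_θ_mul_self : galoisTrace 𝕜 eθ * galoisTrace 𝕜 eθ = galoisTrace 𝕜 eθ := by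
  rw [galoisTrace_mul fun γ => gal_galoisTrace γ eθ, mul_galoisTrace_eq fun γ hγ =>
    gal_orthogonal h.schur_θ h.gal_c h.gal_θ hγ, h.schur_θ.mul_self]

theorem galoisTrace_φ_mul_self : galoisTrace 𝕜 eφ * galoisTrace 𝕜 eφ = galoisTrace 𝕜 eφ := by
  rw [galoisTrace_mul fun γ => gal_galoisTrace γ eφ, mul_galoisTrace_eq fun γ hγ =>
    gal_orthogonal h.schur_φ h.gal_c' h.gal_φ hγ, h.schur_φ.mul_self]

variable [Algebra A 𝕜] [IsScalarTower A 𝕜 𝕃]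

theorem i_mul_f : i * f = f := by
  rw [h.mul_f h.i_mem_top fun l hl => h.grp_mul_i hl.1, h.f_mul_i]

theorem i_mul_θ : i * eθ = f := by
  rw [h.schur_θ.commute h.i_mem_top, h.θ_mul_i]

end

end IsBlockPair

end BlockPair

/-! ### Coordinates in the fixed corner -/

section Coordinates

namespace MemCorner

variable {𝕃 G : Type*} [Field 𝕃] [Group G] {T T' : Subring 𝕃} {K H : Subgroup G}
    {i x y : MonoidAlgebra 𝕃 G}

theorem mono (hT : T ≤ T') (hx : MemCorner T K H i x) : MemCorner T' K H i x :=
  ⟨coeffSubring_mono hT le_rfl hx.mem, hx.left, hx.right, hx.comm⟩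

theorem mul (hx : MemCorner T K H i x) (hy : MemCorner T K H i y) : MemCorner T K H i (x * y) :=
  ⟨mul_mem hx.mem hy.mem, by rw [← mul_assoc, hx.left], by rw [mul_assoc, hy.right],
    fun l hl => by rw [← mul_assoc, hx.comm l hl, mul_assoc, hy.comm l hl, mul_assoc]⟩

theorem sum {ι : Type*} (s : Finset ι) {x : ι → MonoidAlgebra 𝕃 G}
    (hx : ∀ a ∈ s, MemCorner T K H i (x a)) : MemCorner T K H i (∑ a ∈ s, x a) :=
  ⟨sum_mem fun a ha => (hx a ha).mem,
    by rw [Finset.mul_sum]; exact Finset.sum_congr rfl fun a ha => (hx a ha).left,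
    by rw [Finset.sum_mul]; exact Finset.sum_congr rfl fun a ha => (hx a ha).right,
    fun l hl => by
      rw [Finset.sum_mul, Finset.mul_sum]
      exact Finset.sum_congr rfl fun a ha => (hx a ha).comm l hl⟩

theorem conj [K.Normal] {g : G} (hg : g ∈ H) (hi : conj g i = i) (hx : MemCorner T K H i x) :
    MemCorner T K H i (conj g x) := by
  have hK : ∀ k, k ∈ K ↔ g * k * g⁻¹ ∈ K := fun k => by
    refine ⟨fun hk => Subgroup.Normal.conj_mem ‹_› k hk g, fun hk => ?_⟩
    simpa [mul_assoc] using Subgroup.Normal.conj_mem (H := K) ‹_› _ hk g⁻¹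
  refine ⟨conj_mem_coeffSubring hK hx.mem, ?_, ?_, fun l hl => ?_⟩
  · conv_lhs => rw [← hi, ← conj_mul, hx.left]
  · conv_lhs => rw [← hi, ← conj_mul, hx.right]
  · have hl' : g * l * g⁻¹ ∈ H ⊓ K :=
      ⟨H.mul_mem (H.mul_mem hg hl.1) (H.inv_mem hg), (hK l).mp hl.2⟩
    have h1 := congrArg (Magic.conj g) (hx.comm _ hl')
    have h2 : Magic.conj g (grp (g * l * g⁻¹)) = (grp l : MonoidAlgebra 𝕃 G) := by
      rw [Magic.conj, grp_mul_grp, grp_mul_grp]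
      congr 1
      group
    rwa [conj_mul, conj_mul, h2] at h1

end MemCorner

/-- A full set of matrix units in `(i AK i)^L`. -/
structure IsCornerUnits (A : Type*) {𝕃 G : Type*} [CommRing A] [Field 𝕃] [Algebra A 𝕃] [Group G]
    (K H : Subgroup G) (i : MonoidAlgebra 𝕃 G) {n : ℕ}
    (E : Fin n → Fin n → MonoidAlgebra 𝕃 G) : Prop where
  mem : ∀ a b, MemCorner (algebraMap A 𝕃).range K H i (E a b)
  mul : ∀ a b c d, E a b * E c d = if b = c then E a d else 0
  sum : ∑ a, E a a = i

/-- The `(a, b)` coordinate of `sf`, for `s` in the fixed corner, with respect to the `𝕃`-basis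
of the elements `E a b * f`: `E o a * s * E b o * f` is a multiple of the primitive idempotent
`E o o * f`, and the factor is read off from coefficients at the identity. -/
def coord {𝕃 G : Type*} [Field 𝕃] [Group G] (f : MonoidAlgebra 𝕃 G) {n : ℕ}
    (E : Fin n → Fin n → MonoidAlgebra 𝕃 G) (o : Fin n) (s : MonoidAlgebra 𝕃 G) (a b : Fin n) : 𝕃 :=
  (E o a * s * E b o * f).coeff 1 / (E o o * f).coeff 1

namespace MemCorner

variable {𝕜 𝕃 G : Type*} [Field 𝕜] [Field 𝕃] [Algebra 𝕜 𝕃] [Group G] {K H : Subgroup G}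
  {i s : MonoidAlgebra 𝕃 G}

theorem gal_eq_self (hs : MemCorner (algebraMap 𝕜 𝕃).range K H i s) (γ : 𝕃 ≃ₐ[𝕜] 𝕃) :
    gal γ s = s := gal_of_mem_coeffSubring hs.mem γ

end MemCorner

namespace IsCornerUnits

variable {A 𝕜 𝕃 G : Type*} [CommRing A] [Field 𝕜] [Field 𝕃] [Algebra A 𝕜] [Algebra 𝕜 𝕃]
  [Algebra A 𝕃] [IsScalarTower A 𝕜 𝕃] [Group G] {K H : Subgroup G} {i : MonoidAlgebra 𝕃 G} {n : ℕ}
  {E : Fin n → Fin n → MonoidAlgebra 𝕃 G}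

theorem memCorner (hE : IsCornerUnits A K H i E) (a b : Fin n) :
    MemCorner (algebraMap 𝕜 𝕃).range K H i (E a b) :=
  (hE.mem a b).mono range_algebraMap_le

theorem gal_eq_self (hE : IsCornerUnits A K H i E) (γ : 𝕃 ≃ₐ[𝕜] 𝕃) (a b : Fin n) :
    gal γ (E a b) = E a b := (hE.memCorner a b).gal_eq_self γ

theorem i_memCorner (hE : IsCornerUnits A K H i E) : MemCorner (algebraMap 𝕜 𝕃).range K H i i := by
  have : MemCorner (algebraMap 𝕜 𝕃).range K H i (∑ a, E a a) :=
    MemCorner.sum _ fun a _ => hE.memCorner a a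
  rwa [hE.sum] at this

theorem sum_memCorner (hE : IsCornerUnits A K H i E) {s : MonoidAlgebra 𝕃 G}
    (hs : MemCorner (algebraMap 𝕜 𝕃).range K H i s) (a b : Fin n) :
    MemCorner (algebraMap 𝕜 𝕃).range K H i (∑ d, E d a * s * E b d) :=
  MemCorner.sum _ fun _ _ => ((hE.memCorner _ _).mul hs).mul (hE.memCorner _ _)

end IsCornerUnits

variable {A 𝕜 𝕃 G : Type*} [CommRing A] [Field 𝕜] [Field 𝕃] [Algebra 𝕜 𝕃]
  [Algebra A 𝕃] [Group G] {K H : Subgroup G} [Fintype K] [Fintype (H ⊓ K : Subgroup G)]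
  {𝒪 : ValuationSubring 𝕃} {c c' : 𝕃} {eθ eφ f i : MonoidAlgebra 𝕃 G} {n : ℕ}
  {E : Fin n → Fin n → MonoidAlgebra 𝕃 G} {o : Fin n}

namespace IsBlockPair

variable (h : IsBlockPair A 𝕜 K H 𝒪 c c' eθ eφ f i n) (hE : IsCornerUnits A K H i E)
include h

theorem mul_f' {T : Subring 𝕃} {s : MonoidAlgebra 𝕃 G} (hs : MemCorner T K H i s) :
    s * f = f * s := h.mul_f hs.mem hs.comm

include hE

theorem E_mul_f (a b : Fin n) : E a b * f = f * E a b := h.mul_f' (hE.mem a b)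

theorem E_mul_f_idem (a : Fin n) : E a a * f * (E a a * f) = E a a * f := by
  rw [mul_assoc, ← mul_assoc f, ← h.E_mul_f hE, mul_assoc, h.f_mul_f, ← mul_assoc, hE.mul,
    if_pos rfl]

theorem E_mul_f_mem (a b : Fin n) : E a b * f ∈ coeffSubring 𝒪.toSubring K :=
  mul_mem (coeffSubring_mono h.range_le le_rfl (hE.mem a b).mem) h.f_mem

variable [Algebra A 𝕜] [IsScalarTower A 𝕜 𝕃] [FiniteDimensional 𝕜 𝕃] [CharZero 𝕃]

/-- All the idempotents `E a a * f` have the same trace. -/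
theorem coeff_one_E_mul_f (a : Fin n) :
    (E a a * f).coeff 1 = c * c' * Nat.card (H ⊓ K : Subgroup G) := by
  have hsame : ∀ b, (E b b * f).coeff 1 = (E a a * f).coeff 1 := by
    intro b
    have h1 : E b b = E b a * E a b := by rw [hE.mul, if_pos rfl]
    have h2 : E a a = E a b * E b a := by rw [hE.mul, if_pos rfl]
    rw [h1, h2, mul_assoc, coeff_one_mul_comm, mul_assoc, ← h.E_mul_f hE, mul_assoc]
  have hsum : ∑ b, (E b b * f).coeff 1 = f.coeff 1 := by
    conv_rhs => rw [← h.i_mul_f, ← hE.sum, Finset.sum_mul]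
    simp [MonoidAlgebra.coeff_sum]
  rw [Finset.sum_congr rfl fun b _ => hsame b, Finset.sum_const, Finset.card_univ, Fintype.card_fin,
    h.mult, nsmul_eq_mul, mul_comm] at hsum
  exact mul_right_cancel₀ (Nat.cast_ne_zero.mpr h.n_pos.ne') hsum

theorem coeff_one_E_mul_f_ne_zero (a : Fin n) : (E a a * f).coeff 1 ≠ 0 := by
  rw [h.coeff_one_E_mul_f hE]
  exact mul_ne_zero (mul_ne_zero h.schur_θ.ne_zero h.schur_φ.ne_zero)
    (Nat.cast_ne_zero.mpr Nat.card_pos.ne')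

theorem coord_eq {s : MonoidAlgebra 𝕃 G} {a b : Fin n} {r : 𝕃}
    (hr : E o a * s * E b o * f = r • (E o o * f)) : coord f E o s a b = r := by
  rw [coord, hr, MonoidAlgebra.coeff_smul_apply, smul_eq_mul,
    mul_div_cancel_right₀ _ (h.coeff_one_E_mul_f_ne_zero hE o)]

theorem coord_eq_of_mul_f_eq {s : MonoidAlgebra 𝕃 G} {r : Fin n → Fin n → 𝕃}
    (hr : s * f = ∑ a, ∑ b, r a b • (E a b * f)) : coord f E o s = r := by
  funext a b
  refine h.coord_eq hE ?_
  have hterm : ∀ d e, E o a * (E d e * f) * E b o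
      = if e = b then (if a = d then E o o * f else 0) else 0 := by
    intro d e
    rw [mul_assoc, mul_assoc, ← h.E_mul_f hE, ← mul_assoc (E d e), hE.mul]
    split_ifs with h1 h2
    · rw [← mul_assoc, hE.mul, if_pos h2]
    · rw [← mul_assoc, hE.mul, if_neg h2, zero_mul]
    · rw [zero_mul, mul_zero]
  rw [mul_assoc _ (E b o), h.E_mul_f hE, ← mul_assoc, mul_assoc _ s, hr]
  simp only [Finset.mul_sum, Finset.sum_mul, mul_smul_comm, smul_mul_assoc, hterm]
  simp

theorem coord_E (a b d e : Fin n) :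
    coord f E o (E a b) d e = if d = a ∧ e = b then 1 else 0 := by
  refine congrFun (congrFun (h.coord_eq_of_mul_f_eq hE (o := o)
    (r := fun d e => if d = a ∧ e = b then 1 else 0) ?_) d) e
  rw [Finset.sum_eq_single a, Finset.sum_eq_single b] <;> simp +contextual

variable [Finite G]

theorem exists_coord {T : Subring 𝕃} {s : MonoidAlgebra 𝕃 G} (hs : MemCorner T K H i s)
    (a b : Fin n) : ∃ r : 𝕃, E o a * s * E b o * f = r • (E o o * f) := by
  have hcorner : MemCorner ⊤ K H i (E o a * s * E b o) :=
    (((hE.mem o a).mono le_top).mul (hs.mono le_top)).mul ((hE.mem b o).mono le_top)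
  have hfL : ∀ x : MonoidAlgebra 𝕃 G, (∀ l ∈ H ⊓ K, grp l * x = x * grp l) →
      ∀ l ∈ H ⊓ K, grp l * (x * f) = x * f * grp l := fun x hx l hl => by
    rw [← mul_assoc, hx l hl, mul_assoc, h.grp_mul_f hl, mul_assoc]
  have hoo := hE.mul o o o o
  rw [if_pos rfl] at hoo
  refine exists_eq_smul_of_coeff_one inf_le_right h.schur_θ h.schur_φ
    (mul_mem (mem_coeffSubring_top (hE.mem o o).mem) (mem_coeffSubring_top h.f_mem))
    (h.E_mul_f_idem hE o) ?_ ?_ (hfL _ (hE.mem o o).comm) (h.coeff_one_E_mul_f hE o)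
    (mul_mem hcorner.mem (mem_coeffSubring_top h.f_mem)) (hfL _ hcorner.comm) ?_ ?_
  · rw [h.E_mul_f hE, ← mul_assoc, h.θ_mul_f]
  · rw [h.E_mul_f hE, ← mul_assoc, h.φ_mul_f]
  · rw [mul_assoc, h.mul_f' hcorner, ← mul_assoc f, h.f_mul_f, ← h.mul_f' hcorner]
    simp only [← mul_assoc, hE.mul, if_true]
  · rw [mul_assoc _ f, ← mul_assoc f, ← h.E_mul_f hE, mul_assoc _ f, h.f_mul_f, ← mul_assoc,
      mul_assoc _ (E b o), hE.mul, if_pos rfl]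

theorem coord_spec {T : Subring 𝕃} {s : MonoidAlgebra 𝕃 G} (hs : MemCorner T K H i s)
    (a b : Fin n) : E o a * s * E b o * f = coord f E o s a b • (E o o * f) := by
  obtain ⟨r, hr⟩ := h.exists_coord hE (o := o) hs a b
  rw [h.coord_eq hE hr, hr]

/-- `s f = ∑ coord s a b • E a b f`. -/
theorem mul_f_eq_sum {T : Subring 𝕃} {s : MonoidAlgebra 𝕃 G} (hs : MemCorner T K H i s) :
    s * f = ∑ a, ∑ b, coord f E o s a b • (E a b * f) := by
  have hterm : ∀ a b, coord f E o s a b • (E a b * f) = E a a * s * E b b * f := by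
    intro a b
    have h1 : E a b * f = E a o * (E o o * f) * E o b := by
      rw [← mul_assoc, hE.mul, if_pos rfl, mul_assoc, ← h.E_mul_f hE, ← mul_assoc, hE.mul,
        if_pos rfl]
    rw [h1, ← smul_mul_assoc, ← mul_smul_comm, ← h.coord_spec hE hs, mul_assoc _ _ (E o b),
      mul_assoc _ f, ← h.E_mul_f hE]
    have h2 : E b o * (E o b * f) = E b b * f := by rw [← mul_assoc, hE.mul, if_pos rfl]
    have h3 : ∀ x, E a o * (E o a * x) = E a a * x := fun x => by
      rw [← mul_assoc, hE.mul, if_pos rfl]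
    simp only [mul_assoc, h2, h3]
  simp only [hterm]
  simp only [← Finset.sum_mul, ← Finset.mul_sum, hE.sum, hs.left, hs.right]

theorem coord_mul {T T' : Subring 𝕃} {s t : MonoidAlgebra 𝕃 G} (hs : MemCorner T K H i s)
    (ht : MemCorner T' K H i t) (a b : Fin n) :
    coord f E o (s * t) a b = ∑ d, coord f E o s a d * coord f E o t d b := by
  have hcomm : ∀ a b, E a b * f * t = E a b * (t * f) := fun a b => by
    rw [mul_assoc, ← h.mul_f' ht]
  have hEE : ∀ a b d e, E a b * (E d e * f) = if b = d then E a e * f else 0 := fun a b d e => by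
    rw [← mul_assoc, hE.mul, ite_mul, zero_mul]
  refine congrFun (congrFun (h.coord_eq_of_mul_f_eq hE (o := o)
    (r := fun a b => ∑ d, coord f E o s a d * coord f E o t d b) ?_) a) b
  rw [mul_assoc, h.mul_f' ht, ← mul_assoc, h.mul_f_eq_sum hE hs (o := o)]
  have hinner : ∀ a d, E a d * (t * f) = ∑ b, coord f E o t d b • (E a b * f) := fun a d => by
    rw [h.mul_f_eq_sum hE ht (o := o)]
    simp only [Finset.mul_sum, mul_smul_comm, hEE, smul_ite, smul_zero]
    rw [Finset.sum_comm]
    simp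
  simp only [Finset.sum_mul, smul_mul_assoc, hcomm, hinner, Finset.sum_smul, Finset.smul_sum,
    smul_smul]
  exact Finset.sum_congr rfl fun a _ => Finset.sum_comm

/-- The coordinates of the elements of `(i AK i)^L` are integral. -/
theorem coord_mem {s : MonoidAlgebra 𝕃 G} (hs : MemCorner 𝒪.toSubring K H i s) (a b : Fin n) :
    coord f E o s a b ∈ 𝒪 := by
  have h0 : E o o * f ≠ 0 := fun h0 => h.coeff_one_E_mul_f_ne_zero hE o (by simp [h0])
  obtain ⟨g, hg⟩ := exists_valuation_coeff_eq_one 𝒪 (h.E_mul_f_mem hE o o) (h.E_mul_f_idem hE o) h0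
  have hmem : E o a * s * E b o * f ∈ coeffSubring 𝒪.toSubring K := by
    rw [mul_assoc _ _ f]
    exact mul_mem (mul_mem (coeffSubring_mono h.range_le le_rfl (hE.mem o a).mem) hs.mem)
      (h.E_mul_f_mem hE b o)
  have h1 := (𝒪.valuation_le_one_iff _).mpr (hmem g).1
  rw [h.coord_spec hE hs, MonoidAlgebra.coeff_smul_apply, smul_eq_mul, map_mul, hg, mul_one] at h1
  exact (𝒪.valuation_le_one_iff _).mp h1

/-- Conversely, an element of `(i 𝕜K i)^L` with integral coordinates lies in `(i AK i)^L`. -/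
theorem memCorner_of_coord_mem [IsIntegrallyClosed A] [IsFractionRing A 𝕜]
    [IsGalois 𝕜 𝕃] {s : MonoidAlgebra 𝕃 G} (hs : MemCorner (algebraMap 𝕜 𝕃).range K H i s)
    (hcoord : ∀ a b, coord f E o s a b ∈ 𝒪) : MemCorner (algebraMap A 𝕃).range K H i s := by
  refine ⟨?_, hs.left, hs.right, hs.comm⟩
  rw [h.eq_galoisTrace hs.gal_eq_self hs.right, h.mul_f_eq_sum hE hs (o := o)]
  exact galoisTrace_mem_coeffSubring h.mem_iff (sum_mem fun a _ => sum_mem fun b _ =>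
    smul_mem_coeffSubring (hcoord a b) (h.E_mul_f_mem hE a b))

end IsBlockPair
end Coordinates

/-! ### Integrality of a magic crossed representation -/

section CrossedRepresentation

/-- A magic crossed representation `σ` with inverses `τ`, as functions on `H`. -/
structure IsMagicCrossed (𝕜 : Type*) {𝕃 G : Type*} [Field 𝕜] [Field 𝕃] [Algebra 𝕜 𝕃] [Group G]
    (K H : Subgroup G) (i : MonoidAlgebra 𝕃 G) {n : ℕ} (E : Fin n → Fin n → MonoidAlgebra 𝕃 G)
    (σ τ : H → MonoidAlgebra 𝕃 G) : Prop where
  mem : ∀ x, MemCorner (algebraMap 𝕜 𝕃).range K H i (σ x)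
  inv_mem : ∀ x, MemCorner (algebraMap 𝕜 𝕃).range K H i (τ x)
  mul_inv : ∀ x, σ x * τ x = i
  inv_mul : ∀ x, τ x * σ x = i
  crossed : ∀ x y : H, eps E (y : G) (σ x) * σ y = σ (x * y)
  conj_eq : ∀ (x : H) (s : MonoidAlgebra 𝕃 G), MemCorner (algebraMap 𝕜 𝕃).range K H i s →
    conj (x : G) s = τ x * eps E (x : G) s * σ x
  coset : ∀ x : H, (x : G) ∈ K → σ x = σ 1

variable {A 𝕜 𝕃 G : Type*} [CommRing A] [Field 𝕜] [Field 𝕃] [Algebra A 𝕜] [Algebra 𝕜 𝕃]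
  [Algebra A 𝕃] [IsScalarTower A 𝕜 𝕃] [Group G] [FiniteDimensional 𝕜 𝕃]
  {K H : Subgroup G} [Fintype K] [Fintype (H ⊓ K : Subgroup G)]
  {𝒪 : ValuationSubring 𝕃} {c c' : 𝕃} {eθ eφ f i : MonoidAlgebra 𝕃 G} {n : ℕ}
  {E : Fin n → Fin n → MonoidAlgebra 𝕃 G} {o : Fin n} {σ τ : H → MonoidAlgebra 𝕃 G}

namespace IsBlockPair

variable (h : IsBlockPair A 𝕜 K H 𝒪 c c' eθ eφ f i n) (hE : IsCornerUnits A K H i E)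
include h hE

theorem eps_mem [K.Normal] {g : G} (hg : g ∈ H) {s : MonoidAlgebra 𝕃 G}
    (hs : MemCorner (algebraMap 𝕜 𝕃).range K H i s) :
    MemCorner (algebraMap 𝕜 𝕃).range K H i (eps E g s) :=
  MemCorner.sum _ fun _ _ => MemCorner.sum _ fun _ _ => (hE.memCorner _ _).mul
    ((hE.sum_memCorner hs _ _).conj hg (h.conj_i hg))

variable [CharZero 𝕃]

theorem coord_i (a b : Fin n) : coord f E o i a b = if a = b then 1 else 0 := by
  refine congrFun (congrFun (h.coord_eq_of_mul_f_eq hE (o := o)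
    (r := fun a b => if a = b then 1 else 0) ?_) a) b
  rw [← hE.sum, Finset.sum_mul]
  simp

variable [Finite G]

theorem eq_of_coord_eq {s t : MonoidAlgebra 𝕃 G}
    (hs : MemCorner (algebraMap 𝕜 𝕃).range K H i s) (ht : MemCorner (algebraMap 𝕜 𝕃).range K H i t)
    (hst : ∀ a b, coord f E o s a b = coord f E o t a b) : s = t := by
  rw [h.eq_galoisTrace hs.gal_eq_self hs.right, h.eq_galoisTrace ht.gal_eq_self ht.right,
    h.mul_f_eq_sum hE hs (o := o), h.mul_f_eq_sum hE ht (o := o)]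
  simp only [hst]

/-- The element `∑ E d a s E b d` of the center of `S` acts on `f` as the `(a, b)` coordinate
of `s`. -/
theorem sum_E_mul_f {T : Subring 𝕃} {s : MonoidAlgebra 𝕃 G} (hs : MemCorner T K H i s)
    (a b : Fin n) : (∑ d, E d a * s * E b d) * f = coord f E o s a b • f := by
  have hterm : ∀ d, E d a * s * E b d * f = coord f E o s a b • (E d d * f) := by
    intro d
    have h1 : E d d * f = E d o * (E o o * f) * E o d := by
      rw [← mul_assoc, hE.mul, if_pos rfl, mul_assoc, ← h.E_mul_f hE, ← mul_assoc, hE.mul,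
        if_pos rfl]
    rw [h1, ← smul_mul_assoc, ← mul_smul_comm, ← h.coord_spec hE hs, mul_assoc _ _ (E o d),
      mul_assoc _ f, ← h.E_mul_f hE]
    have h2 : E b o * (E o d * f) = E b d * f := by rw [← mul_assoc, hE.mul, if_pos rfl]
    have h3 : ∀ x, E d o * (E o a * x) = E d a * x := fun x => by
      rw [← mul_assoc, hE.mul, if_pos rfl]
    simp only [mul_assoc, h2, h3]
  rw [Finset.sum_mul, Finset.sum_congr rfl fun d _ => hterm d, ← Finset.smul_sum, ← Finset.sum_mul,
    hE.sum, h.i_mul_f]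

variable [K.Normal]

/-- If `f^g` is the conjugate of `f` under `γ`, then `ε(g)` applies `γ⁻¹` to the coordinates. -/
theorem coord_eps {g : G} (hg : g ∈ H) {γ : 𝕃 ≃ₐ[𝕜] 𝕃} (hγ : conj g f = gal γ f)
    {s : MonoidAlgebra 𝕃 G} (hs : MemCorner (algebraMap 𝕜 𝕃).range K H i s) (a b : Fin n) :
    coord f E o (eps E g s) a b = γ⁻¹ (coord f E o s a b) := by
  have hconj : ∀ a b, conj g (∑ d, E d a * s * E b d) * f = γ⁻¹ (coord f E o s a b) • f := by
    intro a b
    have hZ := hE.sum_memCorner hs a b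
    have h1 := congrArg (conj g) (h.sum_E_mul_f hE (o := o) hs a b)
    rw [conj_mul, conj_smul, hγ] at h1
    have h2 := congrArg (gal γ⁻¹) h1
    rwa [map_mul, (hZ.conj hg (h.conj_i hg)).gal_eq_self, gal_smul, gal_gal, inv_mul_cancel,
      gal_one] at h2
  refine congrFun (congrFun (h.coord_eq_of_mul_f_eq hE (o := o)
    (r := fun a b => γ⁻¹ (coord f E o s a b)) ?_) a) b
  rw [eps]
  simp only [Finset.sum_mul, mul_assoc (E _ _) (conj g _) f, hconj, mul_smul_comm]

theorem eps_E {g : G} (hg : g ∈ H) (o a b : Fin n) : eps E g (E a b) = E a b := by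
  obtain ⟨γ, hγ⟩ := h.conj_f hg
  refine h.eq_of_coord_eq hE (o := o) (h.eps_mem hE hg (hE.memCorner a b)) (hE.memCorner a b)
    fun d e => ?_
  rw [h.coord_eps hE hg hγ (hE.memCorner a b), h.coord_E hE]
  split_ifs <;> simp

theorem eps_one (o : Fin n) {s : MonoidAlgebra 𝕃 G}
    (hs : MemCorner (algebraMap 𝕜 𝕃).range K H i s) : eps E 1 s = s := by
  have h1 : conj 1 f = gal (1 : 𝕃 ≃ₐ[𝕜] 𝕃) f := by
    rw [gal_one, conj_eq_iff, grp_one, one_mul, mul_one]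
  refine h.eq_of_coord_eq hE (o := o) (h.eps_mem hE H.one_mem hs) hs fun a b => ?_
  rw [h.coord_eps hE H.one_mem h1 hs]
  simp

theorem eps_i {g : G} (hg : g ∈ H) (o : Fin n) : eps E g i = i := by
  obtain ⟨γ, hγ⟩ := h.conj_f hg
  refine h.eq_of_coord_eq hE (o := o) (h.eps_mem hE hg hE.i_memCorner) hE.i_memCorner
    fun d e => ?_
  rw [h.coord_eps hE hg hγ hE.i_memCorner, h.coord_i hE]
  split_ifs <;> simp

theorem eps_mul' {g : G} (hg : g ∈ H) (o : Fin n) {s t : MonoidAlgebra 𝕃 G}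
    (hs : MemCorner (algebraMap 𝕜 𝕃).range K H i s)
    (ht : MemCorner (algebraMap 𝕜 𝕃).range K H i t) :
    eps E g (s * t) = eps E g s * eps E g t := by
  obtain ⟨γ, hγ⟩ := h.conj_f hg
  refine h.eq_of_coord_eq hE (o := o) (h.eps_mem hE hg (hs.mul ht))
    ((h.eps_mem hE hg hs).mul (h.eps_mem hE hg ht)) fun a b => ?_
  rw [h.coord_eps hE hg hγ (hs.mul ht), h.coord_mul hE hs ht,
    h.coord_mul hE (h.eps_mem hE hg hs) (h.eps_mem hE hg ht), map_sum]
  simp only [map_mul, h.coord_eps hE hg hγ hs, h.coord_eps hE hg hγ ht]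

variable (hσ : IsMagicCrossed 𝕜 K H i E σ τ)
include hσ

theorem sigma_one (o : Fin n) : σ 1 = i := by
  have h1 := hσ.crossed 1 1
  rw [mul_one, Subgroup.coe_one, h.eps_one hE o (hσ.mem 1)] at h1
  rw [← hσ.inv_mul 1]
  conv_rhs => rw [← h1, ← mul_assoc, hσ.inv_mul, (hσ.mem 1).left]

theorem tau_eq (o : Fin n) (x : H) : τ x = eps E (x : G) (σ x⁻¹) := by
  have h1 := hσ.crossed x⁻¹ x
  rw [inv_mul_cancel, h.sigma_one hE hσ o] at h1
  have h2 := congrArg (· * τ x) h1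
  rwa [mul_assoc, hσ.mul_inv, (hσ.inv_mem x).left, (h.eps_mem hE x.2 (hσ.mem _)).right,
    eq_comm] at h2

/-- The coordinates of `σ(x)` do not all lie in the maximal ideal: otherwise the same holds for
the powers of `x`, one of which is `1`. -/
theorem exists_one_le_valuation_coord_sigma (o : Fin n) (x : H) :
    ∃ a b, 1 ≤ 𝒪.valuation (coord f E o (σ x) a b) := by
  by_contra! hlt
  obtain ⟨γ, hγ⟩ := h.conj_f x.2
  have hpow : ∀ k : ℕ, ∀ a b, 𝒪.valuation (coord f E o (σ (x ^ (k + 1))) a b) < 1 := by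
    intro k
    induction k with
    | zero => simpa using hlt
    | succ k ih =>
      intro a b
      rw [pow_succ, ← hσ.crossed, h.coord_mul hE (h.eps_mem hE x.2 (hσ.mem _)) (hσ.mem x)]
      refine Valuation.map_sum_lt _ one_ne_zero fun d _ => ?_
      rw [h.coord_eps hE x.2 hγ (hσ.mem _), map_mul,
        ValuationSubring.valuation_algEquiv_eq h.mem_iff γ⁻¹]
      exact mul_lt_one_of_nonneg_of_lt_one_left zero_le (ih a d) (hlt d b).le
  have h1 := hpow (orderOf x - 1) o o
  rw [Nat.sub_add_cancel (orderOf_pos x), pow_orderOf_eq_one, h.sigma_one hE hσ o,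
    h.coord_i hE, if_pos rfl, map_one] at h1
  exact lt_irrefl _ h1

/-- Since `σ(x)` transforms the matrix units into elements of `(i AK i)^L`, the products of the
coordinates of `σ(x)⁻¹` and `σ(x)` are integral. -/
theorem valuation_coord_mul_le_one (x : H) (o a b d e : Fin n) :
    𝒪.valuation (coord f E o (τ x) a b) * 𝒪.valuation (coord f E o (σ x) d e) ≤ 1 := by
  have h1 := hσ.conj_eq x (E b d) (hE.memCorner b d)
  rw [h.eps_E hE x.2 o] at h1
  have h2 : coord f E o (τ x * E b d * σ x) a e
      = coord f E o (τ x) a b * coord f E o (σ x) d e := by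
    rw [h.coord_mul hE ((hσ.inv_mem x).mul (hE.memCorner b d)) (hσ.mem x)]
    simp only [h.coord_mul hE (hσ.inv_mem x) (hE.mem b d), h.coord_E hE]
    simp [ite_and]
  rw [← map_mul, ← h2, ← h1, 𝒪.valuation_le_one_iff]
  exact h.coord_mem hE (((hE.mem b d).conj x.2 (h.conj_i x.2)).mono h.range_le) a e

variable [IsIntegrallyClosed A] [IsFractionRing A 𝕜] [IsGalois 𝕜 𝕃]

/-- The inverse of `σ(x)` lies in `(i AK i)^L`. -/
theorem tau_mem (o : Fin n) (x : H) : MemCorner (algebraMap A 𝕃).range K H i (τ x) := by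
  refine h.memCorner_of_coord_mem hE (o := o) (hσ.inv_mem x) fun a b => ?_
  obtain ⟨d, e, hde⟩ := h.exists_one_le_valuation_coord_sigma hE hσ o x
  rw [← 𝒪.valuation_le_one_iff]
  exact (le_mul_of_one_le_right' hde).trans (h.valuation_coord_mul_le_one hE hσ x o a b d e)

/-- The elements `σ(x)` lie in `(i AK i)^L`: some coordinate of
`σ(x)⁻¹ = σ(x⁻¹) ^ ε(x)` is not in the maximal ideal. -/
theorem sigma_mem (o : Fin n) (x : H) : MemCorner (algebraMap A 𝕃).range K H i (σ x) := by
  refine h.memCorner_of_coord_mem hE (o := o) (hσ.mem x) fun d e => ?_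
  obtain ⟨a, b, hab⟩ := h.exists_one_le_valuation_coord_sigma hE hσ o x⁻¹
  obtain ⟨γ, hγ⟩ := h.conj_f x.2
  rw [← ValuationSubring.valuation_algEquiv_eq h.mem_iff γ⁻¹, ← h.coord_eps hE x.2 hγ (hσ.mem _),
    ← h.tau_eq hE hσ o] at hab
  rw [← 𝒪.valuation_le_one_iff]
  exact (le_mul_of_one_le_left' hab).trans (h.valuation_coord_mul_le_one hE hσ x o a b d e)

end IsBlockPair

end CrossedRepresentation

/-! ### The centralizer of the matrix units -/

section Corner

variable {A 𝕜 𝕃 G : Type*} [CommRing A] [Field 𝕜] [Field 𝕃] [Algebra A 𝕜] [Algebra 𝕜 𝕃]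
  [Algebra A 𝕃] [IsScalarTower A 𝕜 𝕃] [Group G] [FiniteDimensional 𝕜 𝕃] [CharZero 𝕃] [Finite G]
  {K H : Subgroup G} [Fintype K] [Fintype (H ⊓ K : Subgroup G)]
  {𝒪 : ValuationSubring 𝕃} {c c' : 𝕃} {eθ eφ f i : MonoidAlgebra 𝕃 G} {n : ℕ}
  {E : Fin n → Fin n → MonoidAlgebra 𝕃 G} {o : Fin n} {σ τ : H → MonoidAlgebra 𝕃 G}

namespace IsBlockPair

variable (h : IsBlockPair A 𝕜 K H 𝒪 c c' eθ eφ f i n) (hE : IsCornerUnits A K H i E)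
include h hE

/-- An element of `jAKj`, where `j = E o o`, is a product of `j` and an element of `AL`. -/
theorem exists_eq_mul_of_corner [IsIntegrallyClosed A] [IsFractionRing A 𝕜]
    [IsGalois 𝕜 𝕃] {y : MonoidAlgebra 𝕃 G} (hy : y ∈ coeffSubring (algebraMap A 𝕃).range K)
    (hl : E o o * y = y) (hr : y * E o o = y) :
    ∃ b ∈ coeffSubring (algebraMap A 𝕃).range (H ⊓ K), y = E o o * b := by
  have hj := hE.mem o o
  have hjL : ∀ l ∈ H ⊓ K, grp l * E o o = E o o * grp l := hj.comm
  have hyγ : ∀ γ : 𝕃 ≃ₐ[𝕜] 𝕃, gal γ y = y :=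
    gal_of_mem_coeffSubring (coeffSubring_mono range_algebraMap_le le_rfl hy)
  have hyi : y * i = y := by rw [← hr, mul_assoc, hj.right]
  have hiy : i * y = y := by rw [← hl, ← mul_assoc, hj.left]
  have hyf : f * y * eφ = f * y := by
    have h1 : f * y = f * y * f := by
      conv_lhs => rw [← hyi, ← h.f_mul_θ, mul_assoc f, ← mul_assoc eθ, ← h.schur_θ.commute hy,
        mul_assoc, h.θ_mul_i, ← mul_assoc]
    conv_lhs => rw [← hyi, mul_assoc, mul_assoc, h.i_mul_φ, ← mul_assoc, ← h1]
  have hφy : eφ * (f * y) = f * y := by rw [← mul_assoc, h.φ_mul_f]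
  -- the elements `s l` of `(i AK i)^L` that occur in the expansion of `f * y`
  set s : (H ⊓ K : Subgroup G) → MonoidAlgebra 𝕃 G := fun l =>
    ∑ m : (H ⊓ K : Subgroup G), conj (m : G) (y * grp (l : G)⁻¹) with hs
  have hjs : ∀ l, E o o * s l * E o o = s l := by
    intro l
    rw [hs]
    simp only [Finset.mul_sum, Finset.sum_mul]
    refine Finset.sum_congr rfl fun m _ => ?_
    have : conj (m : G) (E o o) = E o o := (conj_eq_iff _ _ _).mpr (hjL m m.2).symm
    conv_lhs => rw [← this, ← conj_mul, ← conj_mul, ← mul_assoc, hl, mul_assoc,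
      hjL _ ((H ⊓ K).inv_mem l.2), ← mul_assoc, hr]
  have hsmem : ∀ l, MemCorner (algebraMap A 𝕃).range K H i (s l) := by
    refine fun l => ⟨sum_mem fun m _ => conj_mem_coeffSubring (fun g => ?_)
      (mul_mem hy (grp_mem_coeffSubring (K.inv_mem l.2.2))), ?_, ?_, fun m hm => ?_⟩
    · rw [K.mul_mem_cancel_right (K.inv_mem m.2.2), K.mul_mem_cancel_left m.2.2]
    · rw [← hjs l, ← mul_assoc, ← mul_assoc, hj.left]
    · rw [← hjs l, mul_assoc, hj.right]
    · symm
      rw [← conj_eq_iff, hs, conj_sum]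
      simp only [conj_conj]
      exact Equiv.sum_comp (Equiv.mulRight (⟨m, hm⟩ : (H ⊓ K : Subgroup G)))
        fun m : (H ⊓ K : Subgroup G) => conj (m : G) (y * grp (l : G)⁻¹)
  have hsf : ∀ l, f * s l = coord f E o (s l) o o • (E o o * f) := by
    intro l
    rw [← h.coord_spec hE (hsmem l), hjs, h.mul_f' (hsmem l)]
  have hexp : f * y = c' ^ 2 • ∑ l : (H ⊓ K : Subgroup G), (f * s l) * grp (l : G) := by
    conv_lhs => rw [h.schur_φ.eq_sum_sum hyf hφy]
    congr 1
    refine Finset.sum_congr rfl fun l _ => ?_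
    congr 1
    rw [hs]
    simp only [Finset.mul_sum]
    refine Finset.sum_congr rfl fun m _ => ?_
    have : conj (m : G) f = f := (conj_eq_iff _ _ _).mpr (h.grp_mul_f m.2).symm
    conv_rhs => rw [← this, ← conj_mul, ← mul_assoc]
  set b₀ : MonoidAlgebra 𝕃 G :=
    ∑ l : (H ⊓ K : Subgroup G), (c' ^ 2 * coord f E o (s l) o o) • grp (l : G) with hb₀
  have hb₀mem : b₀ ∈ coeffSubring 𝒪.toSubring (H ⊓ K) := sum_mem fun l _ =>
    smul_mem_coeffSubring (mul_mem (pow_mem (by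
      obtain ⟨u, hu⟩ := h.unit_φ
      exact hu ▸ h.range_le ⟨u, rfl⟩) 2) (h.coord_mem hE ((hsmem l).mono h.range_le) o o))
      (grp_mem_coeffSubring l.2)
  have hfy : f * y = E o o * f * b₀ := by
    rw [hexp, hb₀, Finset.mul_sum, Finset.smul_sum]
    refine Finset.sum_congr rfl fun l _ => ?_
    rw [hsf, smul_mul_assoc, smul_smul, mul_smul_comm]
  refine ⟨galoisTrace 𝕜 (eφ * b₀),
    galoisTrace_mem_coeffSubring h.mem_iff (mul_mem h.mem_φ hb₀mem), ?_⟩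
  rw [mul_galoisTrace (hE.gal_eq_self · o o), ← mul_assoc]
  have hjφ : E o o * eφ = E o o * f := by rw [← hj.right, mul_assoc, h.i_mul_φ]; rw [hj.right]
  rw [hjφ, ← hfy, ← galoisTrace_mul hyγ, ← h.i_eq, hiy]

section Twisted

variable [K.Normal] (hσ : IsMagicCrossed 𝕜 K H i E σ τ)
include hσ

theorem tau_of_mem (o : Fin n) (x : H) (hx : (x : G) ∈ K) : τ x = i := by
  rw [← hσ.inv_mul x, hσ.coset x hx, h.sigma_one hE hσ o, (hσ.inv_mem x).right]

/-- The elements `x σ(x)⁻¹` centralize the matrix units. -/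
theorem twisted_mul_E (o : Fin n) (x : H) (a b : Fin n) :
    grp (x : G) * τ x * E a b = E a b * (grp (x : G) * τ x) := by
  have h1 := hσ.conj_eq x (E a b) (hE.memCorner a b)
  rw [h.eps_E hE x.2 o, conj_eq_iff] at h1
  rw [← mul_assoc, h1]
  simp only [mul_assoc, hσ.mul_inv]
  rw [(hE.mem a b).right]

theorem tau_mul (o : Fin n) (x y : H) : τ (x * y) = τ y * eps E (y : G) (τ x) := by
  have h1 : σ (x * y) * (τ y * eps E (y : G) (τ x)) = i := by
    rw [← hσ.crossed, mul_assoc, ← mul_assoc (σ y), hσ.mul_inv,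
      (h.eps_mem hE y.2 (hσ.inv_mem x)).left, ← h.eps_mul' hE y.2 o (hσ.mem x) (hσ.inv_mem x),
      hσ.mul_inv, h.eps_i hE y.2 o]
  have h2 := congrArg (τ (x * y) * ·) h1
  simp only [(hσ.inv_mem (x * y)).right] at h2
  rw [← h2, ← mul_assoc, hσ.inv_mul, ← mul_assoc, (hσ.inv_mem y).left]

/-- The elements `x σ(x)⁻¹` form a group. -/
theorem twisted_mul (o : Fin n) (x y : H) :
    grp (x : G) * τ x * (grp (y : G) * τ y) = grp ((x * y : H) : G) * τ (x * y) := by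
  have h1 := (conj_eq_iff _ _ _).mp (hσ.conj_eq y (τ x) (hσ.inv_mem x))
  have h2 : τ y * eps E (y : G) (τ x) * σ y * τ y = τ (x * y) := by
    rw [mul_assoc, hσ.mul_inv, mul_assoc, (h.eps_mem hE y.2 (hσ.inv_mem x)).right,
      h.tau_mul hE hσ o]
  rw [mul_assoc, ← mul_assoc (τ x), h1, mul_assoc (grp (y : G)), h2, ← mul_assoc, grp_mul_grp]
  rfl

/-- On the Galois conjugates of `e_φ`, the traces of `j x σ(x)⁻¹` and of `x` are proportional. -/
theorem coeff_one_twisted (o : Fin n) (x : H) :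
    c' * (E o o * (grp (x : G) * τ x) * galoisTrace 𝕜 eφ).coeff 1
      = c * (grp (x : G) * galoisTrace 𝕜 eφ).coeff 1 := by
  have := Fintype.ofFinite (𝕃 ≃ₐ[𝕜] 𝕃)
  have hterm : ∀ γ : 𝕃 ≃ₐ[𝕜] 𝕃, c' * (E o o * (grp (x : G) * τ x) * gal γ eφ).coeff 1
      = c * (grp (x : G) * gal γ eφ).coeff 1 := by
    intro γ
    have hφγ : gal γ eφ ∈ coeffSubring (⊤ : Subring 𝕃) (H ⊓ K) :=
      mem_coeffSubring_top (gal_mem_coeffSubring h.mem_iff h.mem_φ γ)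
    by_cases hx : (x : G) ∈ K
    · have hcard : (Nat.card (H ⊓ K : Subgroup G) : 𝕃) ≠ 0 := Nat.cast_ne_zero.mpr Nat.card_pos.ne'
      have hxL : (x : G) ∈ H ⊓ K := ⟨x.2, hx⟩
      have h1 : E o o * (grp (x : G) * τ x) * gal γ eφ = grp (x : G) * gal γ (E o o * f) := by
        rw [h.tau_of_mem hE hσ o x hx, map_mul, hE.gal_eq_self, ← mul_assoc,
          ← (hE.mem o o).comm x hxL,
          mul_assoc, h.i_mul_gal_φ, mul_assoc]
      have h2 := (h.schur_φ.map (γ : 𝕃 ≃+* 𝕃) (h.gal_c' γ)).coeff_one_mul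
        (w := gal γ (E o o * f)) (y := grp (x : G)) (fun g hg => by
          rw [← gal_grp γ g, ← map_mul, ← map_mul, ← mul_assoc, (hE.mem o o).comm g hg, mul_assoc,
            h.grp_mul_f hg, mul_assoc]) (by
          change gal γ eφ * gal γ (E o o * f) = _
          rw [← map_mul, h.E_mul_f hE, ← mul_assoc, h.φ_mul_f]) (grp_mem_coeffSubring hxL)
      change _ = (gal γ eφ * grp (x : G)).coeff 1 * _ at h2
      have h3 : γ (c * c' * Nat.card (H ⊓ K : Subgroup G))
          = c * c' * Nat.card (H ⊓ K : Subgroup G) := by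
        rw [map_mul, map_mul, h.gal_c, h.gal_c', map_natCast]
      rw [coeff_gal, h.coeff_one_E_mul_f hE, h3, coeff_one_mul_comm (gal γ eφ)] at h2
      rw [h1]
      refine mul_left_cancel₀ (mul_ne_zero h.schur_φ.ne_zero hcard) ?_
      linear_combination h2
    · have hx' : (x : G)⁻¹ ∉ K := fun h => hx (by simpa using K.inv_mem h)
      have hz : ∀ y ∈ coeffSubring (⊤ : Subring 𝕃) K, (grp (x : G) * y).coeff 1 = 0 := by
        intro y hy
        rw [coeff_grp_mul, mul_one, (hy _).2 hx']
      have hφK := coeffSubring_mono le_rfl inf_le_right hφγ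
      rw [hz _ hφK, mul_assoc, coeff_one_mul_comm, mul_assoc, mul_assoc, hz _ (mul_mem
        (mem_coeffSubring_top (hσ.inv_mem x).mem) (mul_mem hφK (mem_coeffSubring_top
          (hE.mem o o).mem)))]
      simp
  rw [galoisTrace_eq, Finset.mul_sum, Finset.mul_sum]
  simp only [MonoidAlgebra.coeff_sum, Finsupp.coe_finsetSum, Finset.sum_apply, Finset.mul_sum,
    hterm]

end Twisted

end IsBlockPair
end Corner

/-! ### The isomorphism onto the corner -/

section Embedding

variable {A 𝕃 G : Type*} [CommRing A] [Field 𝕃] [Algebra A 𝕃] [Group G] {M : Type*} [Group M]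

theorem embed_single (ν : M →* G) (m : M) (r : A) :
    (embed ν (MonoidAlgebra.single m r) : MonoidAlgebra 𝕃 G) = algebraMap A 𝕃 r • grp (ν m) := by
  simp [embed, grp, Algebra.algebraMap_eq_smul_one]

theorem embed_smul (ν : M →* G) (r : A) (a : MonoidAlgebra A M) :
    (embed ν (r • a) : MonoidAlgebra 𝕃 G) = algebraMap A 𝕃 r • embed ν a := by
  have h1 : r • a = MonoidAlgebra.single 1 r * a := by ext; simp
  rw [h1, map_mul, embed_single, map_one, grp_one, smul_mul_assoc, one_mul]

theorem embed_mem (ν : M →* G) (a : MonoidAlgebra A M) :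
    (embed ν a : MonoidAlgebra 𝕃 G) ∈ coeffSubring (algebraMap A 𝕃).range ν.range :=
  mem_range_embed.mp ⟨a, rfl⟩

variable (𝕜 : Type*) [Field 𝕜] [Algebra A 𝕜] [Algebra 𝕜 𝕃] [IsScalarTower A 𝕜 𝕃]
  [IsFractionRing A 𝕜]

include 𝕜 in
theorem algebraMap_injective : Function.Injective (algebraMap A 𝕃) := by
  rw [IsScalarTower.algebraMap_eq A 𝕜 𝕃]
  exact (algebraMap 𝕜 𝕃).injective.comp (IsFractionRing.injective A 𝕜)

include 𝕜 in
theorem embed_injective_of_isFractionRing {ν : M →* G} (hν : Function.Injective ν) :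
    Function.Injective (embed ν : MonoidAlgebra A M →+* MonoidAlgebra 𝕃 G) :=
  embed_injective hν (algebraMap_injective 𝕜)

end Embedding

section Isomorphism

variable {A 𝕜 𝕃 G : Type*} [CommRing A] [Field 𝕜] [Field 𝕃] [Algebra A 𝕜] [Algebra 𝕜 𝕃]
  [Algebra A 𝕃] [IsScalarTower A 𝕜 𝕃] [Group G] [FiniteDimensional 𝕜 𝕃] [CharZero 𝕃] [Finite G]
  {K H : Subgroup G} [Fintype K] [Fintype (H ⊓ K : Subgroup G)]
  {𝒪 : ValuationSubring 𝕃} {c c' : 𝕃} {eθ eφ f i : MonoidAlgebra 𝕃 G} {n : ℕ}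
  {E : Fin n → Fin n → MonoidAlgebra 𝕃 G} {o : Fin n} {σ τ : H → MonoidAlgebra 𝕃 G}

theorem embed_algHom_single {A 𝕃 G : Type*} [CommRing A] [Field 𝕃] [Algebra A 𝕃] [Group G]
    {H : Subgroup G} {w : H → MonoidAlgebra 𝕃 G} {j : MonoidAlgebra A G} (hj : IsIdempotentElem j)
    {F : MonoidAlgebra A H →ₐ[A] hj.Corner}
    (hF : ∀ x : H, embed (MonoidHom.id G) (F (MonoidAlgebra.single x 1)).1 = w x)
    (x : H) (r : A) :
    embed (MonoidHom.id G) (F (MonoidAlgebra.single x r)).1 = algebraMap A 𝕃 r • w x := by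
  have : (MonoidAlgebra.single x r : MonoidAlgebra A H) = r • MonoidAlgebra.single x 1 := by simp
  rw [this, map_smul, ← hF, ← embed_smul]
  rfl

namespace IsBlockPair

variable [K.Normal] (h : IsBlockPair A 𝕜 K H 𝒪 c c' eθ eφ f i n) (hE : IsCornerUnits A K H i E)
  (hσ : IsMagicCrossed 𝕜 K H i E σ τ) {j : MonoidAlgebra A G} (hj : IsIdempotentElem j)
include h hE hσ

section

variable {F : MonoidAlgebra A H →ₐ[A] hj.Corner} (hF : ∀ x : H,
    embed (MonoidHom.id G) (F (MonoidAlgebra.single x 1)).1 = E o o * (grp (x : G) * τ x))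
include hF

/-- On `AL` the homomorphism is multiplication with `j`. -/
theorem exists_embed_algHom_eq {b : MonoidAlgebra 𝕃 G}
    (hb : b ∈ coeffSubring (algebraMap A 𝕃).range (H ⊓ K)) : ∃ a : MonoidAlgebra A H,
      embed H.subtype a = b ∧ embed (MonoidHom.id G) (F a).1 = E o o * b := by
  choose r hr using fun g => (hb g).1
  have hcoe : ∀ (s : Finset (H ⊓ K : Subgroup G)) (x : (H ⊓ K : Subgroup G) → hj.Corner),
      (∑ l ∈ s, x l).1 = ∑ l ∈ s, (x l).1 := fun s x =>
    map_sum (⟨⟨Subtype.val, rfl⟩, fun _ _ => rfl⟩ : hj.Corner →+ MonoidAlgebra A G) x s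
  refine ⟨∑ l : (H ⊓ K : Subgroup G), MonoidAlgebra.single (⟨l, l.2.1⟩ : H) (r l), ?_, ?_⟩
  · conv_rhs => rw [eq_sum_of_mem_coeffSubring hb]
    rw [map_sum]
    exact Finset.sum_congr rfl fun l _ => by rw [embed_single, hr]; rfl
  · conv_rhs => rw [eq_sum_of_mem_coeffSubring hb, Finset.mul_sum]
    rw [map_sum, hcoe, map_sum]
    refine Finset.sum_congr rfl fun l _ => ?_
    rw [embed_algHom_single hj hF, hr, h.tau_of_mem hE hσ o _ l.2.2, mul_smul_comm,
      h.grp_mul_i l.2.1, ← mul_assoc, (hE.mem o o).right]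

/-- The homomorphism multiplies the traces on `e_(φ)` by `c / c'`. -/
theorem coeff_one_embed_algHom (a : MonoidAlgebra A H) :
    c' * (embed (MonoidHom.id G) (F a).1 * galoisTrace 𝕜 eφ).coeff 1
      = c * (embed H.subtype a * galoisTrace 𝕜 eφ).coeff 1 := by
  induction a using MonoidAlgebra.induction_linear with
  | zero =>
    have : (F 0).1 = 0 := by rw [map_zero]; rfl
    rw [this]; simp
  | add a b ha hb =>
    have : (F (a + b)).1 = (F a).1 + (F b).1 := by rw [map_add]; rfl
    rw [this, map_add, map_add, add_mul, add_mul, MonoidAlgebra.coeff_add, MonoidAlgebra.coeff_add,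
      Finsupp.add_apply, Finsupp.add_apply, mul_add, ha, hb, mul_add]
  | single x r =>
    rw [embed_algHom_single hj hF, embed_single, smul_mul_assoc, smul_mul_assoc,
      MonoidAlgebra.coeff_smul_apply, MonoidAlgebra.coeff_smul_apply, smul_eq_mul, smul_eq_mul,
      mul_left_comm, h.coeff_one_twisted hE hσ o x, mul_left_comm]
    rfl

/-- The homomorphism is injective on `AH e_(φ)`: the coefficients of an element are its traces with
the elements of `H`, and these are determined by its image. -/
theorem eq_zero_of_algHom_eq_zero [IsFractionRing A 𝕜] {e a : MonoidAlgebra A H}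
    (he : embed H.subtype e = galoisTrace 𝕜 eφ) (hae : a * e = a) (ha : F a = 0) : a = 0 := by
  refine embed_injective_of_isFractionRing (𝕃 := 𝕃) 𝕜 H.subtype_injective ?_
  rw [map_zero]
  ext g
  by_cases hg : g ∈ H
  · have h1 := h.coeff_one_embed_algHom hE hσ hj hF (MonoidAlgebra.single ⟨g, hg⟩⁻¹ 1 * a)
    have h2 : (F (MonoidAlgebra.single ⟨g, hg⟩⁻¹ 1 * a)).1 = 0 := by
      rw [map_mul, ha, mul_zero]; rfl
    rw [h2, map_zero, zero_mul, ← he, ← map_mul, mul_assoc, hae, map_mul, embed_single,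
      map_one (algebraMap A 𝕃), one_smul, coeff_grp_mul] at h1
    simp only [MonoidAlgebra.coeff_zero, Finsupp.coe_zero, Pi.zero_apply, mul_zero, zero_eq_mul,
      h.schur_θ.ne_zero, false_or] at h1
    simpa using h1
  · have := (embed_mem (𝕃 := 𝕃) H.subtype a g).2 (by simpa using hg)
    simpa using this

end

variable [IsIntegrallyClosed A] [IsFractionRing A 𝕜] [IsGalois 𝕜 𝕃]
  (hjE : embed (MonoidHom.id G) j = E o o)
include hjE

/-- The homomorphism `AH → jAGj` sending `x` to `j x σ(x)⁻¹`. -/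
theorem exists_algHom_corner : ∃ F : MonoidAlgebra A H →ₐ[A] hj.Corner, ∀ x : H,
    embed (MonoidHom.id G) (F (MonoidAlgebra.single x 1)).1 = E o o * (grp (x : G) * τ x) := by
  have hinj := embed_injective_of_isFractionRing (A := A) (𝕃 := 𝕃) (ν := MonoidHom.id G) 𝕜
    Function.injective_id
  have hEE : E o o * E o o = E o o := by rw [hE.mul, if_pos rfl]
  have hex : ∀ x : H, ∃ a : MonoidAlgebra A G,
      embed (MonoidHom.id G) a = E o o * (grp (x : G) * τ x) := fun x => by
    rw [mem_range_embed]
    have hle : K ≤ (MonoidHom.id G).range := fun g _ => ⟨g, rfl⟩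
    exact mul_mem (coeffSubring_mono le_rfl hle (hE.mem o o).mem)
      (mul_mem (grp_mem_coeffSubring ⟨x, rfl⟩)
        (coeffSubring_mono le_rfl hle (h.tau_mem hE hσ o x).mem))
  choose m hm using hex
  have hcorner : ∀ x, j * m x * j = m x := fun x => hinj (by
    rw [map_mul, map_mul, hm, hjE, ← mul_assoc (E o o), hEE, mul_assoc, h.twisted_mul_E hE hσ o,
      ← mul_assoc, hEE])
  let μ : H →* hj.Corner :=
    { toFun := fun x => ⟨m x, m x, hcorner x⟩
      map_one' := Subtype.ext (hinj (by
        change embed (MonoidHom.id G) (m 1) = embed (MonoidHom.id G) j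
        rw [hm, hjE, h.tau_of_mem hE hσ o 1 K.one_mem, Subgroup.coe_one, grp_one, one_mul,
          (hE.mem o o).right]))
      map_mul' := fun x y => Subtype.ext (hinj (by
        change embed (MonoidHom.id G) (m (x * y)) = embed (MonoidHom.id G) (m x * m y)
        rw [map_mul, hm, hm, hm, ← h.twisted_mul hE hσ o, ← mul_assoc (E o o * _),
          mul_assoc (E o o) _ (E o o), h.twisted_mul_E hE hσ o, ← mul_assoc (E o o) (E o o), hEE,
          mul_assoc (E o o)])) }
  refine ⟨MonoidAlgebra.lift A hj.Corner H μ, fun x => ?_⟩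
  rw [MonoidAlgebra.lift_single, one_smul]
  exact hm x

section

variable {F : MonoidAlgebra A H →ₐ[A] hj.Corner} (hF : ∀ x : H,
    embed (MonoidHom.id G) (F (MonoidAlgebra.single x 1)).1 = E o o * (grp (x : G) * τ x))
include hF

/-- Surjectivity follows from `j x k j = j x σ(x)⁻¹ · j σ(x) k j` and `jAKj = j · AL`. -/
theorem algHom_surjective (hfac : ∀ g : G, ∃ h ∈ H, ∃ k ∈ K, g = h * k) :
    Function.Surjective F := by
  have hinj := embed_injective_of_isFractionRing (A := A) (𝕃 := 𝕃) (ν := MonoidHom.id G) 𝕜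
    Function.injective_id
  have hEE : E o o * E o o = E o o := by rw [hE.mul, if_pos rfl]
  have hEEx : ∀ x, E o o * (E o o * x) = E o o * x := fun x => by rw [← mul_assoc, hEE]
  have hmem : ∀ r : MonoidAlgebra A G, toCorner hj r ∈ F.range := by
    intro r
    induction r using MonoidAlgebra.induction_linear with
    | zero =>
      have : toCorner hj (0 : MonoidAlgebra A G) = 0 := Subtype.ext (by simp [toCorner]; rfl)
      rw [this]
      exact zero_mem _
    | add r s hr hs =>
      have : toCorner hj (r + s) = toCorner hj r + toCorner hj s :=
        Subtype.ext (by simp [toCorner, mul_add, add_mul]; rfl)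
      rw [this]
      exact add_mem hr hs
    | single g a =>
      obtain ⟨x, hx, k, hk, rfl⟩ := hfac g
      set y := E o o * σ ⟨x, hx⟩ * grp k * E o o with hy
      obtain ⟨b, hb, hyb⟩ := h.exists_eq_mul_of_corner hE (o := o) (y := y)
        (mul_mem (mul_mem (mul_mem (hE.mem o o).mem (h.sigma_mem hE hσ o _).mem)
          (grp_mem_coeffSubring hk)) (hE.mem o o).mem)
        (by rw [hy]; simp only [← mul_assoc, hEE]) (by rw [hy]; simp only [mul_assoc, hEE])
      obtain ⟨a', -, ha'⟩ := h.exists_embed_algHom_eq hE hσ hj hF hb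
      have : toCorner hj (MonoidAlgebra.single (x * k) a)
          = a • (F (MonoidAlgebra.single ⟨x, hx⟩ 1) * F a') := by
        refine Subtype.ext (hinj ?_)
        change embed (MonoidHom.id G) (j * MonoidAlgebra.single (x * k) a * j)
          = embed (MonoidHom.id G) (a • ((F (MonoidAlgebra.single ⟨x, hx⟩ 1)).1 * (F a').1))
        have h1 := hσ.conj_eq ⟨x, hx⟩ (E o o) (hE.memCorner o o)
        rw [h.eps_E hE hx o, conj_eq_iff] at h1
        rw [embed_smul, map_mul, map_mul, map_mul, ha', ← hyb, hF, hjE, embed_single,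
          MonoidHom.id_apply, ← grp_mul_grp, mul_smul_comm, smul_mul_assoc]
        congr 1
        calc E o o * (grp x * grp k) * E o o = E o o * (E o o * grp x) * grp k * E o o := by
              simp only [← mul_assoc, hEE]
          _ = E o o * (grp x * τ ⟨x, hx⟩) * (E o o * E o o) * σ ⟨x, hx⟩ * grp k * E o o := by
              rw [h1, hEE]; simp only [mul_assoc]
          _ = _ := by rw [hy]; simp only [mul_assoc, hEEx]
      rw [this]
      exact F.range.smul_mem (mul_mem ⟨_, rfl⟩ ⟨_, rfl⟩) a
  intro z
  obtain ⟨r, hr⟩ := z.2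
  obtain ⟨a, ha⟩ := hmem r
  exact ⟨a, ha.trans (Subtype.ext hr)⟩

theorem algHom_galoisTrace {e : MonoidAlgebra A H}
    (he : embed H.subtype e = galoisTrace 𝕜 eφ) : F e = 1 := by
  have hmem : galoisTrace 𝕜 eφ ∈ coeffSubring (algebraMap A 𝕃).range (H ⊓ K) :=
    galoisTrace_mem_coeffSubring h.mem_iff h.mem_φ
  obtain ⟨a, ha, hFa⟩ := h.exists_embed_algHom_eq hE hσ hj hF hmem
  have hae : a = e := embed_injective_of_isFractionRing (𝕃 := 𝕃) 𝕜 H.subtype_injective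
    (ha.trans he.symm)
  subst hae
  refine Subtype.ext (embed_injective_of_isFractionRing (𝕃 := 𝕃)
    (ν := MonoidHom.id G) 𝕜 Function.injective_id ?_)
  change _ = embed (MonoidHom.id G) j
  rw [hFa, hjE, ← commute_of_mem_coeffSubring (hE.mem o o).comm hmem, ← (hE.mem o o).left,
    ← mul_assoc, h.galoisTrace_φ_mul_i]

end

/-- `AH e_(φ)` is isomorphic to `jAGj`. -/
theorem exists_algEquiv_corner (hfac : ∀ g : G, ∃ h ∈ H, ∃ k ∈ K, g = h * k)
    {e : MonoidAlgebra A H} (he : IsIdempotentElem e)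
    (heφ : embed H.subtype e = galoisTrace 𝕜 eφ) :
    ∃ Φ : he.Corner ≃ₐ[A] hj.Corner, ∀ x : H,
      embed (MonoidHom.id G) (Φ (toCorner he (MonoidAlgebra.single x 1))).1
        = E o o * (grp (x : G) * τ x) := by
  obtain ⟨F, hF⟩ := h.exists_algHom_corner hE hσ hj hjE
  have hone := h.algHom_galoisTrace hE hσ hj hjE hF heφ
  let Φ : he.Corner →ₐ[A] hj.Corner :=
    { toFun := fun a => F a.1
      map_one' := hone
      map_mul' := fun a b => map_mul F a.1 b.1
      map_zero' := map_zero F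
      map_add' := fun a b => map_add F a.1 b.1
      commutes' := fun r => by
        change F (r • e) = _
        rw [map_smul, hone, Algebra.algebraMap_eq_smul_one] }
  have hinj : Function.Injective Φ := by
    rw [injective_iff_map_eq_zero]
    intro a ha
    refine Subtype.ext (h.eq_zero_of_algHom_eq_zero hE hσ hj hF heφ ?_ ha)
    exact ((Subsemigroup.mem_corner_iff he).mp a.2).2
  have htoCorner : ∀ r, Φ (toCorner he r) = F r := fun r => by
    change F (e * r * e) = F r
    rw [map_mul, map_mul, hone, one_mul, mul_one]
  have hsurj : Function.Surjective Φ := fun z => by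
    obtain ⟨r, rfl⟩ := h.algHom_surjective hE hσ hj hjE hF hfac z
    exact ⟨toCorner he r, htoCorner r⟩
  refine ⟨AlgEquiv.ofBijective Φ ⟨hinj, hsurj⟩, fun x => ?_⟩
  change embed (MonoidHom.id G) (Φ (toCorner he (MonoidAlgebra.single x 1))).1 = _
  rw [htoCorner, hF]

end IsBlockPair
end Isomorphism

/-! ### The ideal generated by a primitive idempotent -/

section FullIdempotent

/-- If `e` is a central element of `RjR` with `je = j`, then `RjR = Re`. -/
theorem top_mul_span_mul_top_eq {A R ι : Type*} [CommRing A] [Ring R] [Algebra A R] [Fintype ι]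
    {e j : R} (he : ∀ r, r * e = e * r) (hje : j * e = j) {x y : ι → R}
    (hxy : ∑ t, x t * j * y t = e) :
    (⊤ * Submodule.span A {j} * ⊤ : Submodule A R) = ⊤ * Submodule.span A {e} := by
  refine le_antisymm (Submodule.mul_le.mpr fun m hm r _ => ?_)
    (Submodule.mul_le.mpr fun r _ t ht => ?_)
  · have hle : (⊤ * Submodule.span A {j} : Submodule A R)
        ≤ (⊤ * Submodule.span A {e} : Submodule A R).comap (LinearMap.mulRight A r) := by
      refine Submodule.mul_le.mpr fun q _ t ht => ?_
      obtain ⟨a, rfl⟩ := Submodule.mem_span_singleton.mp ht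
      have : q * a • j * r = (a • (q * j * r)) * e := by
        rw [mul_smul_comm, smul_mul_assoc, smul_mul_assoc, mul_assoc _ r, he, ← mul_assoc,
          mul_assoc q j e, hje]
      rw [Submodule.mem_comap, LinearMap.mulRight_apply, this]
      exact Submodule.mul_mem_mul trivial (Submodule.mem_span_singleton_self e)
    exact hle hm
  · obtain ⟨a, rfl⟩ := Submodule.mem_span_singleton.mp ht
    have : r * a • e = ∑ t, (a • (r * x t)) * j * y t := by
      rw [← hxy, mul_smul_comm, Finset.mul_sum, Finset.smul_sum]
      simp only [mul_assoc, smul_mul_assoc]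
    rw [this]
    exact sum_mem fun t _ => Submodule.mul_mem_mul (Submodule.mul_mem_mul trivial
      (Submodule.mem_span_singleton_self j)) trivial

variable {A 𝕜 𝕃 G : Type*} [CommRing A] [Field 𝕜] [Field 𝕃] [Algebra A 𝕜] [Algebra 𝕜 𝕃]
  [Algebra A 𝕃] [IsScalarTower A 𝕜 𝕃] [Group G] [FiniteDimensional 𝕜 𝕃] [CharZero 𝕃]
  {K H : Subgroup G} [Fintype K] [Fintype (H ⊓ K : Subgroup G)]
  {𝒪 : ValuationSubring 𝕃} {c c' : 𝕃} {eθ eφ f i : MonoidAlgebra 𝕃 G} {n : ℕ}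
  {E : Fin n → Fin n → MonoidAlgebra 𝕃 G} {o : Fin n}

namespace IsBlockPair

variable [IsIntegrallyClosed A] [IsFractionRing A 𝕜] [IsGalois 𝕜 𝕃]
  (h : IsBlockPair A 𝕜 K H 𝒪 c c' eθ eφ f i n) (hE : IsCornerUnits A K H i E)
include h

/-- As `f` has a unit coefficient and `c` is a unit, a suitable class sum shows that `e_(θ)` lies
in the ideal generated by `i`. -/
theorem exists_sum_conj_eq : ∃ w ∈ coeffSubring (algebraMap A 𝕃).range K,
    ∑ k : K, conj (k : G) (i * w) = galoisTrace 𝕜 eθ := by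
  have hf0 : f ≠ 0 := fun h0 => h.coeff_one_f_ne_zero (by simp [h0])
  obtain ⟨g, hg⟩ := exists_valuation_coeff_eq_one 𝒪 h.f_mem h.f_mul_f hf0
  have hu0 : f.coeff g ≠ 0 := fun h0 => by simp [h0] at hg
  have hgK : g ∈ K := by
    by_contra hgK
    exact hu0 ((h.f_mem g).2 hgK)
  have hgK' := K.inv_mem hgK
  have hfK := mem_coeffSubring_top h.f_mem
  set z : 𝕃 := c ^ 2 * (f.coeff g)⁻¹ with hz
  have hz𝒪 : z ∈ 𝒪.toSubring := by
    refine 𝒪.toSubring.mul_mem (pow_mem ?_ 2) ?_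
    · obtain ⟨u, hu⟩ := h.unit_θ
      exact hu ▸ h.range_le ⟨u, rfl⟩
    · change _ ∈ 𝒪
      rw [← 𝒪.valuation_le_one_iff, map_inv₀, hg, inv_one]
  have hw : z • eθ * grp g⁻¹ ∈ coeffSubring 𝒪.toSubring K :=
    mul_mem (smul_mem_coeffSubring hz𝒪 h.mem_θ) (grp_mem_coeffSubring hgK')
  refine ⟨galoisTrace 𝕜 (z • eθ * grp g⁻¹), galoisTrace_mem_coeffSubring h.mem_iff hw, ?_⟩
  have hconjθ : ∀ k : K, conj (k : G) eθ = eθ := fun k =>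
    (conj_eq_iff _ _ _).mpr (h.schur_θ.comm k k.2).symm
  have hsum : ∑ k : K, conj (k : G) (i * (z • eθ * grp g⁻¹)) = eθ := by
    have h1 := h.schur_θ.schur (f * grp g⁻¹) (mul_mem hfK (grp_mem_coeffSubring hgK'))
    rw [← mul_assoc, h.θ_mul_f, coeff_mul_grp, inv_inv, one_mul, Finset.sum_mul] at h1
    have h2 : ∀ k : K, conj (k : G) (i * (z • eθ * grp g⁻¹))
        = (f.coeff g)⁻¹ • c ^ 2 • (conj (k : G) (f * grp g⁻¹) * eθ) := by
      intro k
      rw [smul_smul, mul_comm, ← hz]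
      conv_rhs => rw [← hconjθ k, ← conj_mul, ← conj_smul]
      congr 1
      rw [smul_mul_assoc, mul_smul_comm, ← mul_assoc, h.i_mul_θ, mul_assoc,
        h.schur_θ.comm _ hgK', ← mul_assoc, h.f_mul_θ]
    rw [Finset.sum_congr rfl fun k _ => h2 k, ← Finset.smul_sum, ← Finset.smul_sum, h1, smul_smul,
      inv_mul_cancel₀ hu0, one_smul]
  have := Fintype.ofFinite (𝕃 ≃ₐ[𝕜] 𝕃)
  simp only [mul_galoisTrace h.gal_i, conj_galoisTrace]
  conv_rhs => rw [← hsum]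
  simp only [galoisTrace_eq, map_sum]
  exact Finset.sum_comm

include hE in
/-- `e_(θ)` lies in the ideal of `AG` generated by `j`. -/
theorem exists_sum_mul_mul_eq {e j : MonoidAlgebra A G}
    (he : embed (MonoidHom.id G) e = galoisTrace 𝕜 eθ)
    (hj : embed (MonoidHom.id G) j = E o o) :
    ∃ x y : K × Fin n → MonoidAlgebra A G, ∑ t, x t * j * y t = e := by
  have hex : ∀ {x : MonoidAlgebra 𝕃 G}, x ∈ coeffSubring (algebraMap A 𝕃).range K →
      ∃ a : MonoidAlgebra A G, embed (MonoidHom.id G) a = x := fun hx => by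
    rw [mem_range_embed]
    exact coeffSubring_mono (N' := (MonoidHom.id G).range) le_rfl (fun g _ => ⟨g, rfl⟩) hx
  obtain ⟨w, hw, hsum⟩ := h.exists_sum_conj_eq
  obtain ⟨w', hw'⟩ := hex hw
  choose E' hE' using fun a b => hex (hE.mem a b).mem
  refine ⟨fun t => MonoidAlgebra.single (t.1 : G)⁻¹ 1 * E' t.2 o,
    fun t => E' o t.2 * w' * MonoidAlgebra.single (t.1 : G) 1,
    embed_injective_of_isFractionRing (𝕃 := 𝕃)
    (ν := MonoidHom.id G) 𝕜 Function.injective_id ?_⟩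
  rw [he, ← hsum, map_sum, Fintype.sum_prod_type]
  refine Finset.sum_congr rfl fun k _ => ?_
  rw [← hE.sum, Finset.sum_mul, conj_sum]
  refine Finset.sum_congr rfl fun b _ => ?_
  have hEE : ∀ x, E b o * (E o o * (E o b * x)) = E b b * x := fun x => by
    rw [← mul_assoc, ← mul_assoc, hE.mul, if_pos rfl, hE.mul, if_pos rfl]
  simp only [map_mul, embed_single, map_one, one_smul, MonoidHom.id_apply, hj, hw', hE', conj,
    mul_assoc, hEE]

end IsBlockPair
end FullIdempotent

/-! ### Morita equivalence of full corners -/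

section Morita

open CategoryTheory

universe u

variable {R : Type u} [Ring R] {e : R}

/-- The subgroup `eM` of a module `M`, for an idempotent `e`. -/
def fixedPart (e : R) (M : Type*) [AddCommGroup M] [Module R M] : AddSubgroup M where
  carrier := {m | e • m = m}
  add_mem' := fun ha hb => by rw [Set.mem_ofPred_eq, smul_add, ha, hb]
  zero_mem' := smul_zero e
  neg_mem' := fun ha => by rw [Set.mem_ofPred_eq, smul_neg, ha]

theorem corner_mul (he : IsIdempotentElem e) (s : he.Corner) : e * s.1 = s.1 ∧ s.1 * e = s.1 :=
  (Subsemigroup.mem_corner_iff he).mp s.2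

/-- `eM` is a module over `eRe`. -/
instance fixedPartModule (he : IsIdempotentElem e) (M : Type*) [AddCommGroup M] [Module R M] :
    Module he.Corner (fixedPart e M) where
  smul s m := ⟨s.1 • m.1, by
    change e • s.1 • m.1 = s.1 • m.1
    rw [← mul_smul, (corner_mul he s).1]⟩
  one_smul m := Subtype.ext m.2
  mul_smul s t m := Subtype.ext (mul_smul s.1 t.1 m.1)
  smul_zero s := Subtype.ext (smul_zero s.1)
  smul_add s m m' := Subtype.ext (smul_add s.1 m.1 m'.1)
  add_smul s t m := Subtype.ext (add_smul s.1 t.1 m.1)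
  zero_smul m := Subtype.ext (zero_smul R m.1)

theorem coe_corner_smul (he : IsIdempotentElem e) {M : Type*} [AddCommGroup M] [Module R M]
    (s : he.Corner) (m : fixedPart e M) : (s • m).1 = s.1 • m.1 := rfl

/-- The element `e • m` of `eM`. -/
def toFixedPart (he : IsIdempotentElem e) {M : Type*} [AddCommGroup M] [Module R M] (m : M) :
    fixedPart e M :=
  ⟨e • m, by change e • e • m = e • m; rw [← mul_smul, he.eq]⟩

/-- The functor `M ↦ eM` from `R`-modules to `eRe`-modules. -/
def fixedPartFunctor (he : IsIdempotentElem e) : ModuleCat.{u} R ⥤ ModuleCat.{u} he.Corner where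
  obj M := ModuleCat.of he.Corner (fixedPart e M)
  map f := ModuleCat.ofHom
    { toFun := fun m => ⟨f.hom m.1, by
        change e • f.hom m.1 = f.hom m.1
        rw [← map_smul]
        exact congrArg f.hom m.2⟩
      map_add' := fun a b => Subtype.ext (map_add f.hom a.1 b.1)
      map_smul' := fun s m => Subtype.ext (map_smul f.hom s.1 m.1) }

variable {ι : Type*} [Fintype ι] {x y : ι → R}

/-- If `e` is full then a homomorphism of `R`-modules is determined by its restriction to `eM`. -/
theorem eq_sum_smul_toFixedPart (he : IsIdempotentElem e) (hxy : ∑ t, x t * e * y t = 1)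
    {M : Type*} [AddCommGroup M] [Module R M] (m : M) :
    m = ∑ t, x t • (toFixedPart he (y t • m)).1 := by
  conv_lhs => rw [← one_smul R m, ← hxy, Finset.sum_smul]
  simp only [mul_smul]
  rfl

theorem fixedPartFunctor_faithful (he : IsIdempotentElem e) (hxy : ∑ t, x t * e * y t = 1) :
    (fixedPartFunctor he).Faithful where
  map_injective {M N} f g hfg := by
    have h1 : ∀ m : fixedPart e M, f.hom m.1 = g.hom m.1 := fun m =>
      congrArg Subtype.val (LinearMap.congr_fun (congrArg ModuleCat.Hom.hom hfg) m)
    ext m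
    rw [eq_sum_smul_toFixedPart he hxy m]
    simp only [map_sum, map_smul, h1]

/-- If `e` is full then the homomorphisms `eM → eN` extend to `M → N`, through
`m = ∑ x t e y t m`. -/
theorem exists_extension (he : IsIdempotentElem e) (hxy : ∑ t, x t * e * y t = 1)
    {M N : Type*} [AddCommGroup M] [Module R M] [AddCommGroup N] [Module R N]
    (g : fixedPart e M →ₗ[he.Corner] fixedPart e N) :
    ∃ F : M →ₗ[R] N, ∀ m : fixedPart e M, F m.1 = (g m).1 := by
  have hg : ∀ (s : R) (m : fixedPart e M),
      (g (toFixedPart he (s • m.1))).1 = e • s • (g m).1 := by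
    intro s m
    have h1 : toFixedPart he (s • m.1) = toCorner he s • m := Subtype.ext (by
      change e • s • m.1 = (e * s * e) • m.1
      have : e • m.1 = m.1 := m.2
      rw [mul_smul, mul_smul, this])
    have h2 : e • (g m).1 = (g m).1 := (g m).2
    rw [h1, map_smul]
    change (e * s * e) • (g m).1 = _
    rw [mul_smul, mul_smul, h2]
  have hadd : ∀ m m' : M, toFixedPart he (m + m') = toFixedPart he m + toFixedPart he m' :=
    fun m m' => Subtype.ext (smul_add e m m')
  let F : M → N := fun m => ∑ t, x t • (g (toFixedPart he (y t • m))).1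
  have hF : ∀ (r : R) (m : fixedPart e M), F (r • m.1) = r • (g m).1 := by
    intro r m
    simp only [F, ← mul_smul, hg]
    conv_rhs => rw [← one_mul r, ← hxy, Finset.sum_mul, Finset.sum_smul]
    simp only [mul_assoc, mul_smul]
  have hFadd : ∀ m m', F (m + m') = F m + F m' := by
    intro m m'
    simp only [F, smul_add, hadd, map_add, ← Finset.sum_add_distrib, AddSubgroup.coe_add]
  have hFsum : ∀ v : ι → M, F (∑ t, v t) = ∑ t, F (v t) := fun v =>
    map_sum (AddMonoidHom.mk' F hFadd) v Finset.univ
  refine ⟨⟨⟨F, hFadd⟩, fun r m => ?_⟩, fun m => ?_⟩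
  · change F (r • m) = r • F m
    conv_lhs => rw [eq_sum_smul_toFixedPart he hxy m, Finset.smul_sum, hFsum]
    simp only [← mul_smul, hF]
    simp only [F, Finset.smul_sum, mul_smul]
  · have := hF 1 m
    rwa [one_smul, one_smul] at this

theorem fixedPartFunctor_full (he : IsIdempotentElem e) (hxy : ∑ t, x t * e * y t = 1) :
    (fixedPartFunctor he).Full where
  map_surjective {M N} g := by
    obtain ⟨F, hF⟩ := exists_extension he hxy g.hom
    refine ⟨ModuleCat.ofHom F, ?_⟩
    ext m
    exact Subtype.ext (hF m)

section Coinduced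

variable (he : IsIdempotentElem e) (N : Type u) [AddCommGroup N] [Module he.Corner N]

/-- Right multiplication with `r` on `eR`. -/
def mulRightFixedPart (r : R) : fixedPart e R →ₗ[he.Corner] fixedPart e R where
  toFun x := ⟨x.1 * r, by
    change e * (x.1 * r) = x.1 * r
    rw [← mul_assoc]
    exact congrArg (· * r) x.2⟩
  map_add' a b := Subtype.ext (add_mul a.1 b.1 r)
  map_smul' s a := Subtype.ext (mul_assoc s.1 a.1 r)

/-- The `R`-module `Hom(eR, N)`, for an `eRe`-module `N`. -/
def Coinduced : Type u := fixedPart e R →ₗ[he.Corner] N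

instance : AddCommGroup (Coinduced he N) :=
  inferInstanceAs (AddCommGroup (fixedPart e R →ₗ[he.Corner] N))

variable {he N} in
/-- The elements of `Coinduced he N` as linear maps. -/
def Coinduced.hom (φ : Coinduced he N) : fixedPart e R →ₗ[he.Corner] N := φ

instance : Module R (Coinduced he N) where
  smul r φ := LinearMap.comp φ.hom (mulRightFixedPart he r)
  one_smul φ := LinearMap.ext fun a => congrArg φ.hom (Subtype.ext (mul_one a.1))
  mul_smul r s φ := LinearMap.ext fun a =>
    congrArg φ.hom (Subtype.ext (mul_assoc a.1 r s).symm)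
  smul_zero _ := rfl
  smul_add _ _ _ := rfl
  add_smul r s φ := LinearMap.ext fun a =>
    (congrArg φ.hom (Subtype.ext (mul_add a.1 r s))).trans (map_add φ.hom _ _)
  zero_smul φ := LinearMap.ext fun a =>
    (congrArg φ.hom (Subtype.ext (mul_zero a.1))).trans (map_zero φ.hom)

variable {he N} in
theorem Coinduced.hom_smul (r : R) (φ : Coinduced he N) :
    (r • φ).hom = φ.hom ∘ₗ mulRightFixedPart he r := rfl

/-- Right multiplication with `e`, as a map `eR → eRe`. -/
def mulRightCorner : fixedPart e R →ₗ[he.Corner] he.Corner where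
  toFun a := ⟨a.1 * e, a.1, by
    have : e * a.1 = a.1 := a.2
    change e * a.1 * e = _
    rw [this]⟩
  map_add' a b := Subtype.ext (add_mul a.1 b.1 e)
  map_smul' s a := Subtype.ext (mul_assoc s.1 a.1 e)

/-- `e Hom(eR, N) = Hom(eRe, N) = N`. -/
def fixedPartCoinduced : fixedPart e (Coinduced he N) ≃ₗ[he.Corner] N where
  toFun φ := φ.1.hom ⟨e, he⟩
  map_add' _ _ := rfl
  map_smul' s φ := by
    rw [coe_corner_smul, Coinduced.hom_smul, LinearMap.comp_apply, RingHom.id_apply, ← map_smul]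
    exact congrArg φ.1.hom (Subtype.ext ((corner_mul he s).1.trans (corner_mul he s).2.symm))
  invFun v := ⟨LinearMap.comp (LinearMap.toSpanSingleton he.Corner N v) (mulRightCorner he),
    LinearMap.ext fun a =>
      have h : mulRightCorner he (mulRightFixedPart he e a) = mulRightCorner he a :=
        Subtype.ext ((mul_assoc a.1 e e).trans (congrArg (a.1 * ·) he.eq))
      congrArg (LinearMap.toSpanSingleton he.Corner N v) h⟩
  left_inv φ := by
    refine Subtype.ext (LinearMap.ext fun a => ?_)
    have hφ : e • φ.1 = φ.1 := φ.2
    change mulRightCorner he a • φ.1.hom ⟨e, he⟩ = φ.1.hom a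
    conv_rhs => rw [← hφ, Coinduced.hom_smul, LinearMap.comp_apply]
    rw [← map_smul]
    exact congrArg φ.1.hom (Subtype.ext ((mul_assoc a.1 e e).trans (congrArg (a.1 * ·) he.eq)))
  right_inv v := by
    change mulRightCorner he ⟨e, he⟩ • v = v
    conv_rhs => rw [← one_smul he.Corner v]
    exact congrArg (· • v) (Subtype.ext he.eq)

end Coinduced

theorem fixedPartFunctor_essSurj (he : IsIdempotentElem e) : (fixedPartFunctor he).EssSurj where
  mem_essImage N := ⟨ModuleCat.of R (Coinduced he N), ⟨(fixedPartCoinduced he N).toModuleIso⟩⟩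

variable {A : Type*} [CommRing A] [Algebra A R]

open scoped ModuleCat.Algebra in
theorem fixedPartFunctor_linear (he : IsIdempotentElem e) :
    (fixedPartFunctor he).Linear A where
  map_smul {M N} f a := by
    ext m
    refine Subtype.ext ?_
    change algebraMap A R a • f.hom m.1 = (a • e) • f.hom m.1
    have : e • m.1 = m.1 := m.2
    rw [← map_smul, ← map_smul, Algebra.algebraMap_eq_smul_one, ← this, ← mul_smul, ← mul_smul,
      smul_mul_assoc, one_mul, smul_mul_assoc, he.eq]

/-- A ring `R` is Morita equivalent to `eRe` if `ReR = R`. -/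
theorem isMoritaEquivalent_corner (he : IsIdempotentElem e) (hxy : ∑ t, x t * e * y t = 1) :
    IsMoritaEquivalent A R he.Corner := by
  have := fixedPartFunctor_faithful he hxy
  have := fixedPartFunctor_full he hxy
  have := fixedPartFunctor_essSurj he
  have : (fixedPartFunctor he).IsEquivalence := { }
  exact ⟨⟨⟨(fixedPartFunctor he).asEquivalence, fixedPartFunctor_linear he⟩⟩⟩

/-- Transitivity of corners: if `j = eje` then `j(eRe)j = jRj`. -/
def cornerCornerEquiv {e j : R} (he : IsIdempotentElem e) (hj : IsIdempotentElem j)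
    (hej : e * j = j) (hje : j * e = j) {j' : he.Corner} (hj' : IsIdempotentElem j')
    (hjj' : j'.1 = j) : hj'.Corner ≃ₐ[A] hj.Corner where
  toFun z := ⟨z.1.1, z.1.1, by
    obtain ⟨h1, h2⟩ := corner_mul hj' z
    have h1' : j * z.1.1 = z.1.1 := by rw [← hjj']; exact congrArg Subtype.val h1
    have h2' : z.1.1 * j = z.1.1 := by rw [← hjj']; exact congrArg Subtype.val h2
    change j * z.1.1 * j = z.1.1
    rw [h1', h2']⟩
  invFun z := ⟨⟨z.1, z.1, by
    obtain ⟨h1, h2⟩ := corner_mul hj z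
    change e * z.1 * e = z.1
    rw [← h1, ← mul_assoc, hej, h1, ← h2, mul_assoc, hje]⟩, ⟨z.1, z.1, by
    obtain ⟨h1, h2⟩ := corner_mul hj z
    change e * z.1 * e = z.1
    rw [← h1, ← mul_assoc, hej, h1, ← h2, mul_assoc, hje]⟩, Subtype.ext (by
    obtain ⟨h1, h2⟩ := corner_mul hj z
    change j'.1 * z.1 * j'.1 = z.1
    rw [hjj', h1, h2])⟩
  left_inv _ := rfl
  right_inv _ := rfl
  map_mul' _ _ := rfl
  map_add' _ _ := rfl
  commutes' a := Subtype.ext (congrArg (a • ·) hjj')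

/-- If `ReR = RjR` with `j = eje`, then `eRe` and `jRj` are Morita equivalent. -/
theorem isMoritaEquivalent_corner_corner {e j : R} (he : IsIdempotentElem e)
    (hj : IsIdempotentElem j) (hej : e * j = j) (hje : j * e = j)
    (hxy : ∑ t, x t * j * y t = e) : IsMoritaEquivalent A he.Corner hj.Corner := by
  let j' : he.Corner := ⟨j, j, by change e * j * e = j; rw [hej, hje]⟩
  have hj' : IsIdempotentElem j' := Subtype.ext hj
  have hcoe : ∀ z : ι → he.Corner, (∑ t, z t).1 = ∑ t, (z t).1 := fun z =>
    map_sum (⟨⟨Subtype.val, rfl⟩, fun _ _ => rfl⟩ : he.Corner →+ R) z Finset.univ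
  have hsum : ∑ t, toCorner he (x t) * j' * toCorner he (y t) = 1 := by
    refine Subtype.ext ?_
    rw [hcoe]
    have hterm : ∀ t, (toCorner he (x t) * j' * toCorner he (y t)).1
        = e * (x t * j * y t) * e := fun t => by
      change e * x t * e * j * (e * y t * e) = _
      simp only [mul_assoc]
      rw [← mul_assoc j e, hje, ← mul_assoc e j, hej]
    rw [Finset.sum_congr rfl fun t _ => hterm t, ← Finset.sum_mul, ← Finset.mul_sum, hxy, he.eq]
    exact he.eq
  exact (isMoritaEquivalent_corner hj' hsum).trans A
    (IsMoritaEquivalent.of_algEquiv A (cornerCornerEquiv he hj hej hje hj' rfl))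

end Morita

/-! ### The block pair of a basic configuration -/

section Configuration

variable {A 𝕜 𝕃 Ω G : Type*} [CommRing A] [Field 𝕜] [Field 𝕃] [Algebra 𝕜 𝕃]
  [Algebra A 𝕃] [Field Ω] [IsAlgClosed Ω] [Algebra 𝕃 Ω] [Group G]

theorem isIntegral_mul_character {N : Subgroup G} [Finite N] {χ : N → 𝕃}
    (hχ : IsIrreducibleCharacter Ω fun x => algebraMap 𝕃 Ω (χ x))
    (hu : ∃ u : Aˣ, algebraMap A 𝕃 u = χ 1 / Nat.card N) (x : N) :
    IsIntegral A (χ 1 / Nat.card N * χ x) := by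
  obtain ⟨u, hu⟩ := hu
  rw [← hu]
  exact isIntegral_algebraMap.mul (hχ.isIntegral x).tower_top

theorem conj_charIdempotent_eq {N : Subgroup G} [Fintype N] {χ : N → 𝕃} {γ : 𝕃 ≃ₐ[𝕜] 𝕃} {x : G}
    (hN : ∀ g, g ∈ N ↔ x * g * x⁻¹ ∈ N) (hγ : γ (χ 1 / Nat.card N) = χ 1 / Nat.card N)
    (h : ∀ k k' : N, (k' : G) = x * k * x⁻¹ → χ k' = γ (χ k)) :
    conj x (charIdempotent N χ : MonoidAlgebra 𝕃 G) = gal γ (charIdempotent N χ) := by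
  have hmem := charIdempotent_mem (G := G) (χ := χ) (T := ⊤) fun _ => trivial
  ext g
  rw [coeff_conj, coeff_gal]
  by_cases hg : g ∈ N
  · have h1 := coeff_charIdempotent (G := G) χ ⟨g, hg⟩
    have h2 := coeff_charIdempotent (G := G) χ ⟨x * g * x⁻¹, (hN g).mp hg⟩
    simp only at h1 h2
    rw [h1, h2, map_mul, hγ, h (⟨g, hg⟩⁻¹) (⟨x * g * x⁻¹, (hN g).mp hg⟩⁻¹) (by simp [mul_assoc])]
  · rw [(hmem _).2 hg, (hmem _).2 fun h' => hg ((hN g).mpr h'), map_zero]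

theorem mem_fixedCorner_iff {R : Type*} [CommRing R] [Algebra R 𝕃] {K H : Subgroup G} {θ : K → 𝕃}
    {φ : (H ⊓ K : Subgroup G) → 𝕃}
    (hi : idem 𝕜 K H θ φ ∈ coeffSubring (algebraMap R 𝕃).range K)
    (hii : idem 𝕜 K H θ φ * idem 𝕜 K H θ φ = idem 𝕜 K H θ φ) {x : MonoidAlgebra 𝕃 G} :
    x ∈ fixedCorner 𝕜 R K H θ φ ↔ MemCorner (algebraMap R 𝕃).range K H (idem 𝕜 K H θ φ) x := by
  have hK : ∀ {y : MonoidAlgebra 𝕃 G}, (∃ a : MonoidAlgebra R K, embed K.subtype a = y) ↔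
      y ∈ coeffSubring (algebraMap R 𝕃).range K := by
    intro y
    rw [mem_range_embed, Subgroup.range_subtype]
  constructor
  · rintro ⟨⟨a, rfl⟩, hL⟩
    refine ⟨mul_mem (mul_mem hi (hK.mp ⟨a, rfl⟩)) hi, ?_, ?_, fun l hl => ?_⟩
    · simp only [← mul_assoc, hii]
    · simp only [mul_assoc, hii]
    · exact ((conj_eq_iff _ _ _).mp (hL l hl)).symm
  · rintro ⟨hmem, hl, hr, hcomm⟩
    obtain ⟨a, ha⟩ := hK.mpr hmem
    exact ⟨⟨a, by rw [ha, hl, hr]⟩, fun l hl => (conj_eq_iff _ _ _).mpr (hcomm l hl).symm⟩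

variable [CharZero 𝕃]

/-- An automorphism that fixes the central idempotent of a character fixes its field of values. -/
theorem eq_one_of_gal_charIdempotent_eq {N : Subgroup G} [Fintype N] {χ : N → 𝕃}
    (hχ : IsIrreducibleCharacter Ω fun x => algebraMap 𝕃 Ω (χ x))
    (hadj : IntermediateField.adjoin 𝕜 (Set.range χ) = ⊤) {γ : 𝕃 ≃ₐ[𝕜] 𝕃}
    (hγ : γ (χ 1 / Nat.card N) = χ 1 / Nat.card N)
    (h : gal γ (charIdempotent N χ : MonoidAlgebra 𝕃 G) = charIdempotent N χ) : γ = 1 := by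
  have hc : χ 1 / Nat.card N ≠ 0 :=
    div_ne_zero hχ.one_ne_zero (Nat.cast_ne_zero.mpr Nat.card_pos.ne')
  have hfix : ∀ x, γ (χ x) = χ x := by
    intro x
    have h1 := congrArg (fun y => y.coeff ((x⁻¹ : N) : G)) h
    simp only [coeff_gal, coeff_charIdempotent, map_mul, hγ, inv_inv] at h1
    exact mul_left_cancel₀ hc h1
  ext y
  have hy : y ∈ IntermediateField.adjoin 𝕜 (Set.range χ) := hadj ▸ IntermediateField.mem_top
  induction hy using IntermediateField.adjoin_induction with
  | mem y hy => obtain ⟨x, rfl⟩ := hy; exact hfix x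
  | algebraMap a => exact γ.commutes a
  | add y z _ _ hy hz => rw [map_add, hy, hz, map_add]
  | inv y _ hy => rw [map_inv₀, hy, map_inv₀]
  | mul y z _ _ hy hz => rw [map_mul, hy, hz, map_mul]

/-- In a basic configuration the idempotents of the characters form a block pair. -/
theorem BasicConfiguration.isBlockPair [IsLocalRing A] {p : ℕ} [Fact p.Prime]
    [CharP (IsLocalRing.ResidueField A) p] [Finite G] {K H : Subgroup G} [K.Normal]
    [Fintype K] [Fintype (H ⊓ K : Subgroup G)] {θ : K → 𝕃} {φ : (H ⊓ K : Subgroup G) → 𝕃} {n : ℕ}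
    (h : BasicConfiguration 𝕜 Ω p K H θ φ n) {𝒪 : ValuationSubring 𝕃}
    (h𝒪 : ∀ x, x ∈ 𝒪 ↔ IsIntegral A x) :
    IsBlockPair A 𝕜 K H 𝒪 (θ 1 / Nat.card K) (φ 1 / Nat.card (H ⊓ K : Subgroup G))
      (charIdempotent K θ) (charIdempotent (H ⊓ K) φ)
      (charIdempotent K θ * charIdempotent (H ⊓ K) φ) (idem 𝕜 K H θ φ) n := by
  have hu := h.defect_θ.exists_unit (A := A) h.irr_θ.one_ne_zero
  have hu' := h.defect_φ.exists_unit (A := A) h.irr_φ.one_ne_zero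
  have hc : ∀ γ : 𝕃 ≃ₐ[𝕜] 𝕃, γ (θ 1 / Nat.card K) = θ 1 / Nat.card K := fun γ => by
    obtain ⟨d, hd, -⟩ := h.defect_θ
    rw [hd, map_div₀, map_natCast, map_natCast]
  have hc' : ∀ γ : 𝕃 ≃ₐ[𝕜] 𝕃, γ (φ 1 / Nat.card (H ⊓ K : Subgroup G))
      = φ 1 / Nat.card (H ⊓ K : Subgroup G) := fun γ => by
    obtain ⟨d, hd, -⟩ := h.defect_φ
    rw [hd, map_div₀, map_natCast, map_natCast]
  refine
    { mem_iff := h𝒪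
      schur_θ := h.irr_θ.isSchurIdempotent
      schur_φ := h.irr_φ.isSchurIdempotent
      mem_θ := charIdempotent_mem fun x => (h𝒪 _).mpr (isIntegral_mul_character h.irr_θ hu x)
      mem_φ := charIdempotent_mem fun x => (h𝒪 _).mpr (isIntegral_mul_character h.irr_φ hu' x)
      unit_θ := hu
      unit_φ := hu'
      gal_c := hc
      gal_c' := hc'
      gal_θ := fun γ hγ => eq_one_of_gal_charIdempotent_eq h.irr_θ h.adjoin_θ (hc γ) hγ
      gal_φ := fun γ hγ => eq_one_of_gal_charIdempotent_eq h.irr_φ h.adjoin_φ (hc' γ) hγ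
      conj_eq := ?_
      n_pos := h.n_pos
      mult := ?_
      f_eq := rfl
      i_eq := rfl }
  · intro x hx
    obtain ⟨γ, hγ, hγ'⟩ := h.semi_invariant x hx
    have hK : ∀ k, k ∈ K ↔ x * k * x⁻¹ ∈ K := fun k => by
      refine ⟨fun hk => Subgroup.Normal.conj_mem ‹_› k hk x, fun hk => ?_⟩
      simpa [mul_assoc] using Subgroup.Normal.conj_mem (H := K) ‹_› _ hk x⁻¹
    have hL : ∀ l, l ∈ H ⊓ K ↔ x * l * x⁻¹ ∈ H ⊓ K := fun l => by
      rw [Subgroup.mem_inf, Subgroup.mem_inf, ← hK, H.mul_mem_cancel_right (H.inv_mem hx),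
        H.mul_mem_cancel_left hx]
    refine ⟨γ⁻¹, conj_charIdempotent_eq hK (hc _) fun k k' hk => ?_,
      conj_charIdempotent_eq hL (hc' _) fun l l' hl => ?_⟩
    · rw [← hγ k k' hk, ← AlgEquiv.mul_apply, inv_mul_cancel, AlgEquiv.one_apply]
    · rw [← hγ' l l' hl, ← AlgEquiv.mul_apply, inv_mul_cancel, AlgEquiv.one_apply]
  · have hcard : (Nat.card (H ⊓ K : Subgroup G) : 𝕃) ≠ 0 := Nat.cast_ne_zero.mpr Nat.card_pos.ne'
    have hmem := charIdempotent_mem (G := G) (χ := φ) (T := ⊤) fun _ => trivial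
    have hmult := h.mult
    rw [finsum_eq_sum_of_fintype, inv_mul_eq_iff_eq_mul₀ hcard] at hmult
    rw [mul_assoc (_ * _), ← hmult, eq_sum_of_mem_coeffSubring hmem, Finset.mul_sum,
      MonoidAlgebra.coeff_sum, Finsupp.coe_finsetSum, Finset.sum_apply, Finset.mul_sum]
    refine Finset.sum_congr rfl fun l _ => ?_
    have h1 : (charIdempotent K θ : MonoidAlgebra 𝕃 G).coeff (l : G)⁻¹
        = θ 1 / Nat.card K * θ ⟨l, l.2.2⟩ := by
      have := coeff_charIdempotent (G := G) θ (⟨l, l.2.2⟩⁻¹ : K)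
      rwa [inv_inv] at this
    rw [mul_smul_comm, MonoidAlgebra.coeff_smul_apply, coeff_mul_grp, one_mul,
      coeff_charIdempotent, h1, smul_eq_mul]
    ring

end Configuration

end Magic

end

/-! ### The isomorphism and the Morita equivalence -/

theorem theoremt {A 𝕜 𝕃 Ω G : Type*}
    [CommRing A] [IsDomain A] [IsDiscreteValuationRing A]
    [IsAdicComplete (IsLocalRing.maximalIdeal A) A]
    [Field 𝕜] [Algebra A 𝕜] [IsFractionRing A 𝕜] [CharZero 𝕜]
    (p : ℕ) [Fact p.Prime] [CharP (IsLocalRing.ResidueField A) p]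
    [Field 𝕃] [Algebra 𝕜 𝕃] [Algebra A 𝕃] [IsScalarTower A 𝕜 𝕃]
    [Field Ω] [IsAlgClosed Ω] [Algebra 𝕃 Ω]
    [Group G] [Finite G] (K H : Subgroup G) [K.Normal]
    (θ : K → 𝕃) (φ : (H ⊓ K : Subgroup G) → 𝕃) (n : ℕ)
    (hconf : BasicConfiguration 𝕜 Ω p K H θ φ n)
    (E : Fin n → Fin n → MonoidAlgebra 𝕃 G) (hE : IsMatrixUnits A 𝕜 K H θ φ E)
    (σ : MagicCrossedRepresentation 𝕜 K H θ φ E) :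
    ∃ (eθ : MonoidAlgebra A G) (eφ : MonoidAlgebra A H) (j : MonoidAlgebra A G)
      (hθ : IsIdempotentElem eθ) (hφ : IsIdempotentElem eφ) (hj : IsIdempotentElem j),
      embed (MonoidHom.id G) eθ = fieldIdempotent 𝕜 K θ ∧
      embed H.subtype eφ = fieldIdempotent 𝕜 (H ⊓ K) φ ∧
      eθ ∈ Set.center (MonoidAlgebra A G) ∧ eφ ∈ Set.center (MonoidAlgebra A H) ∧
      embed (MonoidHom.id G) j ∈ fixedCorner 𝕜 A K H θ φ ∧
      (∃ f : hφ.Corner ≃ₐ[A] hj.Corner, ∀ h : H,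
        embed (MonoidHom.id G) (f (toCorner hφ (MonoidAlgebra.single h 1))).1 =
          embed (MonoidHom.id G) j * grp (h : G) * σ.inv (h : H ⧸ K.subgroupOf H)) ∧
      (⊤ * Submodule.span A {j} * ⊤ : Submodule A (MonoidAlgebra A G)) =
        ⊤ * Submodule.span A {eθ} ∧
      IsMoritaEquivalent A hθ.Corner hφ.Corner := by
  have : CharZero 𝕃 := charZero_of_injective_algebraMap (algebraMap 𝕜 𝕃).injective
  have := Fintype.ofFinite K
  have := Fintype.ofFinite (H ⊓ K : Subgroup G)
  obtain ⟨_, _⟩ := hconf.irr_θ.isAbelianGalois (𝕜 := 𝕜) hconf.adjoin_θ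
  obtain ⟨𝒪, h𝒪⟩ := exists_valuationSubring_of_isAdicComplete A 𝕜 𝕃
  have hB := hconf.isBlockPair (A := A) h𝒪
  have hfac := hconf.factor
  have hiA := hB.i_mem
  have hik := coeffSubring_mono (range_algebraMap_le (A := A) (𝕜 := 𝕜) (𝕃 := 𝕃)) (le_refl K) hiA
  have hii := hB.i_mul_i
  have hU : IsCornerUnits A K H (idem 𝕜 K H θ φ) E :=
    ⟨fun a b => (mem_fixedCorner_iff hiA hii).mp (hE.mem a b), hE.mul, hE.sum⟩
  have hσ : IsMagicCrossed 𝕜 K H (idem 𝕜 K H θ φ) E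
      (fun x : H => σ.toFun (x : H ⧸ K.subgroupOf H))
      (fun x : H => σ.inv (x : H ⧸ K.subgroupOf H)) :=
    { mem := fun x => (mem_fixedCorner_iff hik hii).mp (σ.mem x)
      inv_mem := fun x => (mem_fixedCorner_iff hik hii).mp (σ.inv_mem x)
      mul_inv := fun x => σ.mul_inv x
      inv_mul := fun x => σ.inv_mul x
      crossed := fun x y => σ.crossed x y
      conj_eq := fun x s hs => σ.conj_eq x s ((mem_fixedCorner_iff hik hii).mpr hs)
      coset := fun x hx => congrArg σ.toFun (QuotientGroup.eq.mpr (by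
        rw [mul_one]
        exact (K.subgroupOf H).inv_mem (Subgroup.mem_subgroupOf.mpr hx))) }
  let o : Fin n := ⟨0, hconf.n_pos⟩
  have hinj := embed_injective_of_isFractionRing (A := A) (𝕃 := 𝕃) (ν := MonoidHom.id G) 𝕜
    Function.injective_id
  have hinjH : Function.Injective
      (embed H.subtype : MonoidAlgebra A H →+* MonoidAlgebra 𝕃 G) :=
    embed_injective_of_isFractionRing 𝕜 H.subtype_injective
  have hle : ∀ N : Subgroup G, N ≤ (MonoidHom.id G).range := fun _ g _ => ⟨g, rfl⟩
  obtain ⟨eθ, heθ⟩ := (mem_range_embed (R := A) (ν := MonoidHom.id G)).mpr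
    (coeffSubring_mono le_rfl (hle K) (galoisTrace_mem_coeffSubring (𝕜 := 𝕜) h𝒪 hB.mem_θ))
  obtain ⟨eφ, heφ⟩ := (mem_range_embed (R := A) (ν := H.subtype)).mpr
    (coeffSubring_mono le_rfl (by rw [Subgroup.range_subtype]; exact inf_le_left)
      (galoisTrace_mem_coeffSubring (𝕜 := 𝕜) h𝒪 hB.mem_φ))
  obtain ⟨j, hjE⟩ := (mem_range_embed (R := A) (ν := MonoidHom.id G)).mpr
    (coeffSubring_mono le_rfl (hle K) (hU.mem o o).mem)
  have hθ : IsIdempotentElem eθ := hinj (by rw [map_mul, heθ, hB.galoisTrace_θ_mul_self])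
  have hφ : IsIdempotentElem eφ := hinjH (by rw [map_mul, heφ, hB.galoisTrace_φ_mul_self])
  have hj : IsIdempotentElem j := hinj (by rw [map_mul, hjE, hU.mul, if_pos rfl])
  have hcenter : ∀ r, r * eθ = eθ * r := fun r => hinj (by
    rw [map_mul, map_mul, heθ]
    exact commute_of_mem_coeffSubring (fun g _ => hB.grp_mul_galoisTrace_θ hfac g)
      (embed_mem (MonoidHom.id G) r))
  have hcenterH : ∀ r, r * eφ = eφ * r := fun r => hinjH (by
    rw [map_mul, map_mul, heφ]
    exact commute_of_mem_coeffSubring (fun g hg => hB.grp_mul_galoisTrace_φ (by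
      rwa [Subgroup.range_subtype] at hg)) (embed_mem H.subtype r))
  have hθj : eθ * j = j := hinj (by
    rw [map_mul, heθ, hjE, ← (hU.mem o o).left, ← mul_assoc, hB.galoisTrace_θ_mul_i])
  have hjθ : j * eθ = j := (hcenter j).trans hθj
  obtain ⟨x, y, hxy⟩ := hB.exists_sum_mul_mul_eq hU heθ hjE
  obtain ⟨Φ, hΦ⟩ := hB.exists_algEquiv_corner hU hσ hj hjE hfac hφ heφ
  refine ⟨eθ, eφ, j, hθ, hφ, hj, heθ, heφ, Semigroup.mem_center_iff.mpr hcenter,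
    Semigroup.mem_center_iff.mpr hcenterH, hjE ▸ hE.mem o o, ⟨Φ, fun h => ?_⟩,
    top_mul_span_mul_top_eq hcenter hjθ hxy, ?_⟩
  · rw [hΦ, hjE, mul_assoc]
  · exact (isMoritaEquivalent_corner_corner hθ hj hθj hjθ hxy).trans A
      (IsMoritaEquivalent.of_algEquiv A Φ.symm)
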